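/- Let $k$ be a commutative $\mathbb{C}$-algebra that is finitely generated as an algebra, and let $A$ be a unital associative (not necessarily commutative) $k$-algebra that is finitely generated as a $k$-module. Let $g : A \to A$ be a unital $\mathbb{C}$-algebra endomorphism for which there is a $\mathbb{C}$-algebra endomorphism $\sigma$ of $k$ with $g(za) = \sigma(z)g(a)$ for all $z \in k$, $a \in A$. All tensor products without subscript are over $\mathbb{C}$. For $q \ge 0$ let $\mathcal{B}_q(A) := A \otimes (A/\mathbb{C}1)^{\otimes q}$, with $k$ acting on the first factor, and let $b_g : \mathcal{B}_n(A) \to \mathcal{B}_{n-1}(A)$ be the $k$-linear differential $$b_g(a_0 \otimes \cdots \otimes a_n) = a_0 g(a_1) \otimes a_2 \otimes \cdots \otimes a_n + \sum_{i=1}^{n-1} (-1)^i a_0 \otimes \cdots \otimes a_i a_{i+1} \otimes \cdots \otimes a_n + (-1)^n a_n a_0 \otimes a_1 \otimes \cdots \otimes a_{n-1}.$$ Let $HH_q(A,g)$ be the $q$-th homology of $(\mathcal{B}_*(A), b_g)$. Then: 1. $HH_q(A,g)$ is a finitely generated $k$-module for every $q \ge 0$. 2. Let $I_0 \subseteq k$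 be an ideal such that $I := I_0 A$ satisfies $g(I) \subseteq I$ (this is automatic if $g$ is $k$-linear), and let $\widehat{k} := \varprojlim_n k/I_0^n$. Let $HH^{top}_q(\widehat{A},g)$ be the $q$-th homology of the completed complex $\widehat{\mathcal{B}}_*(\widehat A) := \varprojlim_m \mathcal{B}_*(A/I^m)$ with the differential induced by $b_g$; it is a $\widehat{k}$-module. Then, for every $q \ge 0$, the natural map $\iota : HH_q(A,g) \to HH^{top}_q(\widehat{A},g)$ induced by the projections $A \to A/I^m$ extends to an isomorphism of modules $$HH_q(A,g) \otimes_k \widehat{k} \xrightarrow{\ \simeq\ } HH^{top}_q(\widehat{A},g), \qquad x \otimes c \mapsto c\,\iota(x).$$ -/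

import Mathlib

open scoped TensorProduct

noncomputable section

namespace TwistedHochschild

universe u v

/-! ### Multilinear maps that descend to quotients -/

section Descend

variable {V W : Type*} [AddCommGroup V] [Module ℂ V] [AddCommGroup W] [Module ℂ W]

theorem multilinear_eq_of_sub_mem {n : ℕ} (p : Submodule ℂ V)
    (f : MultilinearMap ℂ (fun _ : Fin n => V) W)
    (hf : ∀ (a : Fin n → V) (i : Fin n), a i ∈ p → f a = 0)
    (a b : Fin n → V) (hab : ∀ i, a i - b i ∈ p) : f a = f b := by
  have key : ∀ s : Finset (Fin n), f (s.piecewise a b) = f b := by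
    intro s
    induction s using Finset.induction_on with
    | empty => simp
    | insert i s hi ih =>
      rw [Finset.piecewise_insert, ← ih]
      have h1 : s.piecewise a b = Function.update (s.piecewise a b) i (b i) := by
        rw [eq_comm, Function.update_eq_self_iff]
        simp [hi]
      rw [← sub_eq_zero]
      conv_lhs => rw [h1]
      rw [Function.update_idem, ← MultilinearMap.map_update_sub]
      exact hf _ i (by simpa using hab i)
  simpa using key Finset.univ

/-- A multilinear map on `V` that vanishes as soon as one argument lies in `p`, regarded as a
multilinear map on `V ⧸ p`. -/
def descend {n : ℕ} (p : Submodule ℂ V) (f : MultilinearMap ℂ (fun _ : Fin n => V) W)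
    (hf : ∀ (a : Fin n → V) (i : Fin n), a i ∈ p → f a = 0) :
    MultilinearMap ℂ (fun _ : Fin n => V ⧸ p) W where
  toFun x := f fun i => (x i).out
  map_update_add' := by
    intro _ x i y z
    have e (w : V ⧸ p) : (f fun j => (Function.update x i w j).out)
        = f (Function.update (fun j => (x j).out) i w.out) := by
      congr 1; funext j
      by_cases h : j = i
      · subst h; simp
      · simp [h]
    rw [e, e, e, ← MultilinearMap.map_update_add]
    refine multilinear_eq_of_sub_mem p f hf _ _ fun j => ?_
    by_cases h : j = i
    · subst h
      rw [← Submodule.Quotient.eq]; simp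
    · simp [h]
  map_update_smul' := by
    intro _ x i c y
    have e (w : V ⧸ p) : (f fun j => (Function.update x i w j).out)
        = f (Function.update (fun j => (x j).out) i w.out) := by
      congr 1; funext j
      by_cases h : j = i
      · subst h; simp
      · simp [h]
    rw [e, e, ← MultilinearMap.map_update_smul]
    refine multilinear_eq_of_sub_mem p f hf _ _ fun j => ?_
    by_cases h : j = i
    · subst h
      rw [← Submodule.Quotient.eq]; simp
    · simp [h]

theorem descend_mk {n : ℕ} (p : Submodule ℂ V) (f : MultilinearMap ℂ (fun _ : Fin n => V) W)
    (hf : ∀ (a : Fin n → V) (i : Fin n), a i ∈ p → f a = 0) (a : Fin n → V) :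
    descend p f hf (fun i => p.mkQ (a i)) = f a := by
  refine multilinear_eq_of_sub_mem p f hf _ _ fun j => ?_
  rw [← Submodule.Quotient.eq]; simp

end Descend

/-! ### The normalized twisted Hochschild complex -/

section Complex

variable (A : Type v) [Ring A] [Algebra ℂ A]

/-- `A / ℂ1`. -/
abbrev Bar : Type v := A ⧸ Submodule.span ℂ {(1 : A)}

/-- `𝓑_q(A) = A ⊗ (A / ℂ1)^{⊗ q}`, tensor products over `ℂ`. -/
abbrev Chain (q : ℕ) : Type v := A ⊗[ℂ] PiTensorProduct ℂ (fun _ : Fin q => Bar A)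

variable {A}

/-- The chain `a₀ ⊗ a₁ ⊗ ⋯ ⊗ a_q`, with `a₁, …, a_q` given as `a : Fin q → A`. -/
def tensor {q : ℕ} (a₀ : A) (a : Fin q → A) : Chain A q :=
  a₀ ⊗ₜ[ℂ] PiTensorProduct.tprod ℂ fun i => (Submodule.span ℂ {(1 : A)}).mkQ (a i)

/-- The entry in position `0` of the `j`-th face of `a₀ ⊗ a₁ ⊗ ⋯ ⊗ a_{q+1}`: it is `a₀ g(a₁)` for
`j = 0`, `a_{q+1} a₀` for `j = q + 1`, and `a₀` otherwise. -/
def faceHead (g : A → A) {q : ℕ} (j : ℕ) (a₀ : A) (a : Fin (q + 1) → A) : A :=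
  if j = 0 then a₀ * g (a 0) else if j = q + 1 then a (Fin.last q) * a₀ else a₀

/-- The other entries of the `j`-th face of `a₀ ⊗ a₁ ⊗ ⋯ ⊗ a_{q+1}`: they are
`a₂, …, a_{q+1}` for `j = 0`, `a₁, …, a_j a_{j+1}, …, a_{q+1}` for `1 ≤ j ≤ q`, and
`a₁, …, a_q` for `j = q + 1`. -/
def faceTail {q : ℕ} (j : ℕ) (a : Fin (q + 1) → A) (i : Fin q) : A :=
  if (i : ℕ) + 1 < j then a i.castSucc
  else if (i : ℕ) + 1 = j then a i.castSucc * a i.succ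
  else a i.succ

theorem tensor_eq_zero {q : ℕ} (a₀ : A) (a : Fin q → A) (i : Fin q) (h : a i = 1) :
    tensor a₀ a = 0 := by
  unfold tensor
  rw [(PiTensorProduct.tprod ℂ).map_coord_zero i, TensorProduct.tmul_zero]
  simp [h, Submodule.mem_span_singleton_self]

theorem tensor_update_add {q : ℕ} (a₀ : A) (a : Fin q → A) (i : Fin q) (x y : A) :
    tensor a₀ (Function.update a i (x + y)) =
      tensor a₀ (Function.update a i x) + tensor a₀ (Function.update a i y) := by
  simp only [tensor, ← TensorProduct.tmul_add]
  congr 1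
  exact ((PiTensorProduct.tprod ℂ).compLinearMap
    (fun _ : Fin q => (Submodule.span ℂ {(1 : A)}).mkQ)).map_update_add a i x y

theorem tensor_update_smul {q : ℕ} (a₀ : A) (a : Fin q → A) (i : Fin q) (c : ℂ) (x : A) :
    tensor a₀ (Function.update a i (c • x)) = c • tensor a₀ (Function.update a i x) := by
  simp only [tensor, ← TensorProduct.tmul_smul]
  congr 1
  exact ((PiTensorProduct.tprod ℂ).compLinearMap
    (fun _ : Fin q => (Submodule.span ℂ {(1 : A)}).mkQ)).map_update_smul a i c x

/-- How a face depends on one of the entries. -/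
theorem face_update (g : A →ₐ[ℂ] A) {q : ℕ} (j : ℕ) (hj : j ≤ q + 1) (a₀ : A)
    (a : Fin (q + 1) → A) (p : Fin (q + 1)) :
    (∃ φ : A →ₗ[ℂ] A, ∀ x, faceHead g j a₀ (Function.update a p x) = φ x ∧
      faceTail j (Function.update a p x) = faceTail j a) ∨
    (∃ (φ : A →ₗ[ℂ] A) (i : Fin q), ∀ x,
      faceHead g j a₀ (Function.update a p x) = faceHead g j a₀ a ∧
      faceTail j (Function.update a p x) = Function.update (faceTail j a) i (φ x)) := by
  by_cases h0 : j = 0 ∧ (p : ℕ) = 0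
  · obtain ⟨rfl, hp⟩ := h0
    obtain rfl : p = 0 := Fin.ext hp
    refine Or.inl ⟨(LinearMap.mulLeft ℂ a₀) ∘ₗ g.toLinearMap, fun x => ⟨by simp [faceHead], ?_⟩⟩
    funext i
    simp [faceTail]
  by_cases h1 : j = q + 1 ∧ (p : ℕ) = q
  · obtain ⟨rfl, hp⟩ := h1
    obtain rfl : p = Fin.last q := Fin.ext hp
    refine Or.inl ⟨LinearMap.mulRight ℂ a₀, fun x => ⟨by simp [faceHead], ?_⟩⟩
    funext i
    simp [faceTail, (Fin.castSucc_lt_last i).ne]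
  have hp := p.isLt
  refine Or.inr ?_
  have hhead : ∀ x, faceHead g j a₀ (Function.update a p x) = faceHead g j a₀ a := by
    intro x
    have e0 : j = 0 → (0 : Fin (q + 1)) ≠ p := fun h h' => h0 ⟨h, by rw [← h']; rfl⟩
    have e1 : j = q + 1 → Fin.last q ≠ p := fun h h' => h1 ⟨h, by rw [← h']; rfl⟩
    simp only [faceHead]
    split_ifs with h h'
    · rw [Function.update_of_ne (e0 h)]
    · rw [Function.update_of_ne (e1 h')]
    · rfl
  by_cases hpj : (p : ℕ) < j
  · have hpq : (p : ℕ) < q := by omega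
    refine ⟨if (p : ℕ) + 1 = j then LinearMap.mulRight ℂ (a (Fin.succ ⟨p, hpq⟩))
      else LinearMap.id, ⟨p, hpq⟩, fun x => ⟨hhead x, ?_⟩⟩
    funext i
    simp only [faceTail, Function.update_apply, Fin.ext_iff, Fin.val_castSucc, Fin.val_succ]
    split_ifs <;> first | omega | rfl | skip
    · have hi : i = ⟨p, hpq⟩ := Fin.ext (by omega)
      simp [hi]
  · refine ⟨if (p : ℕ) = j then LinearMap.mulLeft ℂ (a (Fin.castSucc ⟨p - 1, by omega⟩))
      else LinearMap.id, ⟨p - 1, by omega⟩, fun x => ⟨hhead x, ?_⟩⟩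
    funext i
    simp only [faceTail, Function.update_apply, Fin.ext_iff, Fin.val_castSucc, Fin.val_succ]
    split_ifs <;> first | omega | rfl | skip
    · have hi : i = ⟨p - 1, by omega⟩ := Fin.ext (by simp; omega)
      simp [hi]

theorem tensor_add_left {q : ℕ} (x y : A) (a : Fin q → A) :
    tensor (x + y) a = tensor x a + tensor y a := TensorProduct.add_tmul _ _ _

theorem tensor_smul_left {q : ℕ} (c : ℂ) (x : A) (a : Fin q → A) :
    tensor (c • x) a = c • tensor x a := (TensorProduct.smul_tmul' _ _ _).symm

/-- The `j`-th face of `a₀ ⊗ a₁ ⊗ ⋯ ⊗ a_{q+1}`, as a multilinear function of `a₁, …, a_{q+1}`. -/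
def face (g : A →ₐ[ℂ] A) {q : ℕ} (j : Fin (q + 2)) (a₀ : A) :
    MultilinearMap ℂ (fun _ : Fin (q + 1) => A) (Chain A q) where
  toFun a := tensor (faceHead g j a₀ a) (faceTail j a)
  map_update_add' := by
    intro dec a p x y
    obtain rfl : dec = instDecidableEqFin _ := Subsingleton.elim _ _
    rcases face_update g j (by omega) a₀ a p with ⟨φ, h⟩ | ⟨φ, i, h⟩
    · simp only [h, map_add, tensor_add_left]
    · simp only [h, map_add, tensor_update_add]
  map_update_smul' := by
    intro dec a p c x
    obtain rfl : dec = instDecidableEqFin _ := Subsingleton.elim _ _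
    rcases face_update g j (by omega) a₀ a p with ⟨φ, h⟩ | ⟨φ, i, h⟩
    · simp only [h, map_smul, tensor_smul_left]
    · simp only [h, map_smul, tensor_update_smul]

/-- `b_g (a₀ ⊗ a₁ ⊗ ⋯ ⊗ a_{q+1})`, the alternating sum of the faces, as a multilinear function of
`a₁, …, a_{q+1}`. -/
def boundaryAux (g : A →ₐ[ℂ] A) (q : ℕ) (a₀ : A) :
    MultilinearMap ℂ (fun _ : Fin (q + 1) => A) (Chain A q) :=
  ∑ j : Fin (q + 2), (-1 : ℂ) ^ (j : ℕ) • face g j a₀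

theorem boundaryAux_apply (g : A →ₐ[ℂ] A) (q : ℕ) (a₀ : A) (a : Fin (q + 1) → A) :
    boundaryAux g q a₀ a =
      ∑ j : Fin (q + 2), (-1 : ℂ) ^ (j : ℕ) • tensor (faceHead g j a₀ a) (faceTail j a) := by
  simp [boundaryAux, face]

theorem boundaryAux_one (g : A →ₐ[ℂ] A) (q : ℕ) (a₀ : A) (a : Fin (q + 1) → A)
    (p : Fin (q + 1)) (hp : a p = 1) : boundaryAux g q a₀ a = 0 := by
  rw [boundaryAux_apply]
  have hpl := p.isLt
  rw [Fintype.sum_eq_add p.castSucc p.succ]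
  · have hH : faceHead g (p.succ : ℕ) a₀ a = faceHead g (p.castSucc : ℕ) a₀ a := by
      have e0 : (p : ℕ) = 0 → a 0 = 1 := fun h => by
        rw [← hp]; congr 1; exact Fin.ext h.symm
      have e1 : (p : ℕ) = q → a (Fin.last q) = 1 := fun h => by
        rw [← hp]; congr 1; exact Fin.ext h.symm
      simp only [faceHead, Fin.val_succ, Fin.val_castSucc]
      split_ifs <;> first | omega | simp_all
    have hT : faceTail (p.succ : ℕ) a = faceTail (p.castSucc : ℕ) a := by
      funext i
      have e0 : (p : ℕ) = i → a i.castSucc = 1 := fun h => by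
        rw [← hp]; congr 1; exact Fin.ext h.symm
      have e1 : (p : ℕ) = i + 1 → a i.succ = 1 := fun h => by
        rw [← hp]; congr 1; exact Fin.ext h.symm
      simp only [faceTail, Fin.val_succ, Fin.val_castSucc]
      split_ifs <;> first | omega | rfl | skip
      · rw [e1 (by omega), mul_one]
      · rw [e0 (by omega), one_mul]
    rw [hH, hT, ← add_smul, Fin.val_succ, Fin.val_castSucc, pow_succ]
    simp
  · exact (Fin.castSucc_lt_succ).ne
  · rintro j ⟨h1, h2⟩
    have h1' : (j : ℕ) ≠ p := fun h => h1 (Fin.ext h)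
    have h2' : (j : ℕ) ≠ p + 1 := fun h => h2 (Fin.ext h)
    have hj := j.isLt
    by_cases h : (j : ℕ) < p
    · rw [tensor_eq_zero _ _ ⟨p - 1, by omega⟩, smul_zero]
      simp only [faceTail]
      rw [if_neg (by omega), if_neg (by omega), ← hp]
      congr 1; ext; simp; omega
    · rw [tensor_eq_zero _ _ ⟨p, by omega⟩, smul_zero]
      simp only [faceTail]
      rw [if_pos (by omega), ← hp]
      rfl

theorem boundaryAux_eq_zero (g : A →ₐ[ℂ] A) (q : ℕ) (a₀ : A) (a : Fin (q + 1) → A)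
    (p : Fin (q + 1)) (hp : a p ∈ Submodule.span ℂ {(1 : A)}) : boundaryAux g q a₀ a = 0 := by
  obtain ⟨c, hc⟩ := Submodule.mem_span_singleton.1 hp
  rw [← Function.update_eq_self p a, ← hc, MultilinearMap.map_update_smul,
    boundaryAux_one g q a₀ _ p (by simp), smul_zero]

theorem boundaryAux_add (g : A →ₐ[ℂ] A) (q : ℕ) (x y : A) :
    boundaryAux g q (x + y) = boundaryAux g q x + boundaryAux g q y := by
  ext a
  simp only [add_apply, boundaryAux_apply, ← Finset.sum_add_distrib, ← smul_add,
    ← tensor_add_left]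
  refine Finset.sum_congr rfl fun j _ => ?_
  congr 2
  simp only [faceHead]
  split_ifs <;> simp [add_mul, mul_add]

variable (R : Type u) [CommRing R] [Algebra ℂ R] [Algebra R A] [IsScalarTower ℂ R A]

theorem boundaryAux_smul (g : A →ₐ[ℂ] A) (q : ℕ) (z : R) (x : A) (a : Fin (q + 1) → A) :
    boundaryAux g q (z • x) a = z • boundaryAux g q x a := by
  simp only [boundaryAux_apply, Finset.smul_sum, smul_comm z ((_ : ℂ) ^ _)]
  refine Finset.sum_congr rfl fun j _ => ?_
  congr 1
  rw [tensor, tensor, TensorProduct.smul_tmul']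
  congr 1
  simp only [faceHead]
  split_ifs <;> simp

/-- The twisted Hochschild boundary `b_g : 𝓑_{q+1}(A) → 𝓑_q(A)`,
`b_g (a₀ ⊗ ⋯ ⊗ a_n) = a₀ g(a₁) ⊗ a₂ ⊗ ⋯ ⊗ a_n
  + ∑_{0 < i < n} (-1)^i a₀ ⊗ ⋯ ⊗ a_i a_{i+1} ⊗ ⋯ ⊗ a_n + (-1)^n a_n a₀ ⊗ a₁ ⊗ ⋯ ⊗ a_{n-1}`
with `n = q + 1`. It is linear over every commutative ring `R` over which `A` is an algebra,
where `R` acts on the factor `a₀`. -/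
def boundary (g : A →ₐ[ℂ] A) (q : ℕ) : Chain A (q + 1) →ₗ[R] Chain A q :=
  TensorProduct.AlgebraTensorModule.lift
    { toFun := fun a₀ => PiTensorProduct.lift
        (descend _ (boundaryAux g q a₀) (boundaryAux_eq_zero g q a₀))
      map_add' := fun x y => by
        ext a
        simp [descend, boundaryAux_add]
      map_smul' := fun z x => by
        ext a
        simp [descend, boundaryAux_smul] }

theorem boundary_tensor (g : A →ₐ[ℂ] A) (q : ℕ) (a₀ : A) (a : Fin (q + 1) → A) :
    boundary R g q (tensor a₀ a) =
      ∑ j : Fin (q + 2), (-1 : ℂ) ^ (j : ℕ) • tensor (faceHead g j a₀ a) (faceTail j a) := by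
  rw [← boundaryAux_apply, boundary, tensor, TensorProduct.AlgebraTensorModule.lift_tmul]
  exact (PiTensorProduct.lift.tprod _).trans (descend_mk _ _ _ a)

variable {R} in
theorem chain_hom_ext {M : Type*} [AddCommGroup M] [Module R M] {q : ℕ}
    {f₁ f₂ : Chain A q →ₗ[R] M} (h : ∀ a₀ a, f₁ (tensor a₀ a) = f₂ (tensor a₀ a)) : f₁ = f₂ := by
  let _ : Module ℂ M := Module.compHom M (algebraMap ℂ R)
  have _ : IsScalarTower ℂ R M := .of_algebraMap_smul fun _ _ => rfl
  refine TensorProduct.AlgebraTensorModule.ext fun a₀ t => ?_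
  induction t using PiTensorProduct.induction_on with
  | smul_tprod r x =>
    have hx : x = fun i => (Submodule.span ℂ {(1 : A)}).mkQ (x i).out := by
      funext i; simp
    rw [TensorProduct.tmul_smul, ← algebraMap_smul R r, map_smul, map_smul, hx]
    congr 1
    exact h _ _
  | add x y hx hy => rw [TensorProduct.tmul_add, map_add, map_add, hx, hy]

theorem face_face_head (g : A →ₐ[ℂ] A) (q i j : ℕ) (hij : i < j) (hj : j ≤ q + 2) (a₀ : A)
    (a : Fin (q + 2) → A) :
    faceHead g i (faceHead g j a₀ a) (faceTail j a) =
      faceHead g (j - 1) (faceHead g i a₀ a) (faceTail i a) := by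
  have hl : (Fin.last q).succ = Fin.last (q + 1) := rfl
  simp only [faceHead, faceTail, Fin.val_zero, Fin.val_last, Fin.castSucc_zero, hl]
  obtain rfl | hi := Nat.eq_zero_or_pos i
  · obtain rfl | hj1 : j = 1 ∨ 1 < j := by omega
    · simp [mul_assoc]
    · obtain rfl | hj2 : j = q + 2 ∨ j < q + 2 := by omega
      · simp [mul_assoc]
      · simp [hj1, hj2.ne, show ¬ j - 1 = 0 by omega, show ¬ j = 0 by omega]
  · obtain rfl | hj2 : j = q + 2 ∨ j < q + 2 := by omega
    · obtain rfl | hi2 : i = q + 1 ∨ i < q + 1 := by omega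
      · simp [mul_assoc]
      · simp [hi.ne', hi2.ne, show ¬ i = q + 2 by omega, show ¬ q + 1 < i by omega,
          show ¬ q + 1 = i by omega]
    · simp [hi.ne', hj2.ne, show ¬ j - 1 = 0 by omega, show ¬ j = 0 by omega,
        show ¬ i = q + 1 by omega, show ¬ i = q + 2 by omega]

theorem face_face_tail (q i j : ℕ) (hij : i < j) (a : Fin (q + 2) → A) :
    faceTail i (faceTail j a) = faceTail (j - 1) (faceTail i a) := by
  funext l
  simp only [faceTail, Fin.val_succ, Fin.val_castSucc]
  split_ifs <;> first | omega | rfl | skip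
  rw [mul_assoc]; rfl

theorem alternating_sum_eq_zero {M : Type*} [AddCommGroup M] [Module ℂ M] (n : ℕ)
    (F : ℕ → ℕ → M) (hF : ∀ i j, i < j → j ≤ n → F j i = F i (j - 1)) :
    ∑ x ∈ Finset.range (n + 1) ×ˢ Finset.range n, (-1 : ℂ) ^ (x.1 + x.2) • F x.1 x.2 = 0 := by
  refine Finset.sum_involution
    (fun x _ => if x.2 < x.1 then (x.2, x.1 - 1) else (x.2 + 1, x.1)) ?_ ?_ ?_ ?_
  · rintro ⟨j, i⟩ hx
    simp only [Finset.mem_product, Finset.mem_range] at hx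
    by_cases h : i < j
    · obtain ⟨m, rfl⟩ : ∃ m, j = m + 1 := ⟨j - 1, by omega⟩
      simp only [h, if_true, hF i (m + 1) h (by omega), ← add_smul, Nat.add_sub_cancel]
      rw [show m + 1 + i = (i + m) + 1 by omega, pow_succ]
      simp
    · simp only [h, if_false, hF j (i + 1) (by omega) (by omega), ← add_smul, Nat.add_sub_cancel]
      rw [show i + 1 + j = (j + i) + 1 by omega, pow_succ]
      simp
  · rintro ⟨j, i⟩ hx - h
    dsimp only at h
    split_ifs at h <;> simp only [Prod.mk.injEq] at h <;> omega
  · rintro ⟨j, i⟩ hx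
    simp only [Finset.mem_product, Finset.mem_range] at hx ⊢
    split_ifs <;> dsimp only <;> omega
  · rintro ⟨j, i⟩ hx
    dsimp only
    split_ifs <;> first | omega | skip
    · exact Prod.ext (Nat.sub_add_cancel (by omega)) rfl
    · rfl

theorem boundary_comp_boundary (g : A →ₐ[ℂ] A) (q : ℕ) :
    boundary R g q ∘ₗ boundary R g (q + 1) = 0 := by
  refine chain_hom_ext fun a₀ a => ?_
  have hs (c : ℂ) (x : Chain A (q + 1)) : boundary R g q (c • x) = c • boundary R g q x := by
    rw [← algebraMap_smul R c, map_smul, algebraMap_smul]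
  rw [LinearMap.comp_apply, boundary_tensor, map_sum, LinearMap.zero_apply,
    ← alternating_sum_eq_zero (q + 2)
      (fun j i => tensor (faceHead g i (faceHead g j a₀ a) (faceTail j a))
        (faceTail i (faceTail j a)))
      (fun i j hij hj => by
        rw [face_face_head g q i j hij hj, face_face_tail q i j hij]),
    Finset.sum_product, Finset.sum_range]
  refine Finset.sum_congr rfl fun j _ => ?_
  rw [hs, boundary_tensor, Finset.sum_range, Finset.smul_sum]
  simp only [smul_smul, pow_add]

/-- The morphism of complexes induced by a homomorphism of algebras. -/
def chainMap {A' : Type*} [Ring A'] [Algebra ℂ A'] [Algebra R A'] [IsScalarTower ℂ R A']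
    (f : A →ₐ[R] A') (q : ℕ) : Chain A q →ₗ[R] Chain A' q :=
  TensorProduct.AlgebraTensorModule.map f.toLinearMap
    (PiTensorProduct.map fun _ => Submodule.mapQ _ _ (f.toLinearMap.restrictScalars ℂ)
      (by rw [Submodule.span_le]; simp [Submodule.mem_span_singleton_self]))

theorem chainMap_tensor {A' : Type*} [Ring A'] [Algebra ℂ A'] [Algebra R A'] [IsScalarTower ℂ R A']
    (f : A →ₐ[R] A') {q : ℕ} (a₀ : A) (a : Fin q → A) :
    chainMap R f q (tensor a₀ a) = tensor (f a₀) (f ∘ a) := by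
  simp [chainMap, tensor]

theorem boundary_chainMap {A' : Type*} [Ring A'] [Algebra ℂ A'] [Algebra R A']
    [IsScalarTower ℂ R A'] (f : A →ₐ[R] A') (g : A →ₐ[ℂ] A) (g' : A' →ₐ[ℂ] A')
    (h : ∀ a, f (g a) = g' (f a)) (q : ℕ) :
    boundary R g' q ∘ₗ chainMap R f (q + 1) = chainMap R f q ∘ₗ boundary R g q := by
  refine chain_hom_ext fun a₀ a => ?_
  have hs (c : ℂ) (x : Chain A q) : chainMap R f q (c • x) = c • chainMap R f q x := by
    rw [← algebraMap_smul R c, map_smul, algebraMap_smul]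
  simp only [LinearMap.comp_apply, chainMap_tensor, boundary_tensor, map_sum, hs]
  refine Finset.sum_congr rfl fun j _ => ?_
  congr 2
  · simp only [faceHead, Function.comp_apply, ← h, ← map_mul]
    split_ifs <;> rfl
  · funext i
    simp only [faceTail, Function.comp_apply, ← map_mul]
    split_ifs <;> rfl

end Complex

/-! ### Homology of a chain complex of modules -/

section Homology

variable {R : Type*} [CommRing R] {C : ℕ → Type*} [∀ q, AddCommGroup (C q)] [∀ q, Module R (C q)]

/-- The cycles of `C₀ ← C₁ ← C₂ ← ⋯`. -/
def cycles (d : ∀ q, C (q + 1) →ₗ[R] C q) : ∀ q, Submodule R (C q)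
  | 0 => ⊤
  | q + 1 => LinearMap.ker (d q)

/-- The homology of `C₀ ← C₁ ← C₂ ← ⋯`: cycles modulo boundaries. -/
abbrev Homology (d : ∀ q, C (q + 1) →ₗ[R] C q) (q : ℕ) : Type _ :=
  cycles d q ⧸ (LinearMap.range (d q)).submoduleOf (cycles d q)

variable {S : Type*} [CommRing S] [Algebra R S] {D : ℕ → Type*} [∀ q, AddCommGroup (D q)]
  [∀ q, Module R (D q)] [∀ q, Module S (D q)] [∀ q, IsScalarTower R S (D q)]

theorem mem_cycles_of_comm {d : ∀ q, C (q + 1) →ₗ[R] C q} {d' : ∀ q, D (q + 1) →ₗ[S] D q}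
    (f : ∀ q, C q →ₗ[R] D q) (hf : ∀ q x, d' q (f (q + 1) x) = f q (d q x)) :
    ∀ (q : ℕ) (x : cycles d q), f q x ∈ (cycles d' q).restrictScalars R
  | 0, _ => trivial
  | q + 1, x => by
    have hx : d q x = 0 := x.2
    change d' q (f (q + 1) x) = 0
    rw [hf, hx, map_zero]

/-- The map induced on homology by an `R`-linear morphism of complexes, where the target is a
complex of modules over an `R`-algebra `S`. -/
def homologyMap {d : ∀ q, C (q + 1) →ₗ[R] C q} {d' : ∀ q, D (q + 1) →ₗ[S] D q}
    (f : ∀ q, C q →ₗ[R] D q) (hf : ∀ q x, d' q (f (q + 1) x) = f q (d q x)) (q : ℕ) :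
    Homology d q →ₗ[R] Homology d' q :=
  Submodule.liftQ _
    ((((LinearMap.range (d' q)).submoduleOf (cycles d' q)).mkQ.restrictScalars R) ∘ₗ
      (LinearMap.codRestrict ((cycles d' q).restrictScalars R) (f q ∘ₗ (cycles d q).subtype)
        (mem_cycles_of_comm f hf q)))
    (by
      rintro x ⟨y, hy⟩
      rw [LinearMap.mem_ker]
      refine (Submodule.Quotient.mk_eq_zero _).2 ⟨f (q + 1) y, ?_⟩
      rw [hf, hy]
      rfl)

end Homology

/-! ### Twisted Hochschild homology and its topological version -/

section Completion

variable {k : Type u} {A : Type v} [CommRing k] [Algebra ℂ k] [Ring A] [Algebra ℂ A]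
  [Algebra k A] [IsScalarTower ℂ k A]

variable (k) in
/-- The twisted Hochschild homology `HH_q(A, g)`. -/
abbrev HH (g : A →ₐ[ℂ] A) (q : ℕ) : Type v :=
  Homology (C := Chain A) (boundary k g) q

variable (A) in
/-- The two-sided ideal `I = I₀ A` of `A`. -/
def extIdeal (I₀ : Ideal k) : Ideal A := I₀.map (algebraMap k A)

instance (I₀ : Ideal k) : (extIdeal A I₀).IsTwoSided where
  mul_mem_of_left {a} b ha := by
    refine Submodule.span_induction (p := fun a _ => a * b ∈ extIdeal A I₀) ?_ ?_ ?_ ?_ ha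
    · rintro _ ⟨z, hz, rfl⟩
      rw [Algebra.commutes]
      exact Ideal.mul_mem_left _ _ (Ideal.mem_map_of_mem _ hz)
    · simp
    · intro x y _ _ hx hy
      rw [add_mul]; exact add_mem hx hy
    · intro c x _ hx
      rw [smul_eq_mul, mul_assoc]; exact Ideal.mul_mem_left _ _ hx

variable (A) in
/-- The quotient algebra `A / I^m`, where `I = I₀ A`. -/
abbrev QuotPow (I₀ : Ideal k) (m : ℕ) : Type v := A ⧸ extIdeal A I₀ ^ m

theorem algebraMap_mem_extIdeal_pow (I₀ : Ideal k) (m : ℕ) {z : k} (hz : z ∈ I₀ ^ m) :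
    algebraMap k A z ∈ extIdeal A I₀ ^ m := by
  induction m generalizing z with
  | zero => rw [Submodule.pow_zero, Ideal.one_eq_top]; trivial
  | succ m ih =>
    rw [Submodule.pow_succ] at hz ⊢
    refine Submodule.mul_induction_on hz (fun x hx y hy => ?_) fun x y hx hy => ?_
    · rw [map_mul]
      exact Ideal.mul_mem_mul (ih hx) (Ideal.mem_map_of_mem _ hy)
    · rw [map_add]; exact add_mem hx hy

/-- The structure map `k̂ → k / I₀^m → A / I^m`. -/
def quotPowStructureMap (I₀ : Ideal k) (m : ℕ) : AdicCompletion I₀ k →+* QuotPow A I₀ m :=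
  (Ideal.quotientMap (I := I₀ ^ m) (extIdeal A I₀ ^ m) (algebraMap k A)
    fun _ hz => algebraMap_mem_extIdeal_pow I₀ m hz).comp
      (AdicCompletion.evalₐ I₀ m : AdicCompletion I₀ k →+* k ⧸ I₀ ^ m)

theorem quotPowStructureMap_eq (I₀ : Ideal k) (m : ℕ) {c : AdicCompletion I₀ k} {z : k}
    (hz : AdicCompletion.evalₐ I₀ m c = Ideal.Quotient.mk _ z) :
    quotPowStructureMap (A := A) I₀ m c = Ideal.Quotient.mk _ (algebraMap k A z) := by
  rw [quotPowStructureMap, RingHom.comp_apply, RingHom.coe_coe, hz]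
  rfl

/-- `A / I^m` as an algebra over the completion `k̂ = lim k / I₀^n`. -/
instance quotPowAlgebra (I₀ : Ideal k) (m : ℕ) : Algebra (AdicCompletion I₀ k) (QuotPow A I₀ m) :=
  (quotPowStructureMap I₀ m).toAlgebra' fun c x => by
    obtain ⟨z, hz⟩ := Ideal.Quotient.mk_surjective (AdicCompletion.evalₐ I₀ m c)
    obtain ⟨a, rfl⟩ := Ideal.Quotient.mk_surjective x
    rw [quotPowStructureMap_eq I₀ m hz.symm, ← map_mul, ← map_mul, Algebra.commutes]

instance (I₀ : Ideal k) (m : ℕ) : IsScalarTower k (AdicCompletion I₀ k) (QuotPow A I₀ m) :=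
  .of_algebraMap_eq fun z =>
    (quotPowStructureMap_eq I₀ m ((AdicCompletion.evalₐ I₀ m).commutes z)).symm

instance (I₀ : Ideal k) (m : ℕ) : IsScalarTower ℂ (AdicCompletion I₀ k) (QuotPow A I₀ m) :=
  .of_algebraMap_eq fun z => by
    rw [IsScalarTower.algebraMap_apply ℂ k (QuotPow A I₀ m),
      IsScalarTower.algebraMap_apply k (AdicCompletion I₀ k) (QuotPow A I₀ m),
      ← IsScalarTower.algebraMap_apply ℂ k (AdicCompletion I₀ k)]

/-- The projection `A / I^n → A / I^m` for `m ≤ n`. -/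
def quotPowMap (I₀ : Ideal k) {m n : ℕ} (h : m ≤ n) :
    QuotPow A I₀ n →ₐ[AdicCompletion I₀ k] QuotPow A I₀ m where
  __ := Ideal.Quotient.factor (Ideal.pow_le_pow_right h)
  commutes' c := by
    obtain ⟨x, rfl⟩ := AdicCompletion.mk_surjective I₀ k c
    have key (l : ℕ) : algebraMap (AdicCompletion I₀ k) (QuotPow A I₀ l) (AdicCompletion.mk I₀ k x)
        = Ideal.Quotient.mk _ (algebraMap k A (x l)) :=
      quotPowStructureMap_eq I₀ l (AdicCompletion.evalₐ_mk I₀ l x)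
    rw [key, key]
    change Ideal.Quotient.mk _ (algebraMap k A (x n)) = _
    rw [Ideal.Quotient.eq, ← map_sub]
    refine algebraMap_mem_extIdeal_pow I₀ m ?_
    have := x.2 h
    rw [SModEq.sub_mem] at this
    rw [← neg_sub, neg_mem_iff]
    simpa using this

theorem pow_le_comap (I₀ : Ideal k) (g : A →ₐ[ℂ] A) (hg : ∀ a ∈ extIdeal A I₀, g a ∈ extIdeal A I₀)
    (m : ℕ) : extIdeal A I₀ ^ m ≤ (extIdeal A I₀ ^ m).comap g := by
  induction m with
  | zero => rw [Submodule.pow_zero, Ideal.one_eq_top]; exact fun _ _ => trivial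
  | succ m ih =>
    rw [Submodule.pow_succ]
    refine Ideal.mul_le.2 fun x hx y hy => ?_
    rw [Ideal.mem_comap, map_mul]
    exact Ideal.mul_mem_mul (ih hx) (hg y hy)

/-- The endomorphism of `A / I^m` induced by an endomorphism `g` of `A` with `g(I) ⊆ I`. -/
def quotPowEndo (I₀ : Ideal k) (g : A →ₐ[ℂ] A) (hg : ∀ a ∈ extIdeal A I₀, g a ∈ extIdeal A I₀)
    (m : ℕ) : QuotPow A I₀ m →ₐ[ℂ] QuotPow A I₀ m :=
  Ideal.quotientMapₐ _ g (pow_le_comap I₀ g hg m)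

variable (A) in
/-- The completed chains `lim_m 𝓑_q(A / I^m) = lim_m (A / I^m) ⊗ ((A / I^m) / ℂ1)^{⊗ q}`, a module
over `k̂`. -/
def ComplChain (I₀ : Ideal k) (q : ℕ) :
    Submodule (AdicCompletion I₀ k) (∀ m, Chain (QuotPow A I₀ m) q) where
  carrier := {x | ∀ (m n : ℕ) (h : m ≤ n),
    chainMap (AdicCompletion I₀ k) (quotPowMap I₀ h) q (x n) = x m}
  add_mem' hx hy m n h := by simp [hx m n h, hy m n h]
  zero_mem' m n h := by simp
  smul_mem' c x hx m n h := by simp [hx m n h]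

/-- The boundary of the completed complex, induced by the boundaries `b_g` of the complexes
`𝓑_*(A / I^m)`. -/
def complBoundary (I₀ : Ideal k) (g : A →ₐ[ℂ] A)
    (hg : ∀ a ∈ extIdeal A I₀, g a ∈ extIdeal A I₀) (q : ℕ) :
    ComplChain A I₀ (q + 1) →ₗ[AdicCompletion I₀ k] ComplChain A I₀ q :=
  LinearMap.restrict
    (LinearMap.pi fun m => boundary (AdicCompletion I₀ k) (quotPowEndo I₀ g hg m) q ∘ₗ
      LinearMap.proj m)
    (by
      intro x hx m n h
      have := boundary_chainMap (AdicCompletion I₀ k) (quotPowMap (A := A) I₀ h)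
        (quotPowEndo I₀ g hg n) (quotPowEndo I₀ g hg m)
        (by rintro ⟨a⟩; rfl) q
      simp only [LinearMap.pi_apply, LinearMap.comp_apply, LinearMap.proj_apply]
      rw [← hx m n h]
      exact (LinearMap.congr_fun this (x n)).symm)

theorem complBoundary_comp_complBoundary (I₀ : Ideal k) (g : A →ₐ[ℂ] A)
    (hg : ∀ a ∈ extIdeal A I₀, g a ∈ extIdeal A I₀) (q : ℕ) :
    complBoundary I₀ g hg q ∘ₗ complBoundary I₀ g hg (q + 1) = 0 := by
  refine LinearMap.ext fun x => Subtype.ext (funext fun m => ?_)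
  exact LinearMap.congr_fun
    (boundary_comp_boundary (AdicCompletion I₀ k) (quotPowEndo I₀ g hg m) q) (x.1 m)

/-- The topological twisted Hochschild homology of `A`, with respect to the `I`-adic filtration,
`I = I₀ A`. -/
abbrev HHtop (I₀ : Ideal k) (g : A →ₐ[ℂ] A)
    (hg : ∀ a ∈ extIdeal A I₀, g a ∈ extIdeal A I₀) (q : ℕ) : Type v :=
  Homology (C := fun q => ComplChain A I₀ q) (complBoundary I₀ g hg) q

variable (A) in
/-- The natural map `𝓑_q(A) → lim_m 𝓑_q(A / I^m)`. -/
def toCompl (I₀ : Ideal k) (q : ℕ) : Chain A q →ₗ[k] ComplChain A I₀ q where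
  toFun x := ⟨fun m => chainMap k (Ideal.Quotient.mkₐ k (extIdeal A I₀ ^ m)) q x, by
    intro m n h
    have : (chainMap (AdicCompletion I₀ k) (quotPowMap (A := A) I₀ h) q).restrictScalars k ∘ₗ
        chainMap k (Ideal.Quotient.mkₐ k (extIdeal A I₀ ^ n)) q =
        chainMap k (Ideal.Quotient.mkₐ k (extIdeal A I₀ ^ m)) q :=
      chain_hom_ext fun a₀ a => by
        rw [LinearMap.comp_apply, chainMap_tensor, chainMap_tensor, LinearMap.restrictScalars_apply,
          chainMap_tensor]
        rfl
    exact LinearMap.congr_fun this x⟩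
  map_add' x y := by ext m; simp
  map_smul' z x := by ext m; simp

theorem complBoundary_toCompl (I₀ : Ideal k) (g : A →ₐ[ℂ] A)
    (hg : ∀ a ∈ extIdeal A I₀, g a ∈ extIdeal A I₀) (q : ℕ) (x : Chain A (q + 1)) :
    complBoundary I₀ g hg q (toCompl A I₀ (q + 1) x) = toCompl A I₀ q (boundary k g q x) := by
  refine Subtype.ext (funext fun m => ?_)
  have := boundary_chainMap k (Ideal.Quotient.mkₐ k (extIdeal A I₀ ^ m)) g (quotPowEndo I₀ g hg m)
    (fun a => rfl) q
  exact LinearMap.congr_fun this x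

/-- The natural map from twisted Hochschild homology to topological twisted Hochschild homology. -/
def naturalMap (I₀ : Ideal k) (g : A →ₐ[ℂ] A)
    (hg : ∀ a ∈ extIdeal A I₀, g a ∈ extIdeal A I₀) (q : ℕ) :
    HH k g q →ₗ[k] HHtop I₀ g hg q :=
  homologyMap (toCompl A I₀) (complBoundary_toCompl I₀ g hg) q

end Completion

end TwistedHochschild

end

open scoped TensorProduct

noncomputable section

namespace TwistedHochschild

universe u v

set_option linter.unusedSectionVars false

/-! The chains `𝓑_*(A)` with `b_g` form the normalized Hochschild complex of `A` with coefficients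
in the bimodule `A_g`, which is `A` with right action `x · a = x g(a)`. Both assertions hold for
every bimodule `M` that is finitely generated over `A^e = A ⊗ A^op`, and this generality makes an
induction on the degree possible. As `k` is a finitely generated `ℂ`-algebra, `k ⊗ k` is Noetherian
(`isNoetherianRing_tensor`); it maps to the center of `A^e`, and `A^e` is finite over it
(`finite_env`). Hence there is a short exact sequence `0 → N → L → M → 0` with `L` free of finite
rank and `N` again finitely generated (`exists_presentation`).

With coefficients in `A^e` the complex contracts onto `A` in degree zero (`cBoundary_contraction`,
`cBoundary_contraction_zero`). So a free `L` of finite rank has no homology in positive degrees, and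
`H_0(L)` is finite over `k`. Consequently `H_0(M)` is a quotient of `H_0(L)`, and `H_{q+1}(M)` is
the kernel of `H_q(N) → H_q(L)`; finite generation follows by induction because `k` is Noetherian.

For the completion, the chains `C(M)` are filtered: step `m` is spanned by the tensors with head in
`I₀^m M + M I₀^m` or with another entry in `I₀^m A`. Two functors of `M` are compared, `k̂ ⊗_k C(M)`
and the completion of `C(M)`. Both turn the sequence above into a short exact sequence of complexes:
the first because `k̂` is flat over `k`, the second by the Artin–Rees lemma over `k ⊗ k`
(`exists_biFil_le`, `complCMap_shortExact`). For `A^e` the contraction respects the filtration, so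
the comparison reduces to `k̂ ⊗_k A → Â`, which is bijective since `A` is finite over the Noetherian
ring `k` (`AdicFil.adic_bijective`). Four-lemma arguments then shift the comparison through all
degrees (`finiteHomology_and_comparison`).

Finally, `g(I) ⊆ I` for `I = I₀ A` implies that step `m` for `A_g` is exactly the kernel of `𝓑_q(A)
→ 𝓑_q(A / I^m)` (`Tw.mem_chainFil_iff`), so the filtered completion is the inverse limit defining
`HHtop`. Flatness moves `k̂ ⊗_k` past homology (`bijective_liftBaseChange_homologyMap`). -/

/-! ### Complexes of modules -/

section QuasiIso

variable {R : Type*} [CommRing R]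

section

variable {D D' : ℕ → Type*} [∀ q, AddCommGroup (D q)] [∀ q, Module R (D q)]
  [∀ q, AddCommGroup (D' q)] [∀ q, Module R (D' q)]

/-- The maps `f` induce an injection on homology in degree `q`. -/
def HomologyInj (d : ∀ q, D (q + 1) →ₗ[R] D q) (d' : ∀ q, D' (q + 1) →ₗ[R] D' q)
    (f : ∀ q, D q →ₗ[R] D' q) (q : ℕ) : Prop :=
  ∀ x ∈ cycles d q, f q x ∈ LinearMap.range (d' q) → x ∈ LinearMap.range (d q)

/-- The maps `f` induce a surjection on homology in degree `q`. -/
def HomologySurj (d : ∀ q, D (q + 1) →ₗ[R] D q) (d' : ∀ q, D' (q + 1) →ₗ[R] D' q)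
    (f : ∀ q, D q →ₗ[R] D' q) (q : ℕ) : Prop :=
  ∀ y ∈ cycles d' q, ∃ x ∈ cycles d q, ∃ w, y = f q x + d' q w

theorem mem_cycles_of_injective {d : ∀ q, D (q + 1) →ₗ[R] D q} {d' : ∀ q, D' (q + 1) →ₗ[R] D' q}
    {i : ∀ q, D q →ₗ[R] D' q} (hc : ∀ q x, d' q (i (q + 1) x) = i q (d q x))
    (hi : ∀ q, Function.Injective (i q)) :
    ∀ (q : ℕ) (x : D q), i q x ∈ cycles d' q → x ∈ cycles d q
  | 0, _, _ => trivial
  | q + 1, x, hx => by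
    have hx' : d' q (i (q + 1) x) = 0 := hx
    rw [hc] at hx'
    exact hi q (by rw [hx', map_zero])

theorem map_mem_cycles {d : ∀ q, D (q + 1) →ₗ[R] D q} {d' : ∀ q, D' (q + 1) →ₗ[R] D' q}
    {i : ∀ q, D q →ₗ[R] D' q} (hc : ∀ q x, d' q (i (q + 1) x) = i q (d q x)) :
    ∀ (q : ℕ) (x : D q), x ∈ cycles d q → i q x ∈ cycles d' q
  | 0, _, _ => trivial
  | q + 1, x, hx => by
    have hx' : d q x = 0 := hx
    change d' q (i (q + 1) x) = 0
    rw [hc, hx', map_zero]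

theorem boundary_mem_cycles {d : ∀ q, D (q + 1) →ₗ[R] D q} (hd : ∀ q x, d q (d (q + 1) x) = 0) :
    ∀ (q : ℕ) (x : D (q + 1)), d q x ∈ cycles d q
  | 0, _ => trivial
  | q + 1, x => hd q x

/-- Together with its surjective counterpart, this replaces the filtered completion by the
isomorphic inverse limit over the `A / I^m` at the end of the proof. -/
theorem HomologyInj.trans_bijective {D'' : ℕ → Type*} [∀ q, AddCommGroup (D'' q)]
    [∀ q, Module R (D'' q)] {d : ∀ q, D (q + 1) →ₗ[R] D q} {d' : ∀ q, D' (q + 1) →ₗ[R] D' q}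
    {d'' : ∀ q, D'' (q + 1) →ₗ[R] D'' q} {f : ∀ q, D q →ₗ[R] D' q} {f' : ∀ q, D q →ₗ[R] D'' q}
    {e : ∀ q, D' q →ₗ[R] D'' q} (hc : ∀ q x, d'' q (e (q + 1) x) = e q (d' q x))
    (he : ∀ q, Function.Bijective (e q)) (hf : ∀ q x, f' q x = e q (f q x)) {q : ℕ}
    (h : HomologyInj d d' f q) : HomologyInj d d'' f' q := by
  rintro x hx ⟨w, hw⟩
  obtain ⟨w, rfl⟩ := (he (q + 1)).2 w
  refine h x hx ⟨w, (he q).1 ?_⟩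
  rw [← hc, hw, hf]

theorem HomologySurj.trans_bijective {D'' : ℕ → Type*} [∀ q, AddCommGroup (D'' q)]
    [∀ q, Module R (D'' q)] {d : ∀ q, D (q + 1) →ₗ[R] D q} {d' : ∀ q, D' (q + 1) →ₗ[R] D' q}
    {d'' : ∀ q, D'' (q + 1) →ₗ[R] D'' q} {f : ∀ q, D q →ₗ[R] D' q} {f' : ∀ q, D q →ₗ[R] D'' q}
    {e : ∀ q, D' q →ₗ[R] D'' q} (hc : ∀ q x, d'' q (e (q + 1) x) = e q (d' q x))
    (he : ∀ q, Function.Bijective (e q)) (hf : ∀ q x, f' q x = e q (f q x)) {q : ℕ}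
    (h : HomologySurj d d' f q) : HomologySurj d d'' f' q := by
  intro y hy
  obtain ⟨y, rfl⟩ := (he q).2 y
  obtain ⟨x, hx, w, rfl⟩ := h y (mem_cycles_of_injective hc (fun q => (he q).1) q y hy)
  exact ⟨x, hx, e (q + 1) w, by rw [hf, hc, map_add]⟩

end

/-- A short exact sequence of complexes. -/
structure ShortExactSeq {N L M : ℕ → Type*} [∀ q, AddCommGroup (N q)] [∀ q, Module R (N q)]
    [∀ q, AddCommGroup (L q)] [∀ q, Module R (L q)] [∀ q, AddCommGroup (M q)] [∀ q, Module R (M q)]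
    (dN : ∀ q, N (q + 1) →ₗ[R] N q) (dL : ∀ q, L (q + 1) →ₗ[R] L q)
    (dM : ∀ q, M (q + 1) →ₗ[R] M q) (i : ∀ q, N q →ₗ[R] L q) (p : ∀ q, L q →ₗ[R] M q) : Prop where
  -- Required of the middle complex only; the other two inherit it through `inj` and `surj`.
  sq_zero : ∀ q x, dL q (dL (q + 1) x) = 0
  comm_i : ∀ q x, dL q (i (q + 1) x) = i q (dN q x)
  comm_p : ∀ q x, dM q (p (q + 1) x) = p q (dL q x)
  inj : ∀ q, Function.Injective (i q)
  exact : ∀ q, Function.Exact (i q) (p q)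
  surj : ∀ q, Function.Surjective (p q)

namespace ShortExactSeq

variable {N L M : ℕ → Type*} [∀ q, AddCommGroup (N q)] [∀ q, Module R (N q)]
  [∀ q, AddCommGroup (L q)] [∀ q, Module R (L q)] [∀ q, AddCommGroup (M q)] [∀ q, Module R (M q)]
  {dN : ∀ q, N (q + 1) →ₗ[R] N q} {dL : ∀ q, L (q + 1) →ₗ[R] L q}
  {dM : ∀ q, M (q + 1) →ₗ[R] M q} {i : ∀ q, N q →ₗ[R] L q} {p : ∀ q, L q →ₗ[R] M q}

/-- A cycle in the quotient complex lifts to a chain whose boundary comes from a cycle in the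
subcomplex. -/
theorem exists_lift (S : ShortExactSeq dN dL dM i p) {q : ℕ} {z : M (q + 1)} (hz : dM q z = 0) :
    ∃ y n, p (q + 1) y = z ∧ dL q y = i q n ∧ n ∈ cycles dN q := by
  obtain ⟨y, rfl⟩ := S.surj (q + 1) z
  rw [S.comm_p] at hz
  obtain ⟨n, hn⟩ := (S.exact q _).1 hz
  refine ⟨y, n, rfl, hn.symm, mem_cycles_of_injective S.comm_i S.inj q n ?_⟩
  rw [hn]
  exact boundary_mem_cycles S.sq_zero q y

/-- Finite generation of homology is inherited by the quotient complex in the next degree, if the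
middle complex is exact there. -/
theorem exists_fg_succ [IsNoetherianRing R] (S : ShortExactSeq dN dL dM i p) {q : ℕ}
    (hL : cycles dL (q + 1) ≤ LinearMap.range (dL (q + 1)))
    (hN : ∃ T : Submodule R (N q), T.FG ∧ cycles dN q ≤ T ⊔ LinearMap.range (dN q)) :
    ∃ T : Submodule R (M (q + 1)), T.FG ∧
      cycles dM (q + 1) ≤ T ⊔ LinearMap.range (dM (q + 1)) := by
  obtain ⟨T, hT, hle⟩ := hN
  have : IsNoetherian R T := isNoetherian_of_fg_of_noetherian T hT
  -- These elements become boundaries in `L`, so they represent classes in the kernel of `H_q(N) →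
  -- H_q(L)`. Noetherianity makes this submodule finitely generated.
  obtain ⟨s, hs⟩ : ((T ⊓ (LinearMap.range (dL q)).comap (i q))).FG :=
    isNoetherian_submodule.1 this _ inf_le_left
  have hmem : ∀ t ∈ s, ∃ y, dL q y = i q t := fun t ht => by
    have : t ∈ T ⊓ (LinearMap.range (dL q)).comap (i q) := hs ▸ Submodule.subset_span ht
    exact this.2
  choose! Y hY using hmem
  -- If `d y = i t`, the class of `p y` is a preimage of that of `t` under the connecting map
  -- `H_{q+1}(M) → H_q(N)`. As `H_{q+1}(L) = 0`, that map is injective, so preimages of the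
  -- generators suffice.
  refine ⟨Submodule.span R ((fun t => p (q + 1) (Y t)) '' s),
    Submodule.fg_span (s.finite_toSet.image _), fun z hz => ?_⟩
  obtain ⟨y, n, rfl, hyn, hn⟩ := S.exists_lift hz
  obtain ⟨t, ht, _, ⟨n', rfl⟩, rfl⟩ := Submodule.mem_sup.1 (hle hn)
  have ht' : t ∈ Submodule.span R (s : Set (N q)) := by
    rw [hs]
    refine ⟨ht, y - i (q + 1) n', ?_⟩
    rw [map_sub, S.comm_i, hyn, map_add, add_sub_cancel_right]
  have key : ∃ y₁, dL q y₁ = i q t ∧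
      p (q + 1) y₁ ∈ Submodule.span R ((fun t => p (q + 1) (Y t)) '' (s : Set (N q))) := by
    clear hyn hn ht
    induction ht' using Submodule.span_induction with
    | mem t h => exact ⟨Y t, hY t h, Submodule.subset_span ⟨t, h, rfl⟩⟩
    | zero => exact ⟨0, by simp, by simp⟩
    | add a b _ _ ha hb =>
      obtain ⟨u, hu, hu'⟩ := ha
      obtain ⟨w, hw, hw'⟩ := hb
      exact ⟨u + w, by simp [hu, hw], by rw [map_add]; exact add_mem hu' hw'⟩
    | smul c a _ ha =>
      obtain ⟨u, hu, hu'⟩ := ha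
      exact ⟨c • u, by simp [hu], by rw [map_smul]; exact Submodule.smul_mem _ _ hu'⟩
  obtain ⟨y₁, h₁, h₁'⟩ := key
  -- The two lifts have the same boundary up to `i n'`, so the corrected difference is a cycle of
  -- `L`, hence a boundary.
  obtain ⟨u, hu⟩ := hL (show y - i (q + 1) n' - y₁ ∈ cycles dL (q + 1) by
    change dL q _ = 0
    rw [map_sub, map_sub, S.comm_i, hyn, h₁, map_add]; abel)
  refine Submodule.mem_sup.2 ⟨_, h₁', _, ⟨p _ u, rfl⟩, ?_⟩
  rw [S.comm_p, hu, map_sub, map_sub, (S.exact _).apply_apply_eq_zero]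
  abel

/-- `H_0` is right exact, so generators of `H_0(L)` map to generators of `H_0(M)`. -/
theorem exists_fg_zero (S : ShortExactSeq dN dL dM i p)
    (hL : ∃ T : Submodule R (L 0), T.FG ∧ cycles dL 0 ≤ T ⊔ LinearMap.range (dL 0)) :
    ∃ T : Submodule R (M 0), T.FG ∧ cycles dM 0 ≤ T ⊔ LinearMap.range (dM 0) := by
  obtain ⟨T, hT, hle⟩ := hL
  refine ⟨T.map (p 0), hT.map _, fun z _ => ?_⟩
  obtain ⟨y, rfl⟩ := S.surj 0 z
  obtain ⟨t, ht, _, ⟨n, rfl⟩, rfl⟩ := Submodule.mem_sup.1 (hle (show y ∈ cycles dL 0 from trivial))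
  exact Submodule.mem_sup.2 ⟨_, Submodule.mem_map_of_mem ht, _, ⟨p 1 n, rfl⟩, by
    rw [S.comm_p, map_add]⟩

variable {N' L' M' : ℕ → Type*} [∀ q, AddCommGroup (N' q)] [∀ q, Module R (N' q)]
  [∀ q, AddCommGroup (L' q)] [∀ q, Module R (L' q)]
  [∀ q, AddCommGroup (M' q)] [∀ q, Module R (M' q)]
  {dN' : ∀ q, N' (q + 1) →ₗ[R] N' q} {dL' : ∀ q, L' (q + 1) →ₗ[R] L' q}
  {dM' : ∀ q, M' (q + 1) →ₗ[R] M' q} {i' : ∀ q, N' q →ₗ[R] L' q} {p' : ∀ q, L' q →ₗ[R] M' q}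
  {fN : ∀ q, N q →ₗ[R] N' q} {fL : ∀ q, L q →ₗ[R] L' q} {fM : ∀ q, M q →ₗ[R] M' q}

/-- A four lemma for `H_{q+1}(M) → H_q(N) → H_q(L)`. A class of `H_{q+1}(M')` goes to `H_q(N')` and
lifts to `H_q(N)`; the lift dies in `H_q(L)` by injectivity there, so it comes from `H_{q+1}(M)`.
Exactness of `L'` makes the connecting map of the target injective, which identifies the image with
the given class. -/
theorem homologySurj_succ (S : ShortExactSeq dN dL dM i p) (S' : ShortExactSeq dN' dL' dM' i' p')
    (hL : ∀ q x, dL' q (fL (q + 1) x) = fL q (dL q x))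
    (hi : ∀ q x, i' q (fN q x) = fL q (i q x)) (hp : ∀ q x, p' q (fL q x) = fM q (p q x))
    {q : ℕ} (hN : HomologySurj dN dN' fN q) (hL₁ : HomologyInj dL dL' fL q)
    (hL' : cycles dL' (q + 1) ≤ LinearMap.range (dL' (q + 1))) :
    HomologySurj dM dM' fM (q + 1) := by
  intro z' hz'
  obtain ⟨y', n', rfl, hy, hn'⟩ := S'.exists_lift hz'
  obtain ⟨n, hn, w', rfl⟩ := hN n' hn'
  obtain ⟨y, hyn⟩ := hL₁ (i q n) (map_mem_cycles S.comm_i q n hn) ⟨y' - i' (q + 1) w', by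
    rw [map_sub, hy, S'.comm_i, map_add, hi, add_sub_cancel_right]⟩
  obtain ⟨u, hu⟩ := hL' (show y' - i' (q + 1) w' - fL (q + 1) y ∈ cycles dL' (q + 1) by
    change dL' q _ = 0
    rw [map_sub, map_sub, hy, S'.comm_i, hL, hyn, map_add, hi]; abel)
  refine ⟨p (q + 1) y, ?_, p' _ u, ?_⟩
  · change dM q _ = 0
    rw [S.comm_p, hyn, (S.exact _).apply_apply_eq_zero]
  · rw [S'.comm_p, hu, map_sub, map_sub, (S'.exact _).apply_apply_eq_zero, hp]
    abel

/-- Exactness of `L` embeds `H_{q+1}(M)` into `H_q(N)` by the connecting map, so injectivity is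
inherited from `N`. -/
theorem homologyInj_succ (S : ShortExactSeq dN dL dM i p) (S' : ShortExactSeq dN' dL' dM' i' p')
    (hL : ∀ q x, dL' q (fL (q + 1) x) = fL q (dL q x))
    (hi : ∀ q x, i' q (fN q x) = fL q (i q x)) (hp : ∀ q x, p' q (fL q x) = fM q (p q x))
    {q : ℕ} (hN₁ : HomologyInj dN dN' fN q)
    (hL₁ : cycles dL (q + 1) ≤ LinearMap.range (dL (q + 1))) :
    HomologyInj dM dM' fM (q + 1) := by
  rintro z hz ⟨w', hw'⟩
  obtain ⟨y, n, rfl, hy, hn⟩ := S.exists_lift hz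
  obtain ⟨v', rfl⟩ := S'.surj _ w'
  obtain ⟨n', hn'⟩ := (S'.exact (q + 1) (fL (q + 1) y - dL' (q + 1) v')).1 (by
    rw [map_sub, ← S'.comm_p, hw', hp, sub_self])
  obtain ⟨n₁, rfl⟩ := hN₁ n hn ⟨n', S'.inj q (by
    rw [← S'.comm_i, hn', map_sub, S'.sq_zero, hL, hy, hi, sub_zero])⟩
  obtain ⟨u, hu⟩ := hL₁ (show y - i (q + 1) n₁ ∈ cycles dL (q + 1) by
    change dL q _ = 0
    rw [map_sub, S.comm_i, hy, sub_self])
  exact ⟨p _ u, by rw [S.comm_p, hu, map_sub, (S.exact _).apply_apply_eq_zero, sub_zero]⟩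

/-- `H_0(L') → H_0(M')` is onto. -/
theorem homologySurj_zero (S' : ShortExactSeq dN' dL' dM' i' p')
    (hp : ∀ q x, p' q (fL q x) = fM q (p q x)) (hL₁ : HomologySurj dL dL' fL 0) :
    HomologySurj dM dM' fM 0 := by
  intro z' _
  obtain ⟨y', rfl⟩ := S'.surj 0 z'
  obtain ⟨x, -, w, rfl⟩ := hL₁ y' trivial
  exact ⟨p 0 x, trivial, p' 1 w, by rw [map_add, hp, S'.comm_p]⟩

/-- The four lemma for the right exact rows `H_0(N) → H_0(L) → H_0(M) → 0`; it needs surjectivity on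
`H_0(N)`, not injectivity. -/
theorem homologyInj_zero (S : ShortExactSeq dN dL dM i p) (S' : ShortExactSeq dN' dL' dM' i' p')
    (hi : ∀ q x, i' q (fN q x) = fL q (i q x)) (hp : ∀ q x, p' q (fL q x) = fM q (p q x))
    (hN : HomologySurj dN dN' fN 0) (hL : HomologyInj dL dL' fL 0) :
    HomologyInj dM dM' fM 0 := by
  rintro z - ⟨w', hw'⟩
  obtain ⟨y, rfl⟩ := S.surj 0 z
  obtain ⟨v', rfl⟩ := S'.surj 1 w'
  obtain ⟨n', hn'⟩ := (S'.exact 0 (fL 0 y - dL' 0 v')).1 (by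
    rw [map_sub, ← S'.comm_p, hw', hp, sub_self])
  obtain ⟨n, -, u', rfl⟩ := hN n' trivial
  obtain ⟨v, hv⟩ := hL (y - i 0 n) trivial ⟨v' + i' 1 u', by
    rw [map_sub, map_add, S'.comm_i, ← hi]
    rw [map_add] at hn'
    rw [eq_sub_iff_add_eq, add_assoc, add_comm (i' 0 _), hn']; abel⟩
  exact ⟨p 1 v, by rw [S.comm_p, hv, map_sub, (S.exact _).apply_apply_eq_zero, sub_zero]⟩

end ShortExactSeq

end QuasiIso

/-! ### Flat base change -/

section BaseChange

variable {R : Type*} [CommRing R] {C : ℕ → Type*} [∀ q, AddCommGroup (C q)] [∀ q, Module R (C q)]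
  (S : Type*) [CommRing S] [Algebra R S]

theorem ShortExactSeq.baseChange [Module.Flat R S] {N L M : ℕ → Type*} [∀ q, AddCommGroup (N q)]
    [∀ q, Module R (N q)] [∀ q, AddCommGroup (L q)] [∀ q, Module R (L q)]
    [∀ q, AddCommGroup (M q)] [∀ q, Module R (M q)]
    {dN : ∀ q, N (q + 1) →ₗ[R] N q} {dL : ∀ q, L (q + 1) →ₗ[R] L q}
    {dM : ∀ q, M (q + 1) →ₗ[R] M q} {i : ∀ q, N q →ₗ[R] L q} {p : ∀ q, L q →ₗ[R] M q}
    (h : ShortExactSeq dN dL dM i p) :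
    ShortExactSeq (fun q => (dN q).baseChange S) (fun q => (dL q).baseChange S)
      (fun q => (dM q).baseChange S) (fun q => (i q).baseChange S)
      (fun q => (p q).baseChange S) where
  sq_zero q x := by
    have : dL q ∘ₗ dL (q + 1) = 0 := LinearMap.ext (h.sq_zero q)
    rw [← LinearMap.comp_apply, ← LinearMap.baseChange_comp, this, LinearMap.baseChange_zero,
      LinearMap.zero_apply]
  comm_i q x := by
    have : dL q ∘ₗ i (q + 1) = i q ∘ₗ dN q := LinearMap.ext (h.comm_i q)
    rw [← LinearMap.comp_apply, ← LinearMap.comp_apply, ← LinearMap.baseChange_comp, this,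
      LinearMap.baseChange_comp]
  comm_p q x := by
    have : dM q ∘ₗ p (q + 1) = p q ∘ₗ dL q := LinearMap.ext (h.comm_p q)
    rw [← LinearMap.comp_apply, ← LinearMap.comp_apply, ← LinearMap.baseChange_comp, this,
      LinearMap.baseChange_comp]
  inj q := Module.Flat.lTensor_preserves_injective_linearMap (M := S) (i q) (h.inj q)
  exact q := lTensor_exact S (h.exact q) (h.surj q)
  surj q := LinearMap.lTensor_surjective S (h.surj q)

/-- Cycles of the base change of a complex along a flat map come from the base change of the
cycles. -/
theorem exists_of_mem_cycles_baseChange [Module.Flat R S] (d : ∀ q, C (q + 1) →ₗ[R] C q) (q : ℕ)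
    (x : S ⊗[R] C q) (hx : x ∈ cycles (C := fun q => S ⊗[R] C q) (fun q => (d q).baseChange S) q) :
    ∃ y : S ⊗[R] cycles d q, ((cycles d q).subtype.baseChange S) y = x := by
  cases q with
  | zero =>
    exact LinearMap.lTensor_surjective S (fun y => ⟨⟨y, trivial⟩, rfl⟩) x
  | succ q =>
    exact (Module.Flat.lTensor_exact S
      (LinearMap.exact_subtype_ker_map (d q)) x).1 hx

theorem exact_baseChange [Module.Flat R S] (d : ∀ q, C (q + 1) →ₗ[R] C q) (q : ℕ)
    (h : cycles d q ≤ LinearMap.range (d q)) :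
    cycles (C := fun q => S ⊗[R] C q) (fun q => (d q).baseChange S) q ≤
      LinearMap.range ((d q).baseChange S) := by
  intro x hx
  obtain ⟨y, rfl⟩ := exists_of_mem_cycles_baseChange S d q x hx
  clear hx
  induction y using TensorProduct.induction_on with
  | zero => simp
  | tmul s z =>
    obtain ⟨w, hw⟩ := h z.2
    exact ⟨s ⊗ₜ w, by simp [hw]⟩
  | add a b ha hb => rw [map_add]; exact add_mem ha hb

variable {D : ℕ → Type*} [∀ q, AddCommGroup (D q)]
  [∀ q, Module R (D q)] [∀ q, Module S (D q)] [∀ q, IsScalarTower R S (D q)]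

/-- If the map from the base change of a complex to a complex `D` is a quasi-isomorphism in degree
`q`, then the `q`-th homology of `D` is the base change of the homology of the given complex. -/
theorem bijective_liftBaseChange_homologyMap [Module.Flat R S] {d : ∀ q, C (q + 1) →ₗ[R] C q}
    (hd : ∀ q x, d q (d (q + 1) x) = 0)
    {d' : ∀ q, D (q + 1) →ₗ[S] D q}
    (f : ∀ q, C q →ₗ[R] D q) (hf : ∀ q x, d' q (f (q + 1) x) = f q (d q x)) (q : ℕ)
    (hi : HomologyInj (D := fun q => S ⊗[R] C q) (fun q => (d q).baseChange S) d'
      (fun q => (f q).liftBaseChange S) q)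
    (hs : HomologySurj (D := fun q => S ⊗[R] C q) (fun q => (d q).baseChange S) d'
      (fun q => (f q).liftBaseChange S) q) :
    Function.Bijective ((homologyMap (d := d) (d' := d') f hf q).liftBaseChange S) := by
  have hsub : Function.Injective ((cycles d q).subtype.baseChange S) :=
    Module.Flat.lTensor_preserves_injective_linearMap (M := S) _ Subtype.val_injective
  have hcyc (ζ : S ⊗[R] cycles d q) :
      (cycles d q).subtype.baseChange S ζ ∈
        cycles (C := fun q => S ⊗[R] C q) (fun q => (d q).baseChange S) q := by
    cases q with
    | zero => trivial
    | succ q =>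
      change (d q).baseChange S _ = 0
      rw [← LinearMap.comp_apply, ← LinearMap.baseChange_comp]
      have : d q ∘ₗ (cycles d (q + 1)).subtype = 0 := LinearMap.ext fun x => x.2
      simp [this]
  have hcyc' (ζ : S ⊗[R] cycles d q) :
      (f q).liftBaseChange S ((cycles d q).subtype.baseChange S ζ) ∈ cycles d' q := by
    induction ζ using TensorProduct.induction_on with
    | zero => simp
    | tmul s z =>
      simp only [LinearMap.baseChange_tmul, LinearMap.liftBaseChange_tmul]
      exact Submodule.smul_mem _ _ (mem_cycles_of_comm f hf q z)
    | add a b ha hb => rw [map_add, map_add]; exact add_mem ha hb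
  -- The homology `S ⊗ H_q` is a quotient of `S ⊗ Z_q`, and on representatives from `S ⊗ Z_q` the
  -- map is the class of the chain map. By flatness `S ⊗ Z_q` is the module of cycles of `S ⊗ C`, so
  -- the hypotheses on cycles apply.
  have key (ζ : S ⊗[R] cycles d q) :
      (homologyMap (d := d) (d' := d') f hf q).liftBaseChange S
        ((((LinearMap.range (d q)).submoduleOf (cycles d q)).mkQ).baseChange S ζ) =
      ((LinearMap.range (d' q)).submoduleOf (cycles d' q)).mkQ ⟨_, hcyc' ζ⟩ := by
    induction ζ using TensorProduct.induction_on with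
    | zero => rw [map_zero, map_zero, ← map_zero (Submodule.mkQ _)]; congr 1
    | tmul s z =>
      rw [LinearMap.baseChange_tmul, LinearMap.liftBaseChange_tmul]
      rfl
    | add a b ha hb =>
      rw [map_add, map_add, ha, hb, ← map_add]; congr 1; ext; simp
  have hQ : Function.Surjective
      ((((LinearMap.range (d q)).submoduleOf (cycles d q)).mkQ).baseChange S) :=
    LinearMap.lTensor_surjective S (Submodule.mkQ_surjective _)
  constructor
  · rw [injective_iff_map_eq_zero]
    intro x hx
    obtain ⟨ζ, rfl⟩ := hQ x
    rw [key, Submodule.mkQ_apply, Submodule.Quotient.mk_eq_zero] at hx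
    obtain ⟨u, hu⟩ := hi _ (hcyc ζ) hx
    -- The boundary is corestricted to the cycles so that `ζ` can be compared with a boundary inside
    -- `S ⊗ Z_q`, where the quotient map to `S ⊗ H_q` is defined.
    let dr : C (q + 1) →ₗ[R] cycles d q :=
      LinearMap.codRestrict _ (d q) (boundary_mem_cycles hd q)
    have hdr : (cycles d q).subtype ∘ₗ dr = d q := rfl
    have hζ : ζ = dr.baseChange S u := by
      apply hsub
      rw [← hu, ← LinearMap.comp_apply, ← LinearMap.baseChange_comp, hdr]
    have h0 : ((LinearMap.range (d q)).submoduleOf (cycles d q)).mkQ ∘ₗ dr = 0 := by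
      ext y
      exact (Submodule.Quotient.mk_eq_zero _).2 ⟨y, rfl⟩
    rw [hζ, ← LinearMap.comp_apply, ← LinearMap.baseChange_comp, h0, LinearMap.baseChange_zero,
      LinearMap.zero_apply]
  · intro y
    obtain ⟨y, rfl⟩ := Submodule.mkQ_surjective _ y
    obtain ⟨x, hx, w, hw⟩ := hs y.1 y.2
    obtain ⟨ζ, rfl⟩ := exists_of_mem_cycles_baseChange S d q x hx
    refine ⟨_, (key ζ).trans ?_⟩
    rw [Submodule.mkQ_apply, Submodule.mkQ_apply, Submodule.Quotient.eq]
    refine ⟨-w, ?_⟩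
    rw [map_neg]
    change _ = _ - (y : D q)
    rw [hw]; abel

end BaseChange

/-! ### Completion with respect to a filtration -/

section Filtered

variable {k : Type*} [CommRing k] {I : Ideal k}

variable (I) in
/-- A decreasing filtration of a module that is coarser than the `I`-adic one. -/
structure AdicFil (C : Type*) [AddCommGroup C] [Module k C] where
  /-- The steps of the filtration. -/
  step : ℕ → Submodule k C
  anti : Antitone step
  smul_mem : ∀ m, ∀ z ∈ I ^ m, ∀ x, z • x ∈ step m

variable {C : Type*} [AddCommGroup C] [Module k C]

namespace AdicFil

/-- The quotient by a step of the filtration. -/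
def Level (K : AdicFil I C) (m : ℕ) : Type _ := C ⧸ K.step m

instance (K : AdicFil I C) (m : ℕ) : AddCommGroup (K.Level m) :=
  inferInstanceAs (AddCommGroup (C ⧸ K.step m))

instance (K : AdicFil I C) (m : ℕ) : Module k (K.Level m) :=
  inferInstanceAs (Module k (C ⧸ K.step m))

/-- The projection onto the quotient by a step of the filtration. -/
def proj (K : AdicFil I C) (m : ℕ) : C →ₗ[k] K.Level m := (K.step m).mkQ

theorem proj_surjective (K : AdicFil I C) (m : ℕ) : Function.Surjective (K.proj m) :=
  Submodule.mkQ_surjective _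

theorem proj_eq_zero (K : AdicFil I C) {m : ℕ} {x : C} : K.proj m x = 0 ↔ x ∈ K.step m :=
  Submodule.Quotient.mk_eq_zero _

theorem proj_eq_proj (K : AdicFil I C) {m : ℕ} {x y : C} :
    K.proj m x = K.proj m y ↔ x - y ∈ K.step m :=
  Submodule.Quotient.eq _

theorem isTorsionBySet (K : AdicFil I C) (m : ℕ) :
    Module.IsTorsionBySet k (K.Level m) ((I ^ m : Ideal k) : Set k) := by
  intro x z
  obtain ⟨x, rfl⟩ := K.proj_surjective m x
  rw [← map_smul, proj_eq_zero]
  exact K.smul_mem m z z.2 x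

instance (K : AdicFil I C) (m : ℕ) : Module (AdicCompletion I k) (K.Level m) :=
  letI := (K.isTorsionBySet m).module
  Module.compHom (K.Level m) (AdicCompletion.evalₐ I m : AdicCompletion I k →+* k ⧸ I ^ m)

theorem level_smul (K : AdicFil I C) {m : ℕ} {c : AdicCompletion I k} {z : k}
    (hz : AdicCompletion.evalₐ I m c = Ideal.Quotient.mk _ z) (x : K.Level m) :
    c • x = z • x := by
  let := (K.isTorsionBySet m).module
  change AdicCompletion.evalₐ I m c • x = z • x
  rw [hz]
  rfl

instance (K : AdicFil I C) (m : ℕ) : IsScalarTower k (AdicCompletion I k) (K.Level m) :=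
  .of_algebraMap_smul fun z x => K.level_smul ((AdicCompletion.evalₐ I m).commutes z) x

/-- An element of `k` that approximates `c` modulo `I ^ n` also does so modulo `I ^ m`, `m ≤ n`. -/
theorem eval_eq_of_le {m n : ℕ} (h : m ≤ n) {c : AdicCompletion I k} {z : k}
    (hz : AdicCompletion.evalₐ I n c = Ideal.Quotient.mk _ z) :
    AdicCompletion.evalₐ I m c = Ideal.Quotient.mk _ z := by
  obtain ⟨x, rfl⟩ := AdicCompletion.mk_surjective I k c
  rw [AdicCompletion.evalₐ_mk] at hz ⊢
  rw [Ideal.Quotient.eq] at hz ⊢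
  have h1 : x.val m - x.val n ∈ I ^ m := by
    have := x.2 h
    rw [SModEq.sub_mem] at this
    simpa using this
  simpa using add_mem h1 (Ideal.pow_le_pow_right h hz)

/-- The completion of a module with respect to a filtration, a module over the completion of `k`. -/
def Compl (K : AdicFil I C) : Submodule (AdicCompletion I k) (∀ m, K.Level m) where
  -- Compatibility is tested on representatives in `C`, which replaces the transition maps between
  -- levels.
  carrier := {x | ∀ m n, m ≤ n → ∀ c, x n = K.proj n c → x m = K.proj m c}
  add_mem' {x y} hx hy m n h c hc := by
    obtain ⟨a, ha⟩ := K.proj_surjective n (x n)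
    obtain ⟨b, hb⟩ := K.proj_surjective n (y n)
    rw [Pi.add_apply, hx m n h a ha.symm, hy m n h b hb.symm, ← map_add, proj_eq_proj]
    apply K.anti h
    rw [← proj_eq_proj, map_add, ha, hb, ← hc, Pi.add_apply]
  zero_mem' m n h c hc := by
    rw [Pi.zero_apply, eq_comm, proj_eq_zero] at hc ⊢
    exact K.anti h hc
  smul_mem' r x hx m n h c hc := by
    -- A scalar `z` approximating `r` modulo `I ^ n` describes the action of `r` at level `n` and at
    -- every lower level.
    obtain ⟨z, hz⟩ := Ideal.Quotient.mk_surjective (AdicCompletion.evalₐ I n r)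
    obtain ⟨a, ha⟩ := K.proj_surjective n (x n)
    rw [Pi.smul_apply, K.level_smul (eval_eq_of_le h hz.symm), hx m n h a ha.symm, ← map_smul,
      proj_eq_proj]
    apply K.anti h
    rw [← proj_eq_proj, map_smul, ha, ← hc, Pi.smul_apply, K.level_smul hz.symm]

theorem compl_ext {K : AdicFil I C} {x y : K.Compl} (h : ∀ m, x.1 m = y.1 m) : x = y :=
  Subtype.ext (funext h)

theorem compl_eq_proj (K : AdicFil I C) (x : K.Compl) {m n : ℕ} (h : m ≤ n) {c : C}
    (hc : x.1 n = K.proj n c) : x.1 m = K.proj m c := x.2 m n h c hc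

/-- The element of the completion given by a Cauchy sequence. -/
def ofSeq (K : AdicFil I C) (c : ℕ → C) (hc : ∀ m n, m ≤ n → c n - c m ∈ K.step m) : K.Compl :=
  ⟨fun m => K.proj m (c m), fun m n h a ha => by
    rw [proj_eq_proj] at ha ⊢
    rw [← neg_mem_iff, neg_sub] at ha
    simpa using neg_mem (add_mem (hc m n h) (K.anti h ha))⟩

theorem ofSeq_apply (K : AdicFil I C) (c : ℕ → C) (hc : ∀ m n, m ≤ n → c n - c m ∈ K.step m)
    (m : ℕ) : (K.ofSeq c hc).1 m = K.proj m (c m) := rfl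

theorem exists_seq (K : AdicFil I C) (x : K.Compl) :
    ∃ c : ℕ → C, (∀ m, x.1 m = K.proj m (c m)) ∧ ∀ m n, m ≤ n → c n - c m ∈ K.step m := by
  choose c hc using fun m => K.proj_surjective m (x.1 m)
  refine ⟨c, fun m => (hc m).symm, fun m n h => ?_⟩
  rw [← proj_eq_proj, hc m, K.compl_eq_proj x h (hc n).symm]

/-- The natural map to the completion. -/
def toCompletion (K : AdicFil I C) : C →ₗ[k] K.Compl where
  toFun x := K.ofSeq (fun _ => x) fun m _ _ => by simp
  map_add' x y := compl_ext fun m => map_add (K.proj m) x y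
  map_smul' z x := compl_ext fun m => map_smul (K.proj m) z x

theorem toCompletion_apply (K : AdicFil I C) (x : C) (m : ℕ) :
    (K.toCompletion x).1 m = K.proj m x := rfl

variable {C' : Type*} [AddCommGroup C'] [Module k C'] {C'' : Type*} [AddCommGroup C'']
  [Module k C'']

/-- The map on completions induced by a filtered map. -/
def map (K : AdicFil I C) (K' : AdicFil I C') (f : C →ₗ[k] C')
    (hf : ∀ m, ∀ x ∈ K.step m, f x ∈ K'.step m) : K.Compl →ₗ[AdicCompletion I k] K'.Compl where
  toFun x := ⟨fun m => Submodule.mapQ (K.step m) (K'.step m) f (hf m) (x.1 m), by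
    obtain ⟨c, hc, hc'⟩ := K.exists_seq x
    have : (fun m => Submodule.mapQ (K.step m) (K'.step m) f (hf m) (x.1 m)) =
        (K'.ofSeq (fun m => f (c m)) fun m n h => by
          rw [← map_sub]; exact hf m _ (hc' m n h)).1 := by
      funext m
      rw [hc m]
      rfl
    rw [this]
    exact Subtype.prop _⟩
  map_add' x y := compl_ext fun m => map_add (Submodule.mapQ _ _ f (hf m)) (x.1 m) (y.1 m)
  map_smul' r x := compl_ext fun m => by
    obtain ⟨z, hz⟩ := Ideal.Quotient.mk_surjective (AdicCompletion.evalₐ I m r)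
    have h1 : (r • x).1 m = z • x.1 m := K.level_smul hz.symm (x.1 m)
    dsimp only
    rw [h1]
    exact (map_smul (Submodule.mapQ _ _ f (hf m)) z (x.1 m)).trans
      (K'.level_smul hz.symm _).symm

theorem map_apply {K : AdicFil I C} {K' : AdicFil I C'} {f : C →ₗ[k] C'}
    (hf : ∀ m, ∀ x ∈ K.step m, f x ∈ K'.step m) {x : K.Compl} {m : ℕ} {c : C}
    (hc : x.1 m = K.proj m c) : (map K K' f hf x).1 m = K'.proj m (f c) := by
  change Submodule.mapQ _ _ f (hf m) (x.1 m) = _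
  rw [hc]
  rfl

theorem map_map (K : AdicFil I C) (K' : AdicFil I C') (K'' : AdicFil I C'') {f : C →ₗ[k] C'}
    {f' : C' →ₗ[k] C''} (hf : ∀ m, ∀ x ∈ K.step m, f x ∈ K'.step m)
    (hf' : ∀ m, ∀ x ∈ K'.step m, f' x ∈ K''.step m) (x : K.Compl) :
    map K' K'' f' hf' (map K K' f hf x) =
      map K K'' (f' ∘ₗ f) (fun m x hx => hf' m _ (hf m x hx)) x :=
  compl_ext fun m => by
    obtain ⟨c, hc⟩ := K.proj_surjective m (x.1 m)
    rw [map_apply _ hc.symm, map_apply _ (map_apply _ hc.symm)]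
    rfl

theorem map_congr {K : AdicFil I C} {K' : AdicFil I C'} {f f' : C →ₗ[k] C'}
    (hf : ∀ m, ∀ x ∈ K.step m, f x ∈ K'.step m) (hf' : ∀ m, ∀ x ∈ K.step m, f' x ∈ K'.step m)
    (h : f = f') (x : K.Compl) : map K K' f hf x = map K K' f' hf' x := by
  subst h; rfl

theorem map_zero_apply {K : AdicFil I C} {K' : AdicFil I C'}
    (hf : ∀ m, ∀ x ∈ K.step m, (0 : C →ₗ[k] C') x ∈ K'.step m) (x : K.Compl) :
    map K K' 0 hf x = 0 :=
  compl_ext fun m => by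
    obtain ⟨c, hc⟩ := K.proj_surjective m (x.1 m)
    rw [map_apply _ hc.symm]
    exact map_zero _

theorem map_toCompletion (K : AdicFil I C) (K' : AdicFil I C') {f : C →ₗ[k] C'}
    (hf : ∀ m, ∀ x ∈ K.step m, f x ∈ K'.step m) (x : C) :
    map K K' f hf (K.toCompletion x) = K'.toCompletion (f x) := rfl

theorem map_liftBaseChange (K : AdicFil I C) (K' : AdicFil I C') {f : C →ₗ[k] C'}
    (hf : ∀ m, ∀ x ∈ K.step m, f x ∈ K'.step m) (x : AdicCompletion I k ⊗[k] C) :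
    map K K' f hf (K.toCompletion.liftBaseChange (AdicCompletion I k) x) =
      K'.toCompletion.liftBaseChange (AdicCompletion I k)
        (f.baseChange (AdicCompletion I k) x) := by
  induction x using TensorProduct.induction_on with
  | zero => simp
  | tmul c x =>
    rw [LinearMap.baseChange_tmul, LinearMap.liftBaseChange_tmul, LinearMap.liftBaseChange_tmul,
      map_smul, map_toCompletion]
  | add a b ha hb => simp only [map_add, ha, hb]

/-! ### Exactness of completion for filtered maps -/

section Exact

variable {K : AdicFil I C} {K' : AdicFil I C'} {K'' : AdicFil I C''}
  {i : C →ₗ[k] C'} {p : C' →ₗ[k] C''} (hi : ∀ m, ∀ x ∈ K.step m, i x ∈ K'.step m)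
  (hp : ∀ m, ∀ x ∈ K'.step m, p x ∈ K''.step m)

/-- The hypothesis `hcof`, of Artin–Rees type, says that the filtration induced through `i` is
cofinal with the given one. Vanishing of the image at level `n` then forces vanishing at level `m`.
-/
theorem map_injective (hcof : ∀ m, ∃ n, m ≤ n ∧ ∀ x, i x ∈ K'.step n → x ∈ K.step m) :
    Function.Injective (map K K' i hi) := by
  rw [injective_iff_map_eq_zero]
  intro x hx
  obtain ⟨c, hc, hc'⟩ := K.exists_seq x
  refine compl_ext fun m => ?_
  obtain ⟨n, hmn, hn⟩ := hcof m
  rw [K.compl_eq_proj x hmn (hc n)]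
  refine K.proj_eq_zero.2 (hn _ ?_)
  rw [← proj_eq_zero, ← map_apply hi (hc n), hx]
  rfl

/-- By `hlift` each representative of a kernel element can be corrected within its filtration step
to lie in the image of `i`. The chosen preimages form a Cauchy sequence after reindexing by the
shift that `hcof` provides. -/
theorem map_exact (hcof : ∀ m, ∃ n, m ≤ n ∧ ∀ x, i x ∈ K'.step n → x ∈ K.step m)
    (hlift : ∀ m, ∀ y ∈ K''.step m, ∃ x ∈ K'.step m, p x = y) (hex : Function.Exact i p) :
    Function.Exact (map K K' i hi) (map K' K'' p hp) := by
  intro x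
  constructor
  · intro hx
    obtain ⟨c, hc, hc'⟩ := K'.exists_seq x
    have key (m : ℕ) : ∃ a, x.1 m = K'.proj m (i a) := by
      have h0 : p (c m) ∈ K''.step m := by
        rw [← proj_eq_zero, ← map_apply hp (hc m), hx]; rfl
      obtain ⟨y, hy, hyc⟩ := hlift m _ h0
      obtain ⟨a, ha⟩ := (hex (c m - y)).1 (by rw [map_sub, hyc, sub_self])
      refine ⟨a, ?_⟩
      rw [hc m, ha, proj_eq_proj]
      simpa using hy
    choose a ha using key
    choose t ht ht' using hcof
    -- The images of `a s` and `a (t m)` agree only modulo step `t m` of `K'`; pulled back along `i`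
    -- this gives agreement modulo step `m` of `K`.
    have hdiff (m s : ℕ) (hs : t m ≤ s) : a s - a (t m) ∈ K.step m := by
      apply ht'
      rw [map_sub, ← proj_eq_proj, ← ha (t m), K'.compl_eq_proj x hs (ha s)]
    refine ⟨K.ofSeq (fun m => a (t m)) fun m n hmn => ?_, compl_ext fun m => ?_⟩
    · have h1 := hdiff m (max (t m) (t n)) (le_max_left _ _)
      have h2 := K.anti hmn (hdiff n (max (t m) (t n)) (le_max_right _ _))
      simpa using sub_mem h1 h2
    · rw [map_apply hi (K.ofSeq_apply _ _ m), K'.compl_eq_proj x (ht m) (ha (t m))]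
  · rintro ⟨y, rfl⟩
    rw [map_map, map_congr _ (f' := 0) (by simp) hex.linearMap_comp_eq_zero, map_zero_apply]

/-- Lifts are chosen one after the other. Since `p` maps each step onto the corresponding step, the
next lift can be taken congruent to the previous one, so the lifts are Cauchy. -/
theorem map_surjective (hlift : ∀ m, ∀ y ∈ K''.step m, ∃ x ∈ K'.step m, p x = y)
    (hsurj : Function.Surjective p) : Function.Surjective (map K' K'' p hp) := by
  intro y
  obtain ⟨c, hc, hc'⟩ := K''.exists_seq y
  have hstep (m : ℕ) (x : {x // p x = c m}) :
      ∃ x' : {x // p x = c (m + 1)}, x'.1 - x.1 ∈ K'.step m := by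
    obtain ⟨κ, hκ, hκ'⟩ := hlift m _ (hc' m (m + 1) m.le_succ)
    exact ⟨⟨x.1 + κ, by rw [map_add, x.2, hκ']; abel⟩, by simpa using hκ⟩
  choose F hF using hstep
  let a : ∀ m, {x // p x = c m} := fun m =>
    Nat.rec ⟨(hsurj (c 0)).choose, (hsurj (c 0)).choose_spec⟩ F m
  have ha (m : ℕ) : (a (m + 1)).1 - (a m).1 ∈ K'.step m := hF m (a m)
  refine ⟨K'.ofSeq (fun m => (a m).1) fun m n hmn => ?_, compl_ext fun m => ?_⟩
  · induction n, hmn using Nat.le_induction with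
    | base => simp
    | succ n hmn ih => simpa using add_mem (K'.anti hmn (ha n)) ih
  · rw [map_apply hp (K'.ofSeq_apply _ _ m), (a m).2, hc m]

end Exact

/-- The `I`-adic filtration. -/
def adic (C : Type*) [AddCommGroup C] [Module k C] : AdicFil I C where
  step m := I ^ m • ⊤
  anti _ _ h := Submodule.smul_mono_left (Ideal.pow_le_pow_right h)
  smul_mem _ _ hz _ := Submodule.smul_mem_smul hz trivial

/-- Level by level the map agrees with `AdicCompletion.ofTensorProduct`, which is bijective for
finite modules over a Noetherian ring. -/
theorem adic_bijective_of_same_universe {k : Type u} [CommRing k] {I : Ideal k} {C : Type u}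
    [AddCommGroup C] [Module k C] [IsNoetherianRing k] [Module.Finite k C] :
    Function.Bijective
      (((adic C : AdicFil I C).toCompletion).liftBaseChange (AdicCompletion I k)) := by
  have key (t : AdicCompletion I k ⊗[k] C) (m : ℕ) :
      ((((adic C : AdicFil I C).toCompletion).liftBaseChange (AdicCompletion I k)) t).1 m =
        (AdicCompletion.ofTensorProduct I C t).val m := by
    induction t using TensorProduct.induction_on with
    | zero => simp; rfl
    | tmul c x =>
      obtain ⟨z, hz⟩ := Ideal.Quotient.mk_surjective (AdicCompletion.evalₐ I m c)
      rw [LinearMap.liftBaseChange_tmul, AdicCompletion.ofTensorProduct_tmul]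
      refine ((adic C : AdicFil I C).level_smul hz.symm _).trans ?_
      obtain ⟨r, rfl⟩ := AdicCompletion.mk_surjective I k c
      rw [AdicCompletion.evalₐ_mk] at hz
      have hz' : z - r.val m ∈ I ^ m := Ideal.Quotient.eq.1 hz
      rw [toCompletion_apply, ← map_smul]
      change _ = (adic C : AdicFil I C).proj m (r.val m • x)
      rw [proj_eq_proj, ← sub_smul]
      exact (adic C : AdicFil I C).smul_mem m _ hz' x
    | add a b ha hb =>
      rw [map_add, map_add]
      exact congrArg₂ (· + ·) ha hb
  have hb := AdicCompletion.ofTensorProduct_bijective_of_finite_of_isNoetherian I C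
  constructor
  · intro s t h
    apply hb.1
    ext m
    rw [← key, ← key, h]
  · intro y
    obtain ⟨c, hc, hc'⟩ := exists_seq _ y
    have hy : ∀ {m n : ℕ} (h : m ≤ n), AdicCompletion.transitionMap I C h (y.1 n) = y.1 m := by
      intro m n h
      rw [hc n, compl_eq_proj _ y h (hc n)]
      rfl
    obtain ⟨t, ht⟩ := hb.2 ⟨y.1, hy⟩
    exact ⟨t, compl_ext fun m => by rw [key, ht]⟩

/-- A finite module is isomorphic to a quotient of some `k ^ n`, which lives in the universe of `k`.
Linear isomorphisms preserve the adic filtrations, so the previous case transfers. -/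
theorem adic_bijective [IsNoetherianRing k] [Module.Finite k C] :
    Function.Bijective
      (((adic C : AdicFil I C).toCompletion).liftBaseChange (AdicCompletion I k)) := by
  obtain ⟨n, s, hs⟩ := Module.Finite.exists_fin' k C
  let e : C ≃ₗ[k] ((Fin n → k) ⧸ LinearMap.ker s) := (s.quotKerEquivOfSurjective hs).symm
  have hf : ∀ m, ∀ x ∈ (adic C : AdicFil I C).step m,
      e.toLinearMap x ∈ (adic ((Fin n → k) ⧸ LinearMap.ker s) : AdicFil I _).step m := by
    intro m x hx
    refine Submodule.smul_induction_on hx (fun z hz y _ => ?_) fun x y hx hy => ?_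
    · rw [map_smul]; exact smul_mem _ m z hz _
    · rw [map_add]; exact add_mem hx hy
  have hinj := map_injective hf fun m => ⟨m, le_rfl, fun x hx => by
    rw [← e.symm_apply_apply x]
    refine Submodule.smul_induction_on (p := fun w => e.symm w ∈ (adic C : AdicFil I C).step m) hx
      (fun z hz y _ => ?_) fun x y hx hy => ?_
    · rw [map_smul]; exact smul_mem _ m z hz _
    · rw [map_add]; exact add_mem hx hy⟩
  have hcomp : Function.Bijective (map _ _ e.toLinearMap hf ∘
      (((adic C : AdicFil I C).toCompletion).liftBaseChange (AdicCompletion I k))) := by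
    have : (map _ _ e.toLinearMap hf ∘
      (((adic C : AdicFil I C).toCompletion).liftBaseChange (AdicCompletion I k))) =
        ((adic _ : AdicFil I ((Fin n → k) ⧸ LinearMap.ker s)).toCompletion).liftBaseChange
          (AdicCompletion I k) ∘ e.baseChange k (AdicCompletion I k) _ _ :=
      funext fun x => map_liftBaseChange _ _ hf x
    rw [this]
    exact adic_bijective_of_same_universe.comp (LinearEquiv.bijective _)
  refine ⟨hcomp.1.of_comp, fun y => ?_⟩
  obtain ⟨x, hx⟩ := hcomp.2 (map _ _ e.toLinearMap hf y)
  exact ⟨x, hinj hx⟩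

end AdicFil

end Filtered

/-! ### The Hochschild complex with coefficients in a bimodule -/

section Coefficients

/-- The enveloping algebra. Its modules are the `A`-bimodules. -/
abbrev Env (A : Type*) [Ring A] [Algebra ℂ A] : Type _ := A ⊗[ℂ] Aᵐᵒᵖ

variable {A : Type*} [Ring A] [Algebra ℂ A]

/-- Left multiplication by `a`, as an element of the enveloping algebra. -/
def leftMul : A →ₐ[ℂ] Env A := Algebra.TensorProduct.includeLeft

/-- Right multiplication by `a`, as an element of the enveloping algebra. -/
def rightMul : A →ₗ[ℂ] Env A :=
  (Algebra.TensorProduct.includeRight : Aᵐᵒᵖ →ₐ[ℂ] Env A).toLinearMap ∘ₗ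
    (MulOpposite.opLinearEquiv ℂ).toLinearMap

theorem leftMul_apply (a : A) : leftMul a = a ⊗ₜ[ℂ] (1 : Aᵐᵒᵖ) := rfl

theorem rightMul_apply (a : A) : rightMul a = (1 : A) ⊗ₜ[ℂ] MulOpposite.op a := rfl

theorem rightMul_one : rightMul (1 : A) = 1 := rfl

theorem rightMul_mul (a b : A) : rightMul (a * b) = rightMul b * rightMul a := by
  simp [rightMul_apply]

theorem leftMul_mul_rightMul (a b : A) : leftMul a * rightMul b = rightMul b * leftMul a := by
  simp [rightMul_apply, leftMul_apply]

variable (A) in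
/-- `M ⊗ (A / ℂ1)^{⊗ q}`. -/
abbrev CoChain (M : Type*) [AddCommGroup M] [Module ℂ M] (q : ℕ) : Type _ :=
  M ⊗[ℂ] PiTensorProduct ℂ (fun _ : Fin q => Bar A)

section Tensor

variable {M : Type*} [AddCommGroup M] [Module ℂ M]

/-- The chain `x ⊗ a₁ ⊗ ⋯ ⊗ a_q`. -/
def cTensor {q : ℕ} (x : M) (a : Fin q → A) : CoChain A M q :=
  x ⊗ₜ[ℂ] PiTensorProduct.tprod ℂ fun i => (Submodule.span ℂ {(1 : A)}).mkQ (a i)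

theorem cTensor_eq_zero {q : ℕ} (x : M) (a : Fin q → A) (i : Fin q) (h : a i = 1) :
    cTensor x a = 0 := by
  unfold cTensor
  rw [(PiTensorProduct.tprod ℂ).map_coord_zero i, TensorProduct.tmul_zero]
  simp [h, Submodule.mem_span_singleton_self]

theorem cTensor_update_add {q : ℕ} (x : M) (a : Fin q → A) (i : Fin q) (b c : A) :
    cTensor x (Function.update a i (b + c)) =
      cTensor x (Function.update a i b) + cTensor x (Function.update a i c) := by
  simp only [cTensor, ← TensorProduct.tmul_add]
  congr 1
  exact ((PiTensorProduct.tprod ℂ).compLinearMap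
    (fun _ : Fin q => (Submodule.span ℂ {(1 : A)}).mkQ)).map_update_add a i b c

theorem cTensor_update_smul {q : ℕ} (x : M) (a : Fin q → A) (i : Fin q) (c : ℂ) (b : A) :
    cTensor x (Function.update a i (c • b)) = c • cTensor x (Function.update a i b) := by
  simp only [cTensor, ← TensorProduct.tmul_smul]
  congr 1
  exact ((PiTensorProduct.tprod ℂ).compLinearMap
    (fun _ : Fin q => (Submodule.span ℂ {(1 : A)}).mkQ)).map_update_smul a i c b

theorem cTensor_add_left {q : ℕ} (x y : M) (a : Fin q → A) :
    cTensor (x + y) a = cTensor x a + cTensor y a := TensorProduct.add_tmul _ _ _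

theorem cTensor_smul_left {q : ℕ} (c : ℂ) (x : M) (a : Fin q → A) :
    cTensor (c • x) a = c • cTensor x a := (TensorProduct.smul_tmul' _ _ _).symm

variable {R : Type*} [CommRing R] [Algebra ℂ R] [Module R M] [IsScalarTower ℂ R M]

theorem cTensor_rsmul_left {q : ℕ} (c : R) (x : M) (a : Fin q → A) :
    cTensor (c • x) a = c • cTensor x a := (TensorProduct.smul_tmul' _ _ _).symm

theorem coChain_hom_ext {W : Type*} [AddCommMonoid W] [Module R W] {q : ℕ}
    {f₁ f₂ : CoChain A M q →ₗ[R] W} (h : ∀ x a, f₁ (cTensor x a) = f₂ (cTensor x a)) :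
    f₁ = f₂ := by
  let _ : Module ℂ W := Module.compHom W (algebraMap ℂ R)
  have _ : IsScalarTower ℂ R W := .of_algebraMap_smul fun _ _ => rfl
  refine TensorProduct.AlgebraTensorModule.ext fun x t => ?_
  induction t using PiTensorProduct.induction_on with
  | smul_tprod r a =>
    have ha : a = fun i => (Submodule.span ℂ {(1 : A)}).mkQ (a i).out := by
      funext i; simp
    rw [TensorProduct.tmul_smul, ← algebraMap_smul R r, map_smul, map_smul, ha]
    congr 1
    exact h _ _
  | add x y hx hy => rw [TensorProduct.tmul_add, map_add, map_add, hx, hy]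

theorem coChain_induction {q : ℕ} {P : CoChain A M q → Prop} (t : CoChain A M q)
    (h0 : P 0) (htensor : ∀ x a, P (cTensor x a)) (hadd : ∀ s t, P s → P t → P (s + t)) : P t := by
  induction t using TensorProduct.induction_on with
  | zero => exact h0
  | tmul x t =>
    induction t using PiTensorProduct.induction_on generalizing x with
    | smul_tprod r a =>
      have ha : a = fun i => (Submodule.span ℂ {(1 : A)}).mkQ (a i).out := by
        funext i; simp
      rw [TensorProduct.tmul_smul, TensorProduct.smul_tmul', ha]
      exact htensor _ _
    | add t s ht hs => rw [TensorProduct.tmul_add]; exact hadd _ _ (ht x) (hs x)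
  | add s t hs ht => exact hadd _ _ hs ht

end Tensor

variable {M : Type*} [AddCommGroup M] [Module ℂ M] [Module (Env A) M] [IsScalarTower ℂ (Env A) M]

/-- The entry in position `0` of the `j`-th face of `x ⊗ a₁ ⊗ ⋯ ⊗ a_{q+1}`. -/
def cHead {q : ℕ} (j : ℕ) (x : M) (a : Fin (q + 1) → A) : M :=
  if j = 0 then rightMul (a 0) • x else if j = q + 1 then leftMul (a (Fin.last q)) • x else x

/-- The action of a linear family of elements of the enveloping algebra on an element. -/
def actOn (ψ : A →ₗ[ℂ] Env A) (x : M) : A →ₗ[ℂ] M where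
  toFun a := ψ a • x
  map_add' a b := by rw [map_add, add_smul]
  map_smul' c a := by rw [map_smul, smul_assoc]; rfl

/-- How a face depends on one of the entries. -/
theorem cFace_update {q : ℕ} (j : ℕ) (hj : j ≤ q + 1) (x : M)
    (a : Fin (q + 1) → A) (p : Fin (q + 1)) :
    (∃ φ : A →ₗ[ℂ] M, ∀ b, cHead j x (Function.update a p b) = φ b ∧
      faceTail j (Function.update a p b) = faceTail j a) ∨
    (∃ (φ : A →ₗ[ℂ] A) (i : Fin q), ∀ b,
      cHead j x (Function.update a p b) = cHead j x a ∧
      faceTail j (Function.update a p b) = Function.update (faceTail j a) i (φ b)) := by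
  by_cases h0 : j = 0 ∧ (p : ℕ) = 0
  · obtain ⟨rfl, hp⟩ := h0
    obtain rfl : p = 0 := Fin.ext hp
    refine Or.inl ⟨actOn rightMul x, fun b => ⟨by simp [cHead, actOn], ?_⟩⟩
    funext i
    simp [faceTail]
  by_cases h1 : j = q + 1 ∧ (p : ℕ) = q
  · obtain ⟨rfl, hp⟩ := h1
    obtain rfl : p = Fin.last q := Fin.ext hp
    refine Or.inl ⟨actOn leftMul.toLinearMap x, fun b => ⟨by simp [cHead, actOn], ?_⟩⟩
    funext i
    simp [faceTail, (Fin.castSucc_lt_last i).ne]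
  have hhead : ∀ b, cHead j x (Function.update a p b) = cHead j x a := by
    intro b
    have e0 : j = 0 → (0 : Fin (q + 1)) ≠ p := fun h h' => h0 ⟨h, by rw [← h']; rfl⟩
    have e1 : j = q + 1 → Fin.last q ≠ p := fun h h' => h1 ⟨h, by rw [← h']; rfl⟩
    simp only [cHead]
    split_ifs with h h'
    · rw [Function.update_of_ne (e0 h)]
    · rw [Function.update_of_ne (e1 h')]
    · rfl
  have hp := p.isLt
  refine Or.inr ?_
  by_cases hpj : (p : ℕ) < j
  · have hpq : (p : ℕ) < q := by omega
    refine ⟨if (p : ℕ) + 1 = j then LinearMap.mulRight ℂ (a (Fin.succ ⟨p, hpq⟩))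
      else LinearMap.id, ⟨p, hpq⟩, fun b => ⟨hhead b, ?_⟩⟩
    funext i
    simp only [faceTail, Function.update_apply, Fin.ext_iff, Fin.val_castSucc, Fin.val_succ]
    split_ifs <;> first | omega | rfl | skip
    · have hi : i = ⟨p, hpq⟩ := Fin.ext (by omega)
      simp [hi]
  · refine ⟨if (p : ℕ) = j then LinearMap.mulLeft ℂ (a (Fin.castSucc ⟨p - 1, by omega⟩))
      else LinearMap.id, ⟨p - 1, by omega⟩, fun b => ⟨hhead b, ?_⟩⟩
    funext i
    simp only [faceTail, Function.update_apply, Fin.ext_iff, Fin.val_castSucc, Fin.val_succ]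
    split_ifs <;> first | omega | rfl | skip
    · have hi : i = ⟨p - 1, by omega⟩ := Fin.ext (by simp; omega)
      simp [hi]

/-- The `j`-th face of `x ⊗ a₁ ⊗ ⋯ ⊗ a_{q+1}`, as a multilinear function of `a₁, …, a_{q+1}`. -/
def cFace {q : ℕ} (j : Fin (q + 2)) (x : M) :
    MultilinearMap ℂ (fun _ : Fin (q + 1) => A) (CoChain A M q) where
  toFun a := cTensor (cHead j x a) (faceTail j a)
  map_update_add' := by
    intro dec a p b c
    obtain rfl : dec = instDecidableEqFin _ := Subsingleton.elim _ _
    rcases cFace_update j (by omega) x a p with ⟨φ, h⟩ | ⟨φ, i, h⟩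
    · simp only [h, map_add, cTensor_add_left]
    · simp only [h, map_add, cTensor_update_add]
  map_update_smul' := by
    intro dec a p c b
    obtain rfl : dec = instDecidableEqFin _ := Subsingleton.elim _ _
    rcases cFace_update j (by omega) x a p with ⟨φ, h⟩ | ⟨φ, i, h⟩
    · simp only [h, map_smul, cTensor_smul_left]
    · simp only [h, map_smul, cTensor_update_smul]

/-- The boundary of `x ⊗ a₁ ⊗ ⋯ ⊗ a_{q+1}` as a multilinear function of `a₁, …, a_{q+1}`. -/
def cBoundaryAux (q : ℕ) (x : M) : MultilinearMap ℂ (fun _ : Fin (q + 1) => A) (CoChain A M q) :=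
  ∑ j : Fin (q + 2), (-1 : ℂ) ^ (j : ℕ) • cFace j x

theorem cBoundaryAux_apply (q : ℕ) (x : M) (a : Fin (q + 1) → A) :
    cBoundaryAux q x a =
      ∑ j : Fin (q + 2), (-1 : ℂ) ^ (j : ℕ) • cTensor (cHead j x a) (faceTail j a) := by
  simp [cBoundaryAux, cFace]

/-- The two faces absorbing the entry `1` coincide and carry opposite signs. Every other face still
has `1` among its tail entries and so vanishes in the normalized complex. -/
theorem cBoundaryAux_one (q : ℕ) (x : M) (a : Fin (q + 1) → A)
    (p : Fin (q + 1)) (hp : a p = 1) : cBoundaryAux q x a = 0 := by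
  rw [cBoundaryAux_apply]
  have hpl := p.isLt
  rw [Fintype.sum_eq_add p.castSucc p.succ]
  · have hH : cHead (p.succ : ℕ) x a = cHead (p.castSucc : ℕ) x a := by
      have e0 : (p : ℕ) = 0 → a 0 = 1 := fun h => by
        rw [← hp]; congr 1; exact Fin.ext h.symm
      have e1 : (p : ℕ) = q → a (Fin.last q) = 1 := fun h => by
        rw [← hp]; congr 1; exact Fin.ext h.symm
      simp only [cHead, Fin.val_succ, Fin.val_castSucc]
      split_ifs <;> first | omega | simp_all [rightMul_one]
    have hT : faceTail (p.succ : ℕ) a = faceTail (p.castSucc : ℕ) a := by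
      funext i
      have e0 : (p : ℕ) = i → a i.castSucc = 1 := fun h => by
        rw [← hp]; congr 1; exact Fin.ext h.symm
      have e1 : (p : ℕ) = i + 1 → a i.succ = 1 := fun h => by
        rw [← hp]; congr 1; exact Fin.ext h.symm
      simp only [faceTail, Fin.val_succ, Fin.val_castSucc]
      split_ifs <;> first | omega | rfl | skip
      · rw [e1 (by omega), mul_one]
      · rw [e0 (by omega), one_mul]
    rw [hH, hT, ← add_smul, Fin.val_succ, Fin.val_castSucc, pow_succ]
    simp
  · exact (Fin.castSucc_lt_succ).ne
  · rintro j ⟨h1, h2⟩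
    have h1' : (j : ℕ) ≠ p := fun h => h1 (Fin.ext h)
    have h2' : (j : ℕ) ≠ p + 1 := fun h => h2 (Fin.ext h)
    have hj := j.isLt
    by_cases h : (j : ℕ) < p
    · rw [cTensor_eq_zero _ _ ⟨p - 1, by omega⟩, smul_zero]
      simp only [faceTail]
      rw [if_neg (by omega), if_neg (by omega), ← hp]
      congr 1; ext; simp; omega
    · rw [cTensor_eq_zero _ _ ⟨p, by omega⟩, smul_zero]
      simp only [faceTail]
      rw [if_pos (by omega), ← hp]
      rfl

theorem cBoundaryAux_eq_zero (q : ℕ) (x : M) (a : Fin (q + 1) → A)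
    (p : Fin (q + 1)) (hp : a p ∈ Submodule.span ℂ {(1 : A)}) : cBoundaryAux q x a = 0 := by
  obtain ⟨c, hc⟩ := Submodule.mem_span_singleton.1 hp
  rw [← Function.update_eq_self p a, ← hc, MultilinearMap.map_update_smul,
    cBoundaryAux_one q x _ p (by simp), smul_zero]

theorem cBoundaryAux_add (q : ℕ) (x y : M) :
    cBoundaryAux (A := A) q (x + y) = cBoundaryAux q x + cBoundaryAux q y := by
  ext a
  simp only [add_apply, cBoundaryAux_apply, ← Finset.sum_add_distrib, ← smul_add,
    ← cTensor_add_left]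
  refine Finset.sum_congr rfl fun j _ => ?_
  congr 2
  simp only [cHead]
  split_ifs <;> simp

variable (R : Type*) [CommRing R] [Algebra ℂ R] [Algebra R A] [IsScalarTower ℂ R A]
  [Module R M] [IsScalarTower R (Env A) M] [IsScalarTower ℂ R M]

theorem env_smul_comm (e : Env A) (z : R) (x : M) : e • z • x = z • e • x := by
  rw [← algebraMap_smul (Env A) z x, ← algebraMap_smul (Env A) z (e • x), ← mul_smul, ← mul_smul,
    Algebra.commutes]

theorem cHead_smul {q : ℕ} (j : ℕ) (z : R) (x : M) (a : Fin (q + 1) → A) :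
    cHead j (z • x) a = z • cHead j x a := by
  simp only [cHead]
  split_ifs <;> simp [env_smul_comm]

theorem cBoundaryAux_smul (q : ℕ) (z : R) (x : M) (a : Fin (q + 1) → A) :
    cBoundaryAux q (z • x) a = z • cBoundaryAux q x a := by
  simp only [cBoundaryAux_apply, Finset.smul_sum, smul_comm z ((_ : ℂ) ^ _), cHead_smul,
    cTensor_rsmul_left]

/-- The boundary of the Hochschild complex with coefficients in `M`. -/
def cBoundary (q : ℕ) : CoChain A M (q + 1) →ₗ[R] CoChain A M q :=
  TensorProduct.AlgebraTensorModule.lift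
    { toFun := fun x => PiTensorProduct.lift
        (descend _ (cBoundaryAux q x) (cBoundaryAux_eq_zero q x))
      map_add' := fun x y => by
        ext a
        simp [descend, cBoundaryAux_add]
      map_smul' := fun z x => by
        ext a
        simp [descend, cBoundaryAux_smul] }

theorem cBoundary_cTensor (q : ℕ) (x : M) (a : Fin (q + 1) → A) :
    cBoundary R q (cTensor x a) =
      ∑ j : Fin (q + 2), (-1 : ℂ) ^ (j : ℕ) • cTensor (cHead j x a) (faceTail j a) := by
  rw [← cBoundaryAux_apply, cBoundary, cTensor, TensorProduct.AlgebraTensorModule.lift_tmul]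
  exact (PiTensorProduct.lift.tprod _).trans (descend_mk _ _ _ a)

/-- The head part of the presimplicial identity `d_i d_j = d_{j-1} d_i`. Its nontrivial cases are
associativity of the right action, associativity of the left action, and the commutation of the two.
-/
theorem cHead_cHead (q i j : ℕ) (hij : i < j) (hj : j ≤ q + 2) (x : M) (a : Fin (q + 2) → A) :
    cHead i (cHead j x a) (faceTail j a) = cHead (j - 1) (cHead i x a) (faceTail i a) := by
  have hl : (Fin.last q).succ = Fin.last (q + 1) := rfl
  simp only [cHead, faceTail, Fin.val_zero, Fin.val_last, Fin.castSucc_zero, hl]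
  obtain rfl | hi := Nat.eq_zero_or_pos i
  · obtain rfl | hj1 : j = 1 ∨ 1 < j := by omega
    · simp [rightMul_mul, mul_smul]
    · obtain rfl | hj2 : j = q + 2 ∨ j < q + 2 := by omega
      · simp [← mul_smul, leftMul_mul_rightMul]
      · simp [hj1, hj2.ne, show ¬ j - 1 = 0 by omega, show ¬ j = 0 by omega]
  · obtain rfl | hj2 : j = q + 2 ∨ j < q + 2 := by omega
    · obtain rfl | hi2 : i = q + 1 ∨ i < q + 1 := by omega
      · simp [mul_smul]
      · simp [hi.ne', hi2.ne, show ¬ i = q + 2 by omega, show ¬ q + 1 < i by omega,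
          show ¬ q + 1 = i by omega]
    · simp [hi.ne', hj2.ne, show ¬ j - 1 = 0 by omega, show ¬ j = 0 by omega,
        show ¬ i = q + 1 by omega, show ¬ i = q + 2 by omega]

theorem cBoundary_cBoundary (q : ℕ) (t : CoChain A M (q + 2)) :
    cBoundary R q (cBoundary R (q + 1) t) = 0 := by
  rw [← LinearMap.comp_apply, ← LinearMap.zero_apply (σ₁₂ := RingHom.id R) t]
  congr 1
  refine coChain_hom_ext fun x a => ?_
  have hs (c : ℂ) (x : CoChain A M (q + 1)) : cBoundary R q (c • x) = c • cBoundary R q x := by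
    rw [← algebraMap_smul R c, map_smul, algebraMap_smul]
  rw [LinearMap.comp_apply, cBoundary_cTensor, map_sum, LinearMap.zero_apply,
    ← alternating_sum_eq_zero (q + 2)
      (fun j i => cTensor (cHead i (cHead j x a) (faceTail j a))
        (faceTail i (faceTail j a)))
      (fun i j hij hj => by
        rw [cHead_cHead q i j hij hj, face_face_tail q i j hij]),
    Finset.sum_product, Finset.sum_range]
  refine Finset.sum_congr rfl fun j _ => ?_
  rw [hs, cBoundary_cTensor, Finset.sum_range, Finset.smul_sum]
  simp only [smul_smul, pow_add]

variable {M' : Type*} [AddCommGroup M'] [Module ℂ M'] [Module (Env A) M']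
  [IsScalarTower ℂ (Env A) M'] [Module R M'] [IsScalarTower R (Env A) M'] [IsScalarTower ℂ R M']

/-- The morphism of complexes induced by a homomorphism of bimodules. -/
def cMap (φ : M →ₗ[Env A] M') (q : ℕ) : CoChain A M q →ₗ[R] CoChain A M' q :=
  TensorProduct.AlgebraTensorModule.map (φ.restrictScalars R) LinearMap.id

theorem cMap_cTensor (φ : M →ₗ[Env A] M') {q : ℕ} (x : M) (a : Fin q → A) :
    cMap R φ q (cTensor x a) = cTensor (φ x) a := by
  simp [cMap, cTensor]

theorem cBoundary_cMap (φ : M →ₗ[Env A] M') (q : ℕ) (t : CoChain A M (q + 1)) :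
    cBoundary R q (cMap R φ (q + 1) t) = cMap R φ q (cBoundary R q t) := by
  rw [← LinearMap.comp_apply, ← LinearMap.comp_apply]
  congr 1
  refine coChain_hom_ext fun x a => ?_
  have hs (c : ℂ) (x : CoChain A M q) : cMap R φ q (c • x) = c • cMap R φ q x := by
    rw [← algebraMap_smul R c, map_smul, algebraMap_smul]
  simp only [LinearMap.comp_apply, cMap_cTensor, cBoundary_cTensor, map_sum, hs]
  refine Finset.sum_congr rfl fun j _ => ?_
  congr 2
  simp only [cHead]
  split_ifs <;> simp

/-- The complexes of a short exact sequence of bimodules. -/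
theorem cMap_shortExact {M'' : Type*} [AddCommGroup M''] [Module ℂ M''] [Module (Env A) M'']
    [IsScalarTower ℂ (Env A) M''] [Module R M''] [IsScalarTower R (Env A) M'']
    [IsScalarTower ℂ R M''] (φ : M →ₗ[Env A] M') (ψ : M' →ₗ[Env A] M'')
    (hφ : Function.Injective φ) (hex : Function.Exact φ ψ) (hψ : Function.Surjective ψ) :
    ShortExactSeq (N := CoChain A M) (L := CoChain A M') (M := CoChain A M'')
      (cBoundary R) (cBoundary R) (cBoundary R) (cMap R φ) (cMap R ψ) where
  sq_zero := cBoundary_cBoundary R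
  comm_i := cBoundary_cMap R φ
  comm_p := cBoundary_cMap R ψ
  inj q := by
    -- Over the field `ℂ` the map `φ` has a linear retraction, and this survives tensoring.
    obtain ⟨ρ, hρ⟩ := (φ.restrictScalars ℂ).exists_leftInverse_of_injective
      (LinearMap.ker_eq_bot.2 hφ)
    refine Function.LeftInverse.injective
      (g := ρ.rTensor (PiTensorProduct ℂ (fun _ : Fin q => Bar A))) fun t => ?_
    change (ρ.rTensor _) ((φ.restrictScalars ℂ).rTensor _ t) = t
    rw [← LinearMap.comp_apply, ← LinearMap.rTensor_comp, hρ, LinearMap.rTensor_id,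
      LinearMap.id_apply]
  exact q := rTensor_exact (PiTensorProduct ℂ (fun _ : Fin q => Bar A))
    (f := φ.restrictScalars ℂ) (g := ψ.restrictScalars ℂ) hex hψ
  surj q := LinearMap.rTensor_surjective (PiTensorProduct ℂ (fun _ : Fin q => Bar A))
    (g := ψ.restrictScalars ℂ) hψ

end Coefficients

/-! ### The filtrations of a bimodule and of its Hochschild complex -/

/-- With `N` the image of `φ`, take a complement `P'` of `N ∩ P` in `P` and enlarge it to a
complement `Q` of `N`. Projection along `Q` maps `P` into `N ∩ P`. This carries the Artin–Rees
estimate from bimodules over to chains, whose tensor products are over `ℂ`. -/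
theorem exists_retraction {V W : Type*} [AddCommGroup V] [Module ℂ V] [AddCommGroup W] [Module ℂ W]
    (φ : W →ₗ[ℂ] V) (hφ : Function.Injective φ) (P : Submodule ℂ V) :
    ∃ ρ : V →ₗ[ℂ] W, (∀ x, ρ (φ x) = x) ∧ ∀ x ∈ P, φ (ρ x) ∈ P := by
  set N := LinearMap.range φ with hN
  obtain ⟨P', hd, hP⟩ :=
    IsModularLattice.exists_disjoint_and_sup_eq (inf_le_right : N ⊓ P ≤ P)
  have hP' : P' ≤ P := hP ▸ le_sup_right
  have hdis : Disjoint P' N := by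
    rw [disjoint_iff, eq_bot_iff, ← disjoint_iff.1 hd]
    exact le_inf (le_inf inf_le_right (inf_le_left.trans hP')) inf_le_left
  obtain ⟨Q, hQ, hc⟩ := hdis.exists_isCompl
  refine ⟨LinearMap.linearProjOfIsCompl Q φ hφ hc.symm,
    fun x => LinearMap.linearProjOfIsCompl_apply_left _ _ _ _ x, fun x hx => ?_⟩
  rw [← hP] at hx
  obtain ⟨_, ⟨⟨y, rfl⟩, hy⟩, z, hz, rfl⟩ := Submodule.mem_sup.1 hx
  rw [map_add, LinearMap.linearProjOfIsCompl_apply_right' _ _ _ _ z (hQ hz), add_zero,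
    LinearMap.linearProjOfIsCompl_apply_left]
  exact hy

section Filtration

variable {k A : Type*} [CommRing k] [Algebra ℂ k] [Ring A] [Algebra ℂ A] [Algebra k A]
  [IsScalarTower ℂ k A]

variable (k A) in
/-- The map from `k ⊗ k` to the center of the enveloping algebra. -/
def centerMap : k ⊗[ℂ] k →ₐ[ℂ] Env A :=
  Algebra.TensorProduct.map (IsScalarTower.toAlgHom ℂ k A) (IsScalarTower.toAlgHom ℂ k Aᵐᵒᵖ)

theorem centerMap_commutes (s : k ⊗[ℂ] k) (e : Env A) :
    centerMap k A s * e = e * centerMap k A s := by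
  induction s using TensorProduct.induction_on with
  | zero => simp
  | add a b ha hb => rw [map_add, add_mul, mul_add, ha, hb]
  | tmul z w =>
    induction e using TensorProduct.induction_on with
    | zero => simp
    | add a b ha hb => rw [add_mul, mul_add, ha, hb]
    | tmul a b =>
      simp only [centerMap, Algebra.TensorProduct.map_tmul, IsScalarTower.coe_toAlgHom',
        Algebra.TensorProduct.tmul_mul_tmul, Algebra.commutes]

instance centerAlgebra : Algebra (k ⊗[ℂ] k) (Env A) :=
  (centerMap k A).toRingHom.toAlgebra' centerMap_commutes

theorem algebraMap_center_left (z : k) :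
    algebraMap (k ⊗[ℂ] k) (Env A) (z ⊗ₜ 1) = leftMul (algebraMap k A z) := by
  change centerMap k A _ = _
  simp [centerMap, leftMul_apply]

theorem algebraMap_center_right (z : k) :
    algebraMap (k ⊗[ℂ] k) (Env A) (1 ⊗ₜ z) = rightMul (algebraMap k A z) := by
  change centerMap k A _ = _
  simp [centerMap, rightMul_apply]

/-- The ideal of `k ⊗ k` generated by `I ^ m ⊗ k` and `k ⊗ I ^ m`. -/
def biIdeal (I : Ideal k) (m : ℕ) : Ideal (k ⊗[ℂ] k) :=
  I.map (Algebra.TensorProduct.includeLeft : k →ₐ[ℂ] k ⊗[ℂ] k) ^ m ⊔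
    I.map (Algebra.TensorProduct.includeRight : k →ₐ[ℂ] k ⊗[ℂ] k) ^ m

theorem biIdeal_antitone (I : Ideal k) : Antitone (biIdeal I) := fun _ _ h =>
  sup_le_sup (Ideal.pow_le_pow_right h) (Ideal.pow_le_pow_right h)

variable (M : Type*) [AddCommGroup M] [Module (Env A) M] [Module (k ⊗[ℂ] k) M]
  [IsScalarTower (k ⊗[ℂ] k) (Env A) M]

/-- The steps of the filtration of a bimodule. -/
def biFil (I : Ideal k) (m : ℕ) : Submodule (k ⊗[ℂ] k) M := biIdeal I m • ⊤

theorem biFil_antitone (I : Ideal k) : Antitone (biFil M I) := fun _ _ h =>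
  Submodule.smul_mono_left (biIdeal_antitone I h)

variable {M}

theorem left_smul_mem_biFil {I : Ideal k} {m : ℕ} {z : k} (hz : z ∈ I ^ m) (x : M) :
    leftMul (algebraMap k A z) • x ∈ biFil M I m := by
  rw [← algebraMap_center_left, algebraMap_smul]
  refine Submodule.smul_mem_smul (Ideal.mem_sup_left ?_) trivial
  rw [← Ideal.map_pow]
  exact Ideal.mem_map_of_mem (Algebra.TensorProduct.includeLeft : k →ₐ[ℂ] k ⊗[ℂ] k) hz

theorem right_smul_mem_biFil {I : Ideal k} {m : ℕ} {z : k} (hz : z ∈ I ^ m) (x : M) :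
    rightMul (algebraMap k A z) • x ∈ biFil M I m := by
  rw [← algebraMap_center_right, algebraMap_smul]
  refine Submodule.smul_mem_smul (Ideal.mem_sup_right ?_) trivial
  rw [← Ideal.map_pow]
  exact Ideal.mem_map_of_mem (Algebra.TensorProduct.includeRight : k →ₐ[ℂ] k ⊗[ℂ] k) hz

/-- Arbitrary multiples of the generators of the ideal are absorbed into `x`, so closure under
addition is the only structural condition on `P`. -/
theorem biFil_induction {I : Ideal k} {m : ℕ} {P : M → Prop}
    (hl : ∀ z ∈ I ^ m, ∀ x, P (leftMul (algebraMap k A z) • x))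
    (hr : ∀ z ∈ I ^ m, ∀ x, P (rightMul (algebraMap k A z) • x))
    (hadd : ∀ x y, P x → P y → P (x + y)) {x : M} (hx : x ∈ biFil M I m) : P x := by
  have h0 : P 0 := by simpa using hl 0 (zero_mem _) 0
  refine Submodule.smul_induction_on hx (fun s hs y _ => ?_) hadd
  obtain ⟨a, ha, b, hb, rfl⟩ := Submodule.mem_sup.1 hs
  rw [← Ideal.map_pow] at ha hb
  rw [add_smul]
  apply hadd
  · refine Submodule.span_induction (p := fun a _ => ∀ y, P (a • y)) ?_ ?_ ?_ ?_ ha y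
    · rintro _ ⟨z, hz, rfl⟩ y
      have := hl z hz y
      rwa [← algebraMap_center_left, algebraMap_smul] at this
    · intro y; rwa [zero_smul]
    · intro a b _ _ ha hb y
      rw [add_smul]; exact hadd _ _ (ha y) (hb y)
    · intro c a _ ha y
      rw [smul_eq_mul, mul_comm, mul_smul]; exact ha _
  · refine Submodule.span_induction (p := fun a _ => ∀ y, P (a • y)) ?_ ?_ ?_ ?_ hb y
    · rintro _ ⟨z, hz, rfl⟩ y
      have := hr z hz y
      rwa [← algebraMap_center_right, algebraMap_smul] at this
    · intro y; rwa [zero_smul]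
    · intro a b _ _ ha hb y
      rw [add_smul]; exact hadd _ _ (ha y) (hb y)
    · intro c a _ ha y
      rw [smul_eq_mul, mul_comm, mul_smul]; exact ha _

theorem env_smul_mem_biFil {I : Ideal k} {m : ℕ} (e : Env A) {x : M} (hx : x ∈ biFil M I m) :
    e • x ∈ biFil M I m := by
  refine biFil_induction (A := A) (P := fun x => e • x ∈ biFil M I m) ?_ ?_ ?_ hx
  · intro z hz x
    rw [← mul_smul, ← algebraMap_center_left, ← Algebra.commutes, mul_smul,
      algebraMap_center_left]
    exact left_smul_mem_biFil hz _
  · intro z hz x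
    rw [← mul_smul, ← algebraMap_center_right, ← Algebra.commutes, mul_smul,
      algebraMap_center_right]
    exact right_smul_mem_biFil hz _
  · intro x y hx hy
    rw [smul_add]; exact add_mem hx hy

theorem leftMul_smul_mem_biFil {I : Ideal k} {m : ℕ} {a : A} (ha : a ∈ (I ^ m • ⊤ : Submodule k A))
    (x : M) : leftMul a • x ∈ biFil M I m := by
  refine Submodule.smul_induction_on ha (fun z hz b _ => ?_) fun a b ha hb => ?_
  · rw [Algebra.smul_def, map_mul, mul_smul]
    exact left_smul_mem_biFil hz _
  · rw [map_add, add_smul]; exact add_mem ha hb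

theorem rightMul_smul_mem_biFil {I : Ideal k} {m : ℕ} {a : A}
    (ha : a ∈ (I ^ m • ⊤ : Submodule k A)) (x : M) : rightMul a • x ∈ biFil M I m := by
  refine Submodule.smul_induction_on ha (fun z hz b _ => ?_) fun a b ha hb => ?_
  · rw [Algebra.smul_def, Algebra.commutes, rightMul_mul, mul_smul]
    exact right_smul_mem_biFil hz _
  · rw [map_add, add_smul]; exact add_mem ha hb

/-! ### Bimodule maps and the filtration; Artin–Rees -/

section Functoriality

variable {M' : Type*} [AddCommGroup M'] [Module (Env A) M'] [Module (k ⊗[ℂ] k) M']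
  [IsScalarTower (k ⊗[ℂ] k) (Env A) M']

theorem map_mem_biFil (φ : M →ₗ[Env A] M') {I : Ideal k} {m : ℕ} {x : M} (hx : x ∈ biFil M I m) :
    φ x ∈ biFil M' I m := by
  refine biFil_induction (A := A) (P := fun x => φ x ∈ biFil M' I m) ?_ ?_ ?_ hx
  · intro z hz x
    rw [map_smul]; exact left_smul_mem_biFil hz _
  · intro z hz x
    rw [map_smul]; exact right_smul_mem_biFil hz _
  · intro x y hx hy
    rw [map_add]; exact add_mem hx hy

theorem exists_mem_biFil (φ : M →ₗ[Env A] M') (hφ : Function.Surjective φ) {I : Ideal k} {m : ℕ}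
    {y : M'} (hy : y ∈ biFil M' I m) : ∃ x ∈ biFil M I m, φ x = y := by
  refine biFil_induction (A := A) (P := fun y => ∃ x ∈ biFil M I m, φ x = y) ?_ ?_ ?_ hy
  · intro z hz y
    obtain ⟨x, rfl⟩ := hφ y
    exact ⟨_, left_smul_mem_biFil hz x, map_smul _ _ _⟩
  · intro z hz y
    obtain ⟨x, rfl⟩ := hφ y
    exact ⟨_, right_smul_mem_biFil hz x, map_smul _ _ _⟩
  · rintro _ _ ⟨x, hx, rfl⟩ ⟨y, hy, rfl⟩
    exact ⟨x + y, add_mem hx hy, map_add _ _ _⟩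

/-- The Artin–Rees lemma for bimodules. -/
theorem exists_biFil_le [IsNoetherianRing (k ⊗[ℂ] k)] [Module.Finite (k ⊗[ℂ] k) M']
    (φ : M →ₗ[Env A] M') (hφ : Function.Injective φ) (I : Ideal k) (m : ℕ) :
    ∃ n, m ≤ n ∧ ∀ x : M, φ x ∈ biFil M' I n → x ∈ biFil M I m := by
  set a := I.map (Algebra.TensorProduct.includeLeft : k →ₐ[ℂ] k ⊗[ℂ] k) with ha
  set b := I.map (Algebra.TensorProduct.includeRight : k →ₐ[ℂ] k ⊗[ℂ] k) with hb
  let ψ : M →ₗ[k ⊗[ℂ] k] M' := φ.restrictScalars (k ⊗[ℂ] k)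
  obtain ⟨c, hc⟩ := Ideal.exists_pow_inf_eq_pow_smul (a ⊔ b) (LinearMap.range ψ)
  -- Here `c` is the Artin–Rees constant for `a ⊔ b`, and `m + m` is needed for the inclusion `(a ⊔
  -- b)^(m+m) ≤ a^m ⊔ b^m`.
  refine ⟨m + m + c, by omega, fun x hx => ?_⟩
  have h1 : biIdeal I (m + m + c) ≤ (a ⊔ b) ^ (m + m + c) :=
    sup_le (Ideal.pow_right_mono le_sup_left _) (Ideal.pow_right_mono le_sup_right _)
  have h2 : ψ x ∈ (a ⊔ b) ^ (m + m + c) • (⊤ : Submodule (k ⊗[ℂ] k) M') ⊓ LinearMap.range ψ :=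
    ⟨Submodule.smul_mono_left h1 hx, x, rfl⟩
  rw [hc _ (by omega), Nat.add_sub_cancel] at h2
  have h3 : ψ x ∈ biIdeal I m • LinearMap.range ψ :=
    Submodule.smul_mono Ideal.sup_pow_add_le_pow_sup_pow inf_le_right h2
  rw [LinearMap.range_eq_map, ← Submodule.map_smul''] at h3
  obtain ⟨y, hy, hyx⟩ := h3
  rwa [← hφ hyx]

end Functoriality

end Filtration

/-! ### The filtered Hochschild complex and its completion -/

section ChainFiltration

variable {k A : Type*} [CommRing k] [Algebra ℂ k] [Ring A] [Algebra ℂ A] [Algebra k A]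
  [IsScalarTower ℂ k A]

theorem mul_mem_smul_top_left {J : Ideal k} {a : A} (ha : a ∈ (J • ⊤ : Submodule k A)) (b : A) :
    a * b ∈ (J • ⊤ : Submodule k A) := by
  refine Submodule.smul_induction_on ha (fun z hz c _ => ?_) fun x y hx hy => ?_
  · rw [smul_mul_assoc]; exact Submodule.smul_mem_smul hz trivial
  · rw [add_mul]; exact add_mem hx hy

theorem mul_mem_smul_top_right {J : Ideal k} {a : A} (ha : a ∈ (J • ⊤ : Submodule k A)) (b : A) :
    b * a ∈ (J • ⊤ : Submodule k A) := by
  refine Submodule.smul_induction_on ha (fun z hz c _ => ?_) fun x y hx hy => ?_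
  · rw [mul_smul_comm]; exact Submodule.smul_mem_smul hz trivial
  · rw [mul_add]; exact add_mem hx hy

variable (A) (M : Type*) [AddCommGroup M] [Module ℂ M] [Module (Env A) M]
  [IsScalarTower ℂ (Env A) M] [Module k M] [IsScalarTower k (Env A) M] [IsScalarTower ℂ k M]
  [Module (k ⊗[ℂ] k) M] [IsScalarTower (k ⊗[ℂ] k) (Env A) M]

/-- The filtration of the Hochschild complex with coefficients in a bimodule. -/
def chainFil (I : Ideal k) (q : ℕ) : AdicFil I (CoChain A M q) where
  step m := Submodule.span k {t | ∃ (x : M) (a : Fin q → A), t = cTensor x a ∧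
    (x ∈ biFil M I m ∨ ∃ i, a i ∈ (I ^ m • ⊤ : Submodule k A))}
  anti m n h := by
    refine Submodule.span_mono ?_
    rintro t ⟨x, a, rfl, hx | ⟨i, hi⟩⟩
    · exact ⟨x, a, rfl, .inl (biFil_antitone M I h hx)⟩
    · exact ⟨x, a, rfl, .inr ⟨i, Submodule.smul_mono_left (Ideal.pow_le_pow_right h) hi⟩⟩
  smul_mem m z hz t := by
    induction t using coChain_induction with
    | h0 => simp
    | htensor x a =>
      rw [← cTensor_rsmul_left, ← algebraMap_smul (Env A) z x]
      exact Submodule.subset_span ⟨_, a, rfl, .inl (left_smul_mem_biFil hz x)⟩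
    | hadd s t hs ht => rw [smul_add]; exact add_mem hs ht

variable {A M} {I : Ideal k} {m q : ℕ}

theorem cTensor_mem_chainFil_left {x : M} (hx : x ∈ biFil M I m) (a : Fin q → A) :
    cTensor x a ∈ (chainFil A M I q).step m :=
  Submodule.subset_span ⟨x, a, rfl, .inl hx⟩

theorem cTensor_mem_chainFil_right (x : M) {a : Fin q → A} {i : Fin q}
    (hi : a i ∈ (I ^ m • ⊤ : Submodule k A)) : cTensor x a ∈ (chainFil A M I q).step m :=
  Submodule.subset_span ⟨x, a, rfl, .inr ⟨i, hi⟩⟩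

/-- The `k`-multiples occurring in the span are absorbed into the head, so `P` has to be checked on
pure tensors and sums only. -/
theorem chainFil_induction {P : CoChain A M q → Prop} (h0 : P 0)
    (hl : ∀ x ∈ biFil M I m, ∀ a : Fin q → A, P (cTensor x a))
    (hr : ∀ (x : M) (a : Fin q → A) (i : Fin q), a i ∈ (I ^ m • ⊤ : Submodule k A) →
      P (cTensor x a))
    (hadd : ∀ s t, P s → P t → P (s + t)) {t : CoChain A M q}
    (ht : t ∈ (chainFil A M I q).step m) : P t := by
  rw [← one_smul k t]
  refine Submodule.span_induction (p := fun t _ => ∀ z : k, P (z • t)) ?_ ?_ ?_ ?_ ht 1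
  · rintro t ⟨x, a, rfl, hx | ⟨i, hi⟩⟩ z
    · rw [← cTensor_rsmul_left, ← algebraMap_smul (Env A) z x]
      exact hl _ (env_smul_mem_biFil _ hx) a
    · rw [← cTensor_rsmul_left]
      exact hr _ a i hi
  · intro z; rwa [smul_zero]
  · intro s t _ _ hs ht z
    rw [smul_add]; exact hadd _ _ (hs z) (ht z)
  · intro c t _ ht z
    rw [smul_smul]; exact ht _

theorem complex_smul_mem_chainFil {t : CoChain A M q} (c : ℂ)
    (ht : t ∈ (chainFil A M I q).step m) : c • t ∈ (chainFil A M I q).step m := by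
  rw [← algebraMap_smul k c]; exact Submodule.smul_mem _ _ ht

/-- An entry in `I ^ m A` either stays in the tail, possibly multiplied by a neighbour, or acts on
the head from the right or from the left. The last two cases explain why the filtration of `M`
contains both `I ^ m M` and `M I ^ m`. -/
theorem cBoundary_mem_chainFil (m : ℕ) (t : CoChain A M (q + 1))
    (ht : t ∈ (chainFil A M I (q + 1)).step m) :
    cBoundary k q t ∈ (chainFil A M I q).step m := by
  refine chainFil_induction (P := fun t => cBoundary k q t ∈ (chainFil A M I q).step m)
    (by simp) ?_ ?_ ?_ ht
  · intro x hx a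
    rw [cBoundary_cTensor]
    refine sum_mem fun j _ => complex_smul_mem_chainFil _ (cTensor_mem_chainFil_left ?_ _)
    rw [cHead]
    split_ifs
    · exact env_smul_mem_biFil _ hx
    · exact env_smul_mem_biFil _ hx
    · exact hx
  · intro x a i hi
    rw [cBoundary_cTensor]
    refine sum_mem fun j _ => complex_smul_mem_chainFil _ ?_
    have hj := j.isLt
    have hil := i.isLt
    by_cases h0 : (j : ℕ) = 0 ∧ (i : ℕ) = 0
    · obtain rfl : i = 0 := Fin.ext h0.2
      refine cTensor_mem_chainFil_left ?_ _
      rw [cHead, if_pos h0.1]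
      exact rightMul_smul_mem_biFil hi x
    by_cases h1 : (j : ℕ) = q + 1 ∧ (i : ℕ) = q
    · obtain rfl : i = Fin.last q := Fin.ext h1.2
      refine cTensor_mem_chainFil_left ?_ _
      rw [cHead, if_neg (by omega), if_pos h1.1]
      exact leftMul_smul_mem_biFil hi x
    -- Faces with `j > i` keep the entry at index `i`; the others move it to index `i - 1`.
    by_cases hij : (i : ℕ) < j
    · refine cTensor_mem_chainFil_right _ (i := ⟨i, by omega⟩) ?_
      have hi' : a (Fin.castSucc ⟨i, by omega⟩) ∈ (I ^ m • ⊤ : Submodule k A) := hi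
      simp only [faceTail]
      split_ifs
      · exact hi'
      · exact mul_mem_smul_top_left hi' _
      · omega
    · refine cTensor_mem_chainFil_right _ (i := ⟨i - 1, by omega⟩) ?_
      have hi' : a (Fin.succ ⟨i - 1, by omega⟩) ∈ (I ^ m • ⊤ : Submodule k A) := by
        convert hi using 2; ext; simp; omega
      simp only [faceTail]
      split_ifs
      · omega
      · exact mul_mem_smul_top_right hi' _
      · exact hi'
  · intro s t hs ht
    rw [map_add]; exact add_mem hs ht

variable {M' : Type*} [AddCommGroup M'] [Module ℂ M'] [Module (Env A) M']
  [IsScalarTower ℂ (Env A) M'] [Module k M'] [IsScalarTower k (Env A) M'] [IsScalarTower ℂ k M']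
  [Module (k ⊗[ℂ] k) M'] [IsScalarTower (k ⊗[ℂ] k) (Env A) M']

theorem cMap_mem_chainFil (φ : M →ₗ[Env A] M') (m : ℕ) (t : CoChain A M q)
    (ht : t ∈ (chainFil A M I q).step m) : cMap k φ q t ∈ (chainFil A M' I q).step m := by
  refine chainFil_induction (P := fun t => cMap k φ q t ∈ (chainFil A M' I q).step m)
    (by simp) ?_ ?_ ?_ ht
  · intro x hx a
    rw [cMap_cTensor]; exact cTensor_mem_chainFil_left (map_mem_biFil φ hx) a
  · intro x a i hi
    rw [cMap_cTensor]; exact cTensor_mem_chainFil_right _ hi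
  · intro s t hs ht
    rw [map_add]; exact add_mem hs ht

theorem exists_mem_chainFil (φ : M →ₗ[Env A] M') (hφ : Function.Surjective φ) (m : ℕ)
    (t : CoChain A M' q) (ht : t ∈ (chainFil A M' I q).step m) :
    ∃ s ∈ (chainFil A M I q).step m, cMap k φ q s = t := by
  refine chainFil_induction (P := fun t => ∃ s ∈ (chainFil A M I q).step m, cMap k φ q s = t)
    ⟨0, zero_mem _, map_zero _⟩ ?_ ?_ ?_ ht
  · intro y hy a
    obtain ⟨x, hx, rfl⟩ := exists_mem_biFil φ hφ hy
    exact ⟨_, cTensor_mem_chainFil_left hx a, cMap_cTensor k φ x a⟩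
  · intro y a i hi
    obtain ⟨x, rfl⟩ := hφ y
    exact ⟨_, cTensor_mem_chainFil_right x hi, cMap_cTensor k φ x a⟩
  · rintro _ _ ⟨s, hs, rfl⟩ ⟨t, ht, rfl⟩
    exact ⟨s + t, add_mem hs ht, map_add _ _ _⟩

/-- A `ℂ`-linear retraction of `φ` adapted to step `n` of `M'` induces a retraction on chains. It
sends step `n` into step `m`: heads by Artin–Rees for bimodules, and tail entries because `m ≤ n`.
-/
theorem exists_chainFil_le [IsNoetherianRing (k ⊗[ℂ] k)] [Module.Finite (k ⊗[ℂ] k) M']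
    (φ : M →ₗ[Env A] M') (hφ : Function.Injective φ) (I : Ideal k) (q m : ℕ) :
    ∃ n, m ≤ n ∧ ∀ t : CoChain A M q, cMap k φ q t ∈ (chainFil A M' I q).step n →
      t ∈ (chainFil A M I q).step m := by
  obtain ⟨n, hmn, hn⟩ := exists_biFil_le φ hφ I m
  let P : Submodule ℂ M' :=
    { carrier := biFil M' I n
      add_mem' := add_mem
      zero_mem' := zero_mem _
      smul_mem' := fun c x hx => by
        rw [← algebraMap_smul (Env A) c x]; exact env_smul_mem_biFil _ hx }
  obtain ⟨ρ, hρ, hρ'⟩ := exists_retraction (φ.restrictScalars ℂ) hφ P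
  let r : CoChain A M' q →ₗ[ℂ] CoChain A M q :=
    LinearMap.rTensor (PiTensorProduct ℂ (fun _ : Fin q => Bar A)) ρ
  have hr (x : M') (a : Fin q → A) : r (cTensor x a) = cTensor (ρ x) a := rfl
  have hrl (t : CoChain A M q) : r (cMap k φ q t) = t := by
    induction t using coChain_induction with
    | h0 => simp
    | htensor x a =>
      rw [cMap_cTensor, hr]
      congr 1
      exact hρ x
    | hadd s t hs ht => rw [map_add, map_add, hs, ht]
  refine ⟨n, hmn, fun t ht => ?_⟩
  rw [← hrl t]
  refine chainFil_induction (P := fun t => r t ∈ (chainFil A M I q).step m)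
    (by simp) ?_ ?_ ?_ ht
  · intro x hx a
    rw [hr]
    exact cTensor_mem_chainFil_left (hn _ (hρ' x hx)) a
  · intro x a i hi
    rw [hr]
    exact cTensor_mem_chainFil_right _
      (Submodule.smul_mono_left (Ideal.pow_le_pow_right hmn) hi)
  · intro s t hs ht
    rw [map_add]; exact add_mem hs ht

variable (A M I) in
/-- The boundary of the completed Hochschild complex with coefficients in a bimodule. -/
def complCBoundary (q : ℕ) :
    (chainFil A M I (q + 1)).Compl →ₗ[AdicCompletion I k] (chainFil A M I q).Compl :=
  AdicFil.map _ _ (cBoundary k q) cBoundary_mem_chainFil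

/-- The morphism of completed complexes induced by a homomorphism of bimodules. -/
def complCMap (I : Ideal k) (φ : M →ₗ[Env A] M') (q : ℕ) :
    (chainFil A M I q).Compl →ₗ[AdicCompletion I k] (chainFil A M' I q).Compl :=
  AdicFil.map _ _ (cMap k φ q) (cMap_mem_chainFil φ)

theorem complCBoundary_complCMap (φ : M →ₗ[Env A] M') (q : ℕ)
    (t : (chainFil A M I (q + 1)).Compl) :
    complCBoundary A M' I q (complCMap I φ (q + 1) t) =
      complCMap I φ q (complCBoundary A M I q t) := by
  rw [complCBoundary, complCMap, complCMap, complCBoundary, AdicFil.map_map, AdicFil.map_map]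
  exact AdicFil.map_congr _ _ (LinearMap.ext fun x => cBoundary_cMap k φ q x) t

/-- The filtration of the quotient is the image filtration, and Artin–Rees makes the induced
filtration of the sub-bimodule cofinal with its own. These are the two inputs for exactness of
completion. -/
theorem complCMap_shortExact {M'' : Type*} [AddCommGroup M''] [Module ℂ M''] [Module (Env A) M'']
    [IsScalarTower ℂ (Env A) M''] [Module k M''] [IsScalarTower k (Env A) M'']
    [IsScalarTower ℂ k M''] [Module (k ⊗[ℂ] k) M''] [IsScalarTower (k ⊗[ℂ] k) (Env A) M'']
    [IsNoetherianRing (k ⊗[ℂ] k)] [Module.Finite (k ⊗[ℂ] k) M']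
    (I : Ideal k) (φ : M →ₗ[Env A] M') (ψ : M' →ₗ[Env A] M'')
    (hφ : Function.Injective φ) (hex : Function.Exact φ ψ) (hψ : Function.Surjective ψ) :
    ShortExactSeq (N := fun q => (chainFil A M I q).Compl)
      (L := fun q => (chainFil A M' I q).Compl) (M := fun q => (chainFil A M'' I q).Compl)
      (complCBoundary A _ I) (complCBoundary A _ I) (complCBoundary A _ I)
      (complCMap I φ) (complCMap I ψ) where
  sq_zero q t := by
    rw [complCBoundary, complCBoundary, AdicFil.map_map,
      AdicFil.map_congr _ (f' := 0) (by simp) (LinearMap.ext fun x => cBoundary_cBoundary k q x)]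
    exact AdicFil.map_zero_apply _ t
  comm_i := complCBoundary_complCMap φ
  comm_p := complCBoundary_complCMap ψ
  inj q := AdicFil.map_injective _ (exists_chainFil_le φ hφ I q)
  exact q := AdicFil.map_exact _ _ (exists_chainFil_le φ hφ I q) (exists_mem_chainFil ψ hψ)
    ((cMap_shortExact k φ ψ hφ hex hψ).exact q)
  surj q := AdicFil.map_surjective _ (exists_mem_chainFil ψ hψ)
    ((cMap_shortExact k φ ψ hφ hex hψ).surj q)

end ChainFiltration

/-! ### Complexes that are finite sums of copies of a complex -/

section Sum

variable {R : Type*} [CommRing R] {ι : Type*} [Fintype ι]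
  {D E : ℕ → Type*} [∀ q, AddCommGroup (D q)] [∀ q, Module R (D q)]
  [∀ q, AddCommGroup (E q)] [∀ q, Module R (E q)]
  {d : ∀ q, D (q + 1) →ₗ[R] D q} {e : ∀ q, E (q + 1) →ₗ[R] E q}
  {P : ι → ∀ q, D q →ₗ[R] E q} {J : ι → ∀ q, E q →ₗ[R] D q}

/-- The single identity `∑ J_i P_i = 1` makes `D` a retract of a finite direct sum of copies of `E`;
this half of the biproduct relations suffices for each property transferred below. -/
theorem exact_of_sum (hP : ∀ i q x, e q (P i (q + 1) x) = P i q (d q x))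
    (hJ : ∀ i q x, d q (J i (q + 1) x) = J i q (e q x)) (hPJ : ∀ q x, ∑ i, J i q (P i q x) = x)
    {q : ℕ} (h : cycles e q ≤ LinearMap.range (e q)) : cycles d q ≤ LinearMap.range (d q) := by
  intro x hx
  choose v hv using fun i => h (map_mem_cycles (hP i) q x hx)
  refine ⟨∑ i, J i (q + 1) (v i), ?_⟩
  rw [map_sum, ← hPJ q x]
  exact Finset.sum_congr rfl fun i _ => by rw [hJ, hv]

theorem exists_fg_of_sum (hP : ∀ i q x, e q (P i (q + 1) x) = P i q (d q x))
    (hJ : ∀ i q x, d q (J i (q + 1) x) = J i q (e q x)) (hPJ : ∀ q x, ∑ i, J i q (P i q x) = x)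
    {q : ℕ} (h : ∃ T : Submodule R (E q), T.FG ∧ cycles e q ≤ T ⊔ LinearMap.range (e q)) :
    ∃ T : Submodule R (D q), T.FG ∧ cycles d q ≤ T ⊔ LinearMap.range (d q) := by
  obtain ⟨T, hT, hle⟩ := h
  refine ⟨⨆ i, T.map (J i q), Submodule.fg_iSup _ fun i => hT.map _, fun x hx => ?_⟩
  rw [← hPJ q x]
  refine sum_mem fun i _ => ?_
  obtain ⟨t, ht, _, ⟨w, rfl⟩, htw⟩ := Submodule.mem_sup.1 (hle (map_mem_cycles (hP i) q x hx))
  rw [← htw, map_add, ← hJ]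
  exact add_mem
    (Submodule.mem_sup_left (Submodule.mem_iSup_of_mem i (Submodule.mem_map_of_mem ht)))
    (Submodule.mem_sup_right ⟨_, rfl⟩)

variable {D' E' : ℕ → Type*} [∀ q, AddCommGroup (D' q)] [∀ q, Module R (D' q)]
  [∀ q, AddCommGroup (E' q)] [∀ q, Module R (E' q)]
  {d' : ∀ q, D' (q + 1) →ₗ[R] D' q} {e' : ∀ q, E' (q + 1) →ₗ[R] E' q}
  {P' : ι → ∀ q, D' q →ₗ[R] E' q} {J' : ι → ∀ q, E' q →ₗ[R] D' q}
  {f : ∀ q, D q →ₗ[R] D' q} {f' : ∀ q, E q →ₗ[R] E' q}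

theorem homologyInj_of_sum (hP : ∀ i q x, e q (P i (q + 1) x) = P i q (d q x))
    (hJ : ∀ i q x, d q (J i (q + 1) x) = J i q (e q x)) (hPJ : ∀ q x, ∑ i, J i q (P i q x) = x)
    (hP' : ∀ i q x, e' q (P' i (q + 1) x) = P' i q (d' q x))
    (hf : ∀ i q x, f' q (P i q x) = P' i q (f q x)) {q : ℕ} (h : HomologyInj e e' f' q) :
    HomologyInj d d' f q := by
  rintro x hx ⟨w, hw⟩
  choose v hv using fun i => h _ (map_mem_cycles (hP i) q x hx) ⟨P' i (q + 1) w, by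
    rw [hP', hw, hf]⟩
  refine ⟨∑ i, J i (q + 1) (v i), ?_⟩
  rw [map_sum, ← hPJ q x]
  exact Finset.sum_congr rfl fun i _ => by rw [hJ, hv]

theorem homologySurj_of_sum (hJ : ∀ i q x, d q (J i (q + 1) x) = J i q (e q x))
    (hP' : ∀ i q x, e' q (P' i (q + 1) x) = P' i q (d' q x))
    (hJ' : ∀ i q x, d' q (J' i (q + 1) x) = J' i q (e' q x))
    (hPJ' : ∀ q x, ∑ i, J' i q (P' i q x) = x)
    (hf : ∀ i q x, f q (J i q x) = J' i q (f' q x)) {q : ℕ} (h : HomologySurj e e' f' q) :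
    HomologySurj d d' f q := by
  intro y hy
  choose x hx w hw using fun i => h _ (map_mem_cycles (hP' i) q y hy)
  refine ⟨∑ i, J i q (x i), sum_mem fun i _ => map_mem_cycles (hJ i) q _ (hx i),
    ∑ i, J' i (q + 1) (w i), ?_⟩
  rw [map_sum, map_sum, ← Finset.sum_add_distrib, ← hPJ' q y]
  exact Finset.sum_congr rfl fun i _ => by rw [hw, map_add, hf, hJ']

end Sum

/-! ### The enveloping algebra as a bimodule -/

section Free

variable {k A : Type*} [CommRing k] [Algebra ℂ k] [Ring A] [Algebra ℂ A] [Algebra k A]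
  [IsScalarTower ℂ k A]

/-- `v ↦ (v₁ ⊗ ⋯ ⊗ v_q ↦ v ⊗ v₁ ⊗ ⋯ ⊗ v_q)`. -/
def tensorCons (V : Type*) [AddCommGroup V] [Module ℂ V] (q : ℕ) :
    V →ₗ[ℂ] PiTensorProduct ℂ (fun _ : Fin q => V) →ₗ[ℂ]
      PiTensorProduct ℂ (fun _ : Fin (q + 1) => V) :=
  PiTensorProduct.lift.toLinearMap ∘ₗ
    (PiTensorProduct.tprod ℂ : MultilinearMap ℂ (fun _ : Fin (q + 1) => V) _).curryLeft

theorem tensorCons_tprod (V : Type*) [AddCommGroup V] [Module ℂ V] (q : ℕ) (v : V)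
    (w : Fin q → V) : tensorCons V q v (PiTensorProduct.tprod ℂ w) =
      PiTensorProduct.tprod ℂ (Fin.cons v w : Fin (q + 1) → V) := by
  simp [tensorCons]

variable (k A) in
/-- The contraction `(l ⊗ b) ⊗ a₁ ⊗ ⋯ ⊗ a_q ↦ (l ⊗ 1) ⊗ b ⊗ a₁ ⊗ ⋯ ⊗ a_q`. -/
def contraction (q : ℕ) : CoChain A (Env A) q →ₗ[k] CoChain A (Env A) (q + 1) :=
  TensorProduct.AlgebraTensorModule.lift <| TensorProduct.AlgebraTensorModule.lift
    { toFun := fun l => (tensorCons (Bar A) q ∘ₗ (Submodule.span ℂ {(1 : A)}).mkQ ∘ₗ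
        (MulOpposite.opLinearEquiv ℂ).symm.toLinearMap).compr₂
          (TensorProduct.mk ℂ (Env A) (PiTensorProduct ℂ (fun _ : Fin (q + 1) => Bar A))
            (leftMul l))
      map_add' := fun l l' => by
        ext b t
        simp
      map_smul' := fun z l => by
        ext b t
        simp [leftMul_apply, TensorProduct.smul_tmul'] }

theorem contraction_cTensor (q : ℕ) (l b : A) (a : Fin q → A) :
    contraction k A q (cTensor (l ⊗ₜ MulOpposite.op b) a) =
      cTensor (leftMul l) (Fin.cons b a : Fin (q + 1) → A) := by
  have h : (fun i => (Submodule.span ℂ {(1 : A)}).mkQ ((Fin.cons b a : Fin (q + 1) → A) i)) =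
      (Fin.cons ((Submodule.span ℂ {(1 : A)}).mkQ b)
        fun i => (Submodule.span ℂ {(1 : A)}).mkQ (a i) : Fin (q + 1) → Bar A) := by
    funext i
    refine Fin.cases ?_ (fun i => ?_) i <;> simp
  rw [cTensor, cTensor, h, ← tensorCons_tprod]
  rfl

theorem faceTail_zero_cons (q : ℕ) (b : A) (a : Fin q → A) :
    faceTail 0 (Fin.cons b a : Fin (q + 1) → A) = a := by
  funext i
  simp [faceTail]

theorem faceTail_one_cons (q : ℕ) (b : A) (a : Fin (q + 1) → A) :
    faceTail 1 (Fin.cons b a : Fin (q + 2) → A) = Fin.cons (b * a 0) (faceTail 0 a) := by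
  funext i
  refine Fin.cases ?_ (fun i => ?_) i <;> simp [faceTail]

theorem faceTail_succ_cons (q j : ℕ) (hj : 0 < j) (b : A) (a : Fin (q + 1) → A) :
    faceTail (j + 1) (Fin.cons b a : Fin (q + 2) → A) = Fin.cons b (faceTail j a) := by
  funext i
  refine Fin.cases ?_ (fun i => ?_) i
  · simp [faceTail, hj]
  · simp [faceTail]

/-- The contraction shifts face indices by one: face `j + 1` of a contracted chain is the
contraction of its face `j`. For `j = 0` this holds because multiplying `b` by `a₁` in the head
becomes multiplication in the tail. -/
theorem cTensor_face_cons (q j : ℕ) (hj : j ≤ q + 1) (l b : A) (a : Fin (q + 1) → A) :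
    cTensor (cHead (j + 1) (leftMul l) (Fin.cons b a : Fin (q + 2) → A))
        (faceTail (j + 1) (Fin.cons b a : Fin (q + 2) → A)) =
      contraction k A q (cTensor (cHead j (l ⊗ₜ[ℂ] MulOpposite.op b : Env A) a)
        (faceTail j a)) := by
  obtain rfl | hj0 := Nat.eq_zero_or_pos j
  · rw [show (cHead 0 (l ⊗ₜ[ℂ] MulOpposite.op b : Env A) a) =
        l ⊗ₜ[ℂ] MulOpposite.op (b * a 0) by simp [cHead, rightMul_apply],
      contraction_cTensor, ← faceTail_one_cons]
    simp [cHead]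
  · rw [faceTail_succ_cons q j hj0]
    obtain rfl | hj1 := hj.eq_or_lt
    · rw [show (cHead (q + 1) (l ⊗ₜ[ℂ] MulOpposite.op b : Env A) a) =
        (a (Fin.last q) * l) ⊗ₜ[ℂ] MulOpposite.op b by simp [cHead, leftMul_apply],
        contraction_cTensor]
      congr 1
      simp [cHead, Fin.cons_last]
    · rw [show (cHead j (l ⊗ₜ[ℂ] MulOpposite.op b : Env A) a) = l ⊗ₜ[ℂ] MulOpposite.op b by
        simp [cHead, hj0.ne', hj1.ne], contraction_cTensor]
      simp [cHead, hj1.ne]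

theorem env_chain_hom_ext {W : Type*} [AddCommMonoid W] [Module k W] {q : ℕ}
    {f₁ f₂ : CoChain A (Env A) q →ₗ[k] W}
    (h : ∀ (l b : A) (a : Fin q → A), f₁ (cTensor (l ⊗ₜ[ℂ] MulOpposite.op b) a) =
      f₂ (cTensor (l ⊗ₜ[ℂ] MulOpposite.op b) a)) : f₁ = f₂ := by
  refine coChain_hom_ext fun x a => ?_
  induction x using TensorProduct.induction_on with
  | zero => simp [cTensor]
  | tmul l b => exact h l b.unop a
  | add x y hx hy => rw [cTensor_add_left, map_add, map_add, hx, hy]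

/-- Face `0` undoes the contraction, as `(l ⊗ 1) · b = l ⊗ b`. The remaining faces cancel in pairs
by the shift of indices. -/
theorem cBoundary_contraction (q : ℕ) (t : CoChain A (Env A) (q + 1)) :
    cBoundary k (q + 1) (contraction k A (q + 1) t) + contraction k A q (cBoundary k q t) = t := by
  have : cBoundary (A := A) (M := Env A) k (q + 1) ∘ₗ contraction k A (q + 1) +
      contraction k A q ∘ₗ cBoundary k q =
      LinearMap.id := by
    refine env_chain_hom_ext fun l b a => ?_
    have hs (c : ℂ) (x : CoChain A (Env A) q) :
        contraction k A q (c • x) = c • contraction k A q x := by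
      rw [← algebraMap_smul k c, map_smul, algebraMap_smul]
    simp only [LinearMap.add_apply, LinearMap.comp_apply, LinearMap.id_apply]
    rw [contraction_cTensor, cBoundary_cTensor, cBoundary_cTensor, Fin.sum_univ_succ, map_sum,
      add_assoc, ← Finset.sum_add_distrib, Finset.sum_eq_zero, add_zero]
    · rw [Fin.val_zero, faceTail_zero_cons]
      simp [cHead, rightMul_apply, leftMul_apply]
    · intro j _
      rw [Fin.val_succ, cTensor_face_cons (k := k) q j (by omega), hs, pow_succ, ← add_smul]
      simp
  exact LinearMap.congr_fun this t

variable (k A) in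
/-- `l ⊗ b ↦ b l`. -/
def envMul : Env A →ₗ[k] A :=
  TensorProduct.AlgebraTensorModule.lift
    { toFun := fun l => LinearMap.mulRight ℂ l ∘ₗ (MulOpposite.opLinearEquiv ℂ).symm.toLinearMap
      map_add' := fun l l' => by ext b; simp [mul_add]
      map_smul' := fun z l => by ext b; simp }

theorem envMul_tmul (l b : A) : envMul k A (l ⊗ₜ MulOpposite.op b) = b * l := rfl

variable (k A) in
/-- `l ⊗ b ↦ b l`, on chains of degree zero. -/
def augmentation : CoChain A (Env A) 0 →ₗ[k] A :=
  envMul k A ∘ₗ (TensorProduct.AlgebraTensorModule.rid ℂ k (Env A)).toLinearMap ∘ₗ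
    TensorProduct.AlgebraTensorModule.map LinearMap.id
      (PiTensorProduct.isEmptyEquiv (Fin 0)).toLinearMap

theorem augmentation_cTensor (x : Env A) (a : Fin 0 → A) :
    augmentation k A (cTensor x a) = envMul k A x := by
  simp [augmentation, cTensor]

variable (k A) in
/-- `l ↦ l ⊗ 1`, as a chain of degree zero. -/
def augSection : A →ₗ[k] CoChain A (Env A) 0 where
  toFun l := cTensor (leftMul l) Fin.elim0
  map_add' l l' := by rw [map_add, cTensor_add_left]
  map_smul' z l := by
    rw [RingHom.id_apply, ← cTensor_rsmul_left]
    rfl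

theorem augSection_apply (l : A) (a : Fin 0 → A) :
    augSection k A l = cTensor (leftMul l) a := by
  rw [Subsingleton.elim a Fin.elim0]; rfl

theorem augmentation_cBoundary (t : CoChain A (Env A) 1) :
    augmentation k A (cBoundary k 0 t) = 0 := by
  have : augmentation k A ∘ₗ cBoundary k 0 = 0 := by
    refine env_chain_hom_ext fun l b a => ?_
    have hs (c : ℂ) (x : CoChain A (Env A) 0) :
        augmentation k A (c • x) = c • augmentation k A x := by
      rw [← algebraMap_smul k c, map_smul, algebraMap_smul]
    rw [LinearMap.comp_apply, cBoundary_cTensor, map_sum, Fin.sum_univ_two]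
    simp [hs, augmentation_cTensor, cHead, rightMul_apply, leftMul_apply, envMul_tmul,
      ← MulOpposite.op_mul, mul_assoc, Fin.last]
  exact LinearMap.congr_fun this t

/-- In degree zero the last face does not cancel; it is `b l ⊗ 1`, the augmentation followed by its
section. Hence `H_0` with coefficients in `A^e` is `A`. -/
theorem cBoundary_contraction_zero (t : CoChain A (Env A) 0) :
    cBoundary k 0 (contraction k A 0 t) + augSection k A (augmentation k A t) = t := by
  have : cBoundary (A := A) (M := Env A) k 0 ∘ₗ contraction k A 0 +
      augSection k A ∘ₗ augmentation k A = LinearMap.id := by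
    refine env_chain_hom_ext fun l b a => ?_
    simp only [LinearMap.add_apply, LinearMap.comp_apply, LinearMap.id_apply]
    rw [contraction_cTensor, cBoundary_cTensor, Fin.sum_univ_two, augmentation_cTensor,
      envMul_tmul, augSection_apply _ a, Subsingleton.elim (faceTail _ _) a,
      Subsingleton.elim (faceTail _ _) a]
    have key (x y : CoChain A (Env A) 0) :
        (-1 : ℂ) ^ 0 • x + (-1 : ℂ) ^ 1 • y + y = x := by
      have h : (-1 : ℂ) ^ 1 • y + (1 : ℂ) • y = 0 := by
        rw [← add_smul, pow_one, neg_add_cancel, zero_smul]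
      rw [one_smul] at h
      rw [pow_zero, one_smul, add_assoc, h, add_zero]
    rw [leftMul_apply (b * l)]
    convert key _ _ using 3 <;> simp [cHead, rightMul_apply, leftMul_apply, Fin.last]
  exact LinearMap.congr_fun this t

variable {I : Ideal k}

/-- The left multiples by `I ^ m` stay in the head, while the right multiples are moved into the new
tail entry. The mixed form of the filtration is what makes the homotopy continuous, so that it
extends to the completion. -/
theorem contraction_mem_chainFil {q : ℕ} (m : ℕ) (t : CoChain A (Env A) q)
    (ht : t ∈ (chainFil A (Env A) I q).step m) :
    contraction k A q t ∈ (chainFil A (Env A) I (q + 1)).step m := by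
  refine chainFil_induction
    (P := fun t => contraction k A q t ∈ (chainFil A (Env A) I (q + 1)).step m) (by simp)
    ?_ ?_ ?_ ht
  · intro x hx a
    refine biFil_induction (A := A) (P := fun x => contraction k A q (cTensor x a) ∈
      (chainFil A (Env A) I (q + 1)).step m) ?_ ?_ ?_ hx
    · intro z hz x
      induction x using TensorProduct.induction_on with
      | zero => simp [cTensor]
      | tmul l b =>
        rw [show leftMul (algebraMap k A z) • (l ⊗ₜ[ℂ] b : Env A) =
          (algebraMap k A z * l) ⊗ₜ[ℂ] MulOpposite.op b.unop by simp [leftMul_apply],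
          contraction_cTensor, map_mul]
        exact cTensor_mem_chainFil_left
          (left_smul_mem_biFil (A := A) (M := Env A) hz (leftMul l)) _
      | add x y hx hy =>
        rw [smul_add, cTensor_add_left, map_add]; exact add_mem hx hy
    · intro z hz x
      induction x using TensorProduct.induction_on with
      | zero => simp [cTensor]
      | tmul l b =>
        rw [show rightMul (algebraMap k A z) • (l ⊗ₜ[ℂ] b : Env A) =
          l ⊗ₜ[ℂ] MulOpposite.op (z • b.unop) by
            rw [Algebra.smul_def, Algebra.commutes]; simp [rightMul_apply],
          contraction_cTensor]
        refine cTensor_mem_chainFil_right _ (i := 0) ?_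
        exact Submodule.smul_mem_smul hz trivial
      | add x y hx hy =>
        rw [smul_add, cTensor_add_left, map_add]; exact add_mem hx hy
    · intro x y hx hy
      rw [cTensor_add_left, map_add]; exact add_mem hx hy
  · intro x a i hi
    induction x using TensorProduct.induction_on with
    | zero => simp [cTensor]
    | tmul l b =>
      rw [← MulOpposite.op_unop b, contraction_cTensor]
      refine cTensor_mem_chainFil_right _ (i := i.succ) ?_
      rwa [Fin.cons_succ]
    | add x y hx hy =>
      rw [cTensor_add_left, map_add]; exact add_mem hx hy
  · intro s t hs ht
    rw [map_add]; exact add_mem hs ht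

theorem augmentation_mem (m : ℕ) (t : CoChain A (Env A) 0)
    (ht : t ∈ (chainFil A (Env A) I 0).step m) :
    augmentation k A t ∈ (AdicFil.adic A : AdicFil I A).step m := by
  refine chainFil_induction
    (P := fun t => augmentation k A t ∈ (AdicFil.adic A : AdicFil I A).step m) (by simp) ?_ ?_ ?_ ht
  · intro x hx a
    rw [augmentation_cTensor]
    refine biFil_induction (A := A)
      (P := fun x => envMul k A x ∈ (AdicFil.adic A : AdicFil I A).step m) ?_ ?_ ?_ hx
    · intro z hz x
      induction x using TensorProduct.induction_on with
      | zero => simp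
      | tmul l b =>
        rw [show leftMul (algebraMap k A z) • (l ⊗ₜ[ℂ] b : Env A) =
          (algebraMap k A z * l) ⊗ₜ[ℂ] MulOpposite.op b.unop by simp [leftMul_apply],
          envMul_tmul, ← Algebra.smul_def, mul_smul_comm]
        exact AdicFil.smul_mem _ m z hz _
      | add x y hx hy => rw [smul_add, map_add]; exact add_mem hx hy
    · intro z hz x
      induction x using TensorProduct.induction_on with
      | zero => simp
      | tmul l b =>
        rw [show rightMul (algebraMap k A z) • (l ⊗ₜ[ℂ] b : Env A) =
          l ⊗ₜ[ℂ] MulOpposite.op (z • b.unop) by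
            rw [Algebra.smul_def, Algebra.commutes]; simp [rightMul_apply],
          envMul_tmul, smul_mul_assoc]
        exact AdicFil.smul_mem _ m z hz _
      | add x y hx hy => rw [smul_add, map_add]; exact add_mem hx hy
    · intro x y hx hy
      rw [map_add]; exact add_mem hx hy
  · intro x a i _
    exact i.elim0
  · intro s t hs ht
    rw [map_add]; exact add_mem hs ht

theorem augSection_mem (m : ℕ) (l : A) (hl : l ∈ (AdicFil.adic A : AdicFil I A).step m) :
    augSection k A l ∈ (chainFil A (Env A) I 0).step m := by
  refine Submodule.smul_induction_on
    (p := fun l => augSection k A l ∈ (chainFil A (Env A) I 0).step m) hl ?_ ?_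
  · intro z hz l _
    rw [map_smul]; exact AdicFil.smul_mem _ m z hz _
  · intro x y hx hy
    rw [map_add]; exact add_mem hx hy

end Free

/-! ### Homology with coefficients in a finitely generated bimodule -/

section Comparison

variable {k A : Type*} [CommRing k] [Algebra ℂ k] [Ring A] [Algebra ℂ A] [Algebra k A]
  [IsScalarTower ℂ k A]

variable (k A) in
/-- The `q`-th homology is finitely generated: up to boundaries, all cycles lie in a finitely
generated module of chains. -/
def FiniteHomology (M : Type*) [AddCommGroup M] [Module ℂ M] [Module (Env A) M]
    [IsScalarTower ℂ (Env A) M] [Module k M] [IsScalarTower k (Env A) M] [IsScalarTower ℂ k M]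
    (q : ℕ) : Prop :=
  ∃ T : Submodule k (CoChain A M q), T.FG ∧
    cycles (C := CoChain A M) (cBoundary k) q ≤ T ⊔ LinearMap.range (cBoundary k q)

variable (A) (M : Type*) [AddCommGroup M] [Module ℂ M] [Module (Env A) M]
  [IsScalarTower ℂ (Env A) M] [Module k M] [IsScalarTower k (Env A) M] [IsScalarTower ℂ k M]
  [Module (k ⊗[ℂ] k) M] [IsScalarTower (k ⊗[ℂ] k) (Env A) M]

/-- The boundary of the base change of the Hochschild complex to the completion of `k`. -/
def bcBoundary (I : Ideal k) (q : ℕ) : AdicCompletion I k ⊗[k] CoChain A M (q + 1)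
    →ₗ[AdicCompletion I k] AdicCompletion I k ⊗[k] CoChain A M q :=
  (cBoundary k q).baseChange (AdicCompletion I k)

/-- The map from the base change of the Hochschild complex to its completion. -/
def comparison (I : Ideal k) (q : ℕ) : AdicCompletion I k ⊗[k] CoChain A M q
    →ₗ[AdicCompletion I k] (chainFil A M I q).Compl :=
  (chainFil A M I q).toCompletion.liftBaseChange (AdicCompletion I k)

/-- The comparison map is injective on homology in degree `q`. -/
def ComparisonInj (I : Ideal k) (q : ℕ) : Prop :=
  HomologyInj (D := fun q => AdicCompletion I k ⊗[k] CoChain A M q)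
    (D' := fun q => (chainFil A M I q).Compl) (bcBoundary A M I) (complCBoundary A M I)
    (comparison A M I) q

/-- The comparison map is surjective on homology in degree `q`. -/
def ComparisonSurj (I : Ideal k) (q : ℕ) : Prop :=
  HomologySurj (D := fun q => AdicCompletion I k ⊗[k] CoChain A M q)
    (D' := fun q => (chainFil A M I q).Compl) (bcBoundary A M I) (complCBoundary A M I)
    (comparison A M I) q

variable {A M}

theorem complCBoundary_comparison (I : Ideal k) (q : ℕ)
    (x : AdicCompletion I k ⊗[k] CoChain A M (q + 1)) :
    complCBoundary A M I q (comparison A M I (q + 1) x) =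
      comparison A M I q (bcBoundary A M I q x) :=
  AdicFil.map_liftBaseChange _ _ _ x

/-- The morphism of base changed complexes induced by a homomorphism of bimodules. -/
def bcMap {M' : Type*} [AddCommGroup M'] [Module ℂ M'] [Module (Env A) M']
    [IsScalarTower ℂ (Env A) M'] [Module k M'] [IsScalarTower k (Env A) M'] [IsScalarTower ℂ k M']
    (I : Ideal k) (φ : M →ₗ[Env A] M') (q : ℕ) : AdicCompletion I k ⊗[k] CoChain A M q
      →ₗ[AdicCompletion I k] AdicCompletion I k ⊗[k] CoChain A M' q :=
  (cMap k φ q).baseChange (AdicCompletion I k)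

variable {M' : Type*} [AddCommGroup M'] [Module ℂ M'] [Module (Env A) M']
  [IsScalarTower ℂ (Env A) M'] [Module k M'] [IsScalarTower k (Env A) M'] [IsScalarTower ℂ k M']
  [Module (k ⊗[ℂ] k) M'] [IsScalarTower (k ⊗[ℂ] k) (Env A) M']

theorem complCMap_comparison (I : Ideal k) (φ : M →ₗ[Env A] M') (q : ℕ)
    (x : AdicCompletion I k ⊗[k] CoChain A M q) :
    complCMap I φ q (comparison A M I q x) = comparison A M' I q (bcMap I φ q x) :=
  AdicFil.map_liftBaseChange _ _ _ x

theorem bcBoundary_bcMap (I : Ideal k) (φ : M →ₗ[Env A] M') (q : ℕ)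
    (x : AdicCompletion I k ⊗[k] CoChain A M (q + 1)) :
    bcBoundary A M' I q (bcMap I φ (q + 1) x) = bcMap I φ q (bcBoundary A M I q x) := by
  have : cBoundary k q ∘ₗ cMap k φ (q + 1) = cMap k φ q ∘ₗ cBoundary k q :=
    LinearMap.ext (cBoundary_cMap k φ q)
  simp only [bcBoundary, bcMap, ← LinearMap.comp_apply, ← LinearMap.baseChange_comp, this]

/-! ### Passage to retracts of finite sums of bimodules -/

section Sum

variable {ι : Type*} [Fintype ι] (π : ι → M →ₗ[Env A] M') (j : ι → M' →ₗ[Env A] M)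

theorem sum_cMap (h : ∀ x, ∑ i, j i (π i x) = x) (q : ℕ) (t : CoChain A M q) :
    ∑ i, cMap k (j i) q (cMap k (π i) q t) = t := by
  induction t using coChain_induction with
  | h0 => simp
  | htensor x a =>
    simp only [cMap_cTensor]
    conv_rhs => rw [← h x]
    simp only [cTensor, TensorProduct.sum_tmul]
  | hadd s t hs ht => simp only [map_add, Finset.sum_add_distrib, hs, ht]

theorem sum_complCMap (h : ∀ x, ∑ i, j i (π i x) = x) (I : Ideal k) (q : ℕ)
    (t : (chainFil A M I q).Compl) : ∑ i, complCMap I (j i) q (complCMap I (π i) q t) = t := by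
  refine AdicFil.compl_ext fun m => ?_
  obtain ⟨c, hc⟩ := AdicFil.proj_surjective _ m (t.1 m)
  have h1 (i : ι) : (complCMap I (j i) q (complCMap I (π i) q t)).1 m =
      (chainFil A M I q).proj m (cMap k (j i) q (cMap k (π i) q c)) :=
    AdicFil.map_apply _ (AdicFil.map_apply _ hc.symm)
  rw [Submodule.coe_sum, Finset.sum_apply, Finset.sum_congr rfl fun i _ => h1 i, ← map_sum,
    sum_cMap π j h, hc]

theorem sum_bcMap (h : ∀ x, ∑ i, j i (π i x) = x) (I : Ideal k) (q : ℕ)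
    (t : AdicCompletion I k ⊗[k] CoChain A M q) :
    ∑ i, bcMap I (j i) q (bcMap I (π i) q t) = t := by
  induction t using TensorProduct.induction_on with
  | zero => simp
  | tmul c x =>
    simp only [bcMap, LinearMap.baseChange_tmul, ← TensorProduct.tmul_sum, sum_cMap π j h]
  | add s t hs ht => simp only [map_add, Finset.sum_add_distrib, hs, ht]

variable {π j}

theorem FiniteHomology.of_sum (h : ∀ x, ∑ i, j i (π i x) = x) {q : ℕ}
    (hM : FiniteHomology k A M' q) : FiniteHomology k A M q :=
  exists_fg_of_sum (D := CoChain A M) (E := CoChain A M') (P := fun i => cMap k (π i))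
    (J := fun i => cMap k (j i)) (fun i => cBoundary_cMap k (π i)) (fun i => cBoundary_cMap k (j i))
    (sum_cMap π j h) hM

theorem ComparisonInj.of_sum (h : ∀ x, ∑ i, j i (π i x) = x) {I : Ideal k} {q : ℕ}
    (hM : ComparisonInj A M' I q) : ComparisonInj A M I q :=
  homologyInj_of_sum (P := fun i => bcMap I (π i)) (J := fun i => bcMap I (j i))
    (P' := fun i => complCMap I (π i)) (fun i => bcBoundary_bcMap I (π i))
    (fun i => bcBoundary_bcMap I (j i)) (sum_bcMap π j h I)
    (fun i => complCBoundary_complCMap (π i)) (fun i q x => (complCMap_comparison I (π i) q x).symm)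
    hM

theorem ComparisonSurj.of_sum (h : ∀ x, ∑ i, j i (π i x) = x) {I : Ideal k} {q : ℕ}
    (hM : ComparisonSurj A M' I q) : ComparisonSurj A M I q :=
  homologySurj_of_sum (J := fun i => bcMap I (j i))
    (P' := fun i => complCMap I (π i)) (J' := fun i => complCMap I (j i))
    (fun i => bcBoundary_bcMap I (j i)) (fun i => complCBoundary_complCMap (π i))
    (fun i => complCBoundary_complCMap (j i)) (sum_complCMap π j h I)
    (fun i q x => (complCMap_comparison I (j i) q x).symm) hM

end Sum

/-! ### The enveloping algebra as coefficients -/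

section Env

theorem env_exact (q : ℕ) : cycles (C := CoChain A (Env A)) (cBoundary k) (q + 1) ≤
    LinearMap.range (cBoundary (M := Env A) k (q + 1)) := by
  intro t ht
  have ht' : cBoundary k q t = 0 := ht
  refine ⟨contraction k A (q + 1) t, ?_⟩
  have := cBoundary_contraction (k := k) q t
  rwa [ht', map_zero, add_zero] at this

/-- The homotopy identity passes to the completion, since it holds on representatives at each level.
-/
theorem env_compl_exact (I : Ideal k) (q : ℕ) :
    cycles (C := fun q => (chainFil A (Env A) I q).Compl) (complCBoundary A (Env A) I) (q + 1) ≤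
      LinearMap.range (complCBoundary A (Env A) I (q + 1)) := by
  intro t ht
  have ht' : complCBoundary A (Env A) I q t = 0 := ht
  refine ⟨AdicFil.map _ _ (contraction k A (q + 1)) contraction_mem_chainFil t, ?_⟩
  have key : complCBoundary A (Env A) I (q + 1)
      (AdicFil.map _ _ (contraction k A (q + 1)) contraction_mem_chainFil t) +
        AdicFil.map _ _ (contraction k A q) contraction_mem_chainFil
          (complCBoundary A (Env A) I q t) = t := by
    refine AdicFil.compl_ext fun m => ?_
    obtain ⟨c, hc⟩ := AdicFil.proj_surjective _ m (t.1 m)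
    change (complCBoundary A (Env A) I (q + 1) _).1 m + _ = _
    rw [complCBoundary, complCBoundary, AdicFil.map_apply _ (AdicFil.map_apply _ hc.symm),
      AdicFil.map_apply _ (AdicFil.map_apply _ hc.symm), ← map_add, cBoundary_contraction, hc]
  rwa [ht', map_zero, add_zero] at key

theorem env_finiteHomology_zero [Module.Finite k A] : FiniteHomology k A (Env A) 0 := by
  refine ⟨LinearMap.range (augSection k A), ?_, fun t _ => ?_⟩
  · rw [LinearMap.range_eq_map]
    exact Module.Finite.fg_top.map _
  · rw [← cBoundary_contraction_zero (k := k) t]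
    exact add_mem (Submodule.mem_sup_right ⟨_, rfl⟩) (Submodule.mem_sup_left ⟨_, rfl⟩)

variable [IsNoetherianRing k] [Module.Finite k A]

/-- The augmentation kills boundaries, so a class that dies in the completion has zero image in `Â`,
hence in `k̂ ⊗ A` by `AdicFil.adic_bijective`. The homotopy then writes it as a boundary. -/
theorem env_comparisonInj_zero (I : Ideal k) : ComparisonInj A (Env A) I 0 := by
  rintro t - ⟨w, hw⟩
  have h1 : AdicFil.map _ (AdicFil.adic A : AdicFil I A) (augmentation k A) augmentation_mem
      (comparison A (Env A) I 0 t) = 0 := by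
    rw [← hw, complCBoundary, AdicFil.map_map, AdicFil.map_congr _ (f' := 0) (by simp)
      (LinearMap.ext augmentation_cBoundary), AdicFil.map_zero_apply]
  rw [comparison, AdicFil.map_liftBaseChange] at h1
  have h2 := (injective_iff_map_eq_zero _).1 (AdicFil.adic_bijective (I := I) (C := A)).1 _ h1
  refine ⟨(contraction k A 0).baseChange _ t, ?_⟩
  have h3 : cBoundary (M := Env A) k 0 ∘ₗ contraction k A 0 + augSection k A ∘ₗ augmentation k A =
      LinearMap.id := LinearMap.ext cBoundary_contraction_zero
  have h4 := LinearMap.congr_fun (congrArg (LinearMap.baseChange (AdicCompletion I k)) h3) t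
  rw [LinearMap.baseChange_add, LinearMap.baseChange_comp, LinearMap.baseChange_comp,
    LinearMap.add_apply, LinearMap.comp_apply, LinearMap.comp_apply, h2, map_zero, add_zero,
    LinearMap.baseChange_id, LinearMap.id_apply] at h4
  exact h4

/-- Up to the boundary of its contraction, a completed chain equals the section applied to its
augmentation, and the latter comes from `k̂ ⊗ A`. -/
theorem env_comparisonSurj_zero (I : Ideal k) : ComparisonSurj A (Env A) I 0 := by
  intro t _
  obtain ⟨s, hs⟩ := (AdicFil.adic_bijective (I := I) (C := A)).2
    (AdicFil.map _ (AdicFil.adic A : AdicFil I A) (augmentation k A) augmentation_mem t)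
  refine ⟨(augSection k A).baseChange _ s, trivial,
    AdicFil.map _ _ (contraction k A 0) contraction_mem_chainFil t, ?_⟩
  rw [comparison, ← AdicFil.map_liftBaseChange (AdicFil.adic A) _ augSection_mem, hs]
  refine AdicFil.compl_ext fun m => ?_
  obtain ⟨c, hc⟩ := AdicFil.proj_surjective _ m (t.1 m)
  change _ = _ + (complCBoundary A (Env A) I 0 _).1 m
  rw [complCBoundary, AdicFil.map_apply _ (AdicFil.map_apply _ hc.symm),
    AdicFil.map_apply _ (AdicFil.map_apply _ hc.symm), ← map_add, add_comm,
    cBoundary_contraction_zero, hc]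

end Env

end Comparison

/-! ### Dimension shifting -/

section DimensionShift

variable {k A : Type*} [CommRing k] [Algebra ℂ k] [Ring A] [Algebra ℂ A] [Algebra k A]
  [IsScalarTower ℂ k A]

variable {N : Type*} [AddCommGroup N] [Module ℂ N] [Module (Env A) N]
  [IsScalarTower ℂ (Env A) N] [Module k N] [IsScalarTower k (Env A) N] [IsScalarTower ℂ k N]
  [Module (k ⊗[ℂ] k) N] [IsScalarTower (k ⊗[ℂ] k) (Env A) N]
  {L : Type*} [AddCommGroup L] [Module ℂ L] [Module (Env A) L]
  [IsScalarTower ℂ (Env A) L] [Module k L] [IsScalarTower k (Env A) L] [IsScalarTower ℂ k L]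
  [Module (k ⊗[ℂ] k) L] [IsScalarTower (k ⊗[ℂ] k) (Env A) L]
  {M : Type*} [AddCommGroup M] [Module ℂ M] [Module (Env A) M]
  [IsScalarTower ℂ (Env A) M] [Module k M] [IsScalarTower k (Env A) M] [IsScalarTower ℂ k M]
  [Module (k ⊗[ℂ] k) M] [IsScalarTower (k ⊗[ℂ] k) (Env A) M]

/-! ### Dimension shifting along a short exact sequence of bimodules -/

section Relative

variable {φ : N →ₗ[Env A] L} {ψ : L →ₗ[Env A] M} (hφ : Function.Injective φ)
  (hex : Function.Exact φ ψ) (hψ : Function.Surjective ψ)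

include hφ hex hψ

/-- The completion of a Noetherian ring is flat over it. -/
theorem bcMap_shortExact [IsNoetherianRing k] (I : Ideal k) :
    ShortExactSeq (N := fun q => AdicCompletion I k ⊗[k] CoChain A N q)
      (L := fun q => AdicCompletion I k ⊗[k] CoChain A L q)
      (M := fun q => AdicCompletion I k ⊗[k] CoChain A M q)
      (bcBoundary A N I) (bcBoundary A L I) (bcBoundary A M I) (bcMap I φ) (bcMap I ψ) :=
  (cMap_shortExact k φ ψ hφ hex hψ).baseChange (AdicCompletion I k)

theorem FiniteHomology.of_surjective_zero (hL : FiniteHomology k A L 0) :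
    FiniteHomology k A M 0 :=
  (cMap_shortExact k φ ψ hφ hex hψ).exists_fg_zero hL

theorem FiniteHomology.succ [IsNoetherianRing k] {q : ℕ}
    (hL : cycles (C := CoChain A L) (cBoundary k) (q + 1) ≤
      LinearMap.range (cBoundary (M := L) k (q + 1))) (hN : FiniteHomology k A N q) :
    FiniteHomology k A M (q + 1) :=
  (cMap_shortExact k φ ψ hφ hex hψ).exists_fg_succ hL hN

variable [IsNoetherianRing k] [IsNoetherianRing (k ⊗[ℂ] k)] [Module.Finite (k ⊗[ℂ] k) L]
  {I : Ideal k}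

theorem ComparisonSurj.of_surjective_zero (hL : ComparisonSurj A L I 0) :
    ComparisonSurj A M I 0 :=
  ShortExactSeq.homologySurj_zero (complCMap_shortExact I φ ψ hφ hex hψ)
    (complCMap_comparison I ψ) hL

theorem ComparisonInj.zero (hN : ComparisonSurj A N I 0) (hL : ComparisonInj A L I 0) :
    ComparisonInj A M I 0 :=
  ShortExactSeq.homologyInj_zero (bcMap_shortExact hφ hex hψ I)
    (complCMap_shortExact I φ ψ hφ hex hψ) (complCMap_comparison I φ) (complCMap_comparison I ψ)
    hN hL

theorem ComparisonSurj.succ {q : ℕ} (hN : ComparisonSurj A N I q) (hL : ComparisonInj A L I q)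
    (hL' : cycles (C := fun q => (chainFil A L I q).Compl) (complCBoundary A L I) (q + 1) ≤
      LinearMap.range (complCBoundary A L I (q + 1))) :
    ComparisonSurj A M I (q + 1) :=
  ShortExactSeq.homologySurj_succ (bcMap_shortExact hφ hex hψ I)
    (complCMap_shortExact I φ ψ hφ hex hψ) (complCBoundary_comparison I)
    (complCMap_comparison I φ) (complCMap_comparison I ψ) hN hL hL'

theorem ComparisonInj.succ {q : ℕ} (hN : ComparisonInj A N I q)
    (hL : cycles (C := CoChain A L) (cBoundary k) (q + 1) ≤
      LinearMap.range (cBoundary (M := L) k (q + 1))) :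
    ComparisonInj A M I (q + 1) :=
  ShortExactSeq.homologyInj_succ (bcMap_shortExact hφ hex hψ I)
    (complCMap_shortExact I φ ψ hφ hex hψ) (complCBoundary_comparison I)
    (complCMap_comparison I φ) (complCMap_comparison I ψ) hN (exact_baseChange _ _ _ hL)

end Relative

/-! ### Vanishing and comparison for free coefficients -/

section Free

variable {ι : Type*} [Fintype ι] {π : ι → L →ₗ[Env A] Env A} {j : ι → Env A →ₗ[Env A] L}
  (h : ∀ x, ∑ i, j i (π i x) = x)

include h

theorem exact_of_sum_eq (q : ℕ) : cycles (C := CoChain A L) (cBoundary k) (q + 1) ≤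
    LinearMap.range (cBoundary (M := L) k (q + 1)) :=
  exact_of_sum (D := CoChain A L) (E := CoChain A (Env A)) (P := fun i => cMap k (π i))
    (J := fun i => cMap k (j i)) (fun i => cBoundary_cMap k (π i))
    (fun i => cBoundary_cMap k (j i)) (sum_cMap π j h) (env_exact q)

theorem compl_exact_of_sum_eq (I : Ideal k) (q : ℕ) :
    cycles (C := fun q => (chainFil A L I q).Compl) (complCBoundary A L I) (q + 1) ≤
      LinearMap.range (complCBoundary A L I (q + 1)) :=
  exact_of_sum (P := fun i => complCMap I (π i)) (J := fun i => complCMap I (j i))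
    (fun i => complCBoundary_complCMap (π i)) (fun i => complCBoundary_complCMap (j i))
    (sum_complCMap π j h I) (env_compl_exact I q)

/-- Only degree zero has content; in positive degrees the base-changed complex is already exact. -/
theorem comparisonInj_of_sum_eq [IsNoetherianRing k] [Module.Finite k A] (I : Ideal k) :
    ∀ q, ComparisonInj A L I q
  | 0 => ComparisonInj.of_sum h (env_comparisonInj_zero I)
  | q + 1 => fun _ hx _ => exact_baseChange (C := CoChain A L) _ _ _ (exact_of_sum_eq h q) hx

end Free

end DimensionShift

/-! ### Finitely generated bimodules -/

section Bimodules

variable {k A : Type*} [CommRing k] [Algebra ℂ k] [Ring A] [Algebra ℂ A] [Algebra k A]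
  [IsScalarTower ℂ k A]

/-- A module over the enveloping algebra, regarded as a module over every commutative ring over
which the enveloping algebra is an algebra. -/
@[nolint unusedArguments]
def Bimod (_ : Type*) (M : Type*) : Type _ := M

namespace Bimod

variable (M : Type*) [AddCommGroup M] [Module (Env A) M]

instance : AddCommGroup (Bimod A M) := inferInstanceAs (AddCommGroup M)

instance : Module (Env A) (Bimod A M) := inferInstanceAs (Module (Env A) M)

instance (R : Type*) [CommSemiring R] [Algebra R (Env A)] : Module R (Bimod A M) :=
  Module.compHom _ (algebraMap R (Env A))

instance (R : Type*) [CommSemiring R] [Algebra R (Env A)] :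
    IsScalarTower R (Env A) (Bimod A M) :=
  .of_algebraMap_smul fun _ _ => rfl

instance : IsScalarTower ℂ k (Bimod A M) where
  smul_assoc c z x := by
    rw [← algebraMap_smul (Env A) (c • z), ← algebraMap_smul (Env A) c (z • x),
      ← algebraMap_smul (Env A) z, smul_smul, Algebra.smul_def, map_mul,
      ← IsScalarTower.algebraMap_apply]

end Bimod

/-- A finitely generated bimodule is the quotient of a free one by a finitely generated one. -/
theorem exists_presentation {R : Type*} [CommRing R] [IsNoetherianRing R] [Algebra R (Env A)]
    [Module.Finite R (Env A)] (M : Type*) [AddCommGroup M] [Module (Env A) M]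
    [Module.Finite (Env A) M] :
    ∃ (r : ℕ) (ψ : Bimod A (Fin r → Env A) →ₗ[Env A] M)
      (φ : Bimod A (LinearMap.ker ψ) →ₗ[Env A] Bimod A (Fin r → Env A)),
      Function.Injective φ ∧ Function.Exact φ ψ ∧ Function.Surjective ψ ∧
        Module.Finite (Env A) (Bimod A (LinearMap.ker ψ)) ∧
        Module.Finite R (Bimod A (Fin r → Env A)) := by
  obtain ⟨r, ψ, hψ⟩ := Module.Finite.exists_fin' (Env A) M
  have : Module.Finite (Env A) (Bimod A (Fin r → Env A)) :=
    inferInstanceAs (Module.Finite (Env A) (Fin r → Env A))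
  have hL : Module.Finite R (Bimod A (Fin r → Env A)) := Module.Finite.trans (Env A) _
  let ψ' : Bimod A (Fin r → Env A) →ₗ[Env A] M := ψ
  let φ : Bimod A (LinearMap.ker ψ') →ₗ[Env A] Bimod A (Fin r → Env A) :=
    (LinearMap.ker ψ').subtype
  have hφ : Function.Injective φ := Subtype.val_injective
  -- Finiteness of the kernel is obtained over the commutative Noetherian ring `R` and then passes
  -- to `Env A`.
  have : IsNoetherian R (Bimod A (Fin r → Env A)) := isNoetherian_of_isNoetherianRing_of_finite R _
  have : Module.Finite R (Bimod A (LinearMap.ker ψ')) :=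
    Module.Finite.of_injective (φ.restrictScalars R) hφ
  exact ⟨r, ψ', φ, hφ, LinearMap.exact_subtype_ker_map ψ', hψ,
    Module.Finite.of_restrictScalars_finite R (Env A) _, hL⟩

/-- The projections of a free bimodule. -/
def freeProj (r : ℕ) (i : Fin r) : Bimod A (Fin r → Env A) →ₗ[Env A] Env A :=
  LinearMap.proj (R := Env A) (φ := fun _ : Fin r => Env A) i

/-- The inclusions of the summands of a free bimodule. -/
def freeSingle (r : ℕ) (i : Fin r) : Env A →ₗ[Env A] Bimod A (Fin r → Env A) :=
  LinearMap.single (Env A) (fun _ : Fin r => Env A) i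

theorem sum_freeSingle_freeProj (r : ℕ) (x : Bimod A (Fin r → Env A)) :
    ∑ i, freeSingle r i (freeProj r i x) = x :=
  Finset.univ_sum_single (M := fun _ : Fin r => Env A) x

/-- If `s` generates `A` over `k`, the tensors `a ⊗ op b` with `a, b ∈ s` generate `A^e` over `k ⊗
k`. -/
theorem finite_env [Module.Finite k A] : Module.Finite (k ⊗[ℂ] k) (Env A) := by
  obtain ⟨s, hs⟩ := Module.Finite.fg_top (R := k) (M := A)
  classical
  refine ⟨(s ×ˢ s).image fun x => (x.1 ⊗ₜ[ℂ] MulOpposite.op x.2 : Env A),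
    eq_top_iff.2 fun x _ => ?_⟩
  have key (z w : k) (a : A) (b : Aᵐᵒᵖ) :
      (z ⊗ₜ[ℂ] w : k ⊗[ℂ] k) • (a ⊗ₜ[ℂ] b : Env A) = (z • a) ⊗ₜ[ℂ] (w • b) := by
    rw [Algebra.smul_def]
    change centerMap k A _ * _ = _
    simp [centerMap, Algebra.smul_def]
  set P := Submodule.span (k ⊗[ℂ] k)
    (((s ×ˢ s).image fun x => (x.1 ⊗ₜ[ℂ] MulOpposite.op x.2 : Env A) : Finset (Env A)) :
      Set (Env A))
  induction x using TensorProduct.induction_on with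
  | zero => exact zero_mem _
  | add x y hx hy => exact add_mem (hx trivial) (hy trivial)
  | tmul a b =>
    obtain ⟨b, rfl⟩ := MulOpposite.op_surjective b
    have ha : a ∈ Submodule.span k (s : Set A) := hs ▸ trivial
    have hb : b ∈ Submodule.span k (s : Set A) := hs ▸ trivial
    refine Submodule.span_induction
      (p := fun a _ => (a ⊗ₜ[ℂ] MulOpposite.op b : Env A) ∈ P) ?_ ?_ ?_ ?_ ha
    · intro a ha
      refine Submodule.span_induction
        (p := fun b _ => (a ⊗ₜ[ℂ] MulOpposite.op b : Env A) ∈ P) ?_ ?_ ?_ ?_ hb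
      · intro b hb
        exact Submodule.subset_span (Finset.mem_coe.2 (Finset.mem_image.2
          ⟨(a, b), Finset.mem_product.2 ⟨ha, hb⟩, rfl⟩))
      · simp
      · intro x y _ _ hx hy
        rw [MulOpposite.op_add, TensorProduct.tmul_add]; exact add_mem hx hy
      · intro z x _ hx
        have := P.smul_mem (1 ⊗ₜ[ℂ] z) hx
        rwa [key, one_smul] at this
    · simp
    · intro x y _ _ hx hy
      rw [TensorProduct.add_tmul]; exact add_mem hx hy
    · intro z x _ hx
      have := P.smul_mem (z ⊗ₜ[ℂ] 1) hx
      rwa [key, one_smul] at this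

/-- `k ⊗ k` is again of finite type over `ℂ`, so Hilbert's basis theorem applies. -/
theorem isNoetherianRing_tensor (k : Type*) [CommRing k] [Algebra ℂ k] [Algebra.FiniteType ℂ k] :
    IsNoetherianRing (k ⊗[ℂ] k) := by
  have : Algebra.FiniteType k (k ⊗[ℂ] k) := inferInstance
  have : Algebra.FiniteType ℂ (k ⊗[ℂ] k) := Algebra.FiniteType.trans (S := k) inferInstance this
  exact Algebra.FiniteType.isNoetherianRing ℂ _

end Bimodules

/-! ### The main induction -/

section Induction

variable {k : Type u} {A : Type v} [CommRing k] [Algebra ℂ k] [Ring A] [Algebra ℂ A] [Algebra k A]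
  [IsScalarTower ℂ k A] [Algebra.FiniteType ℂ k] [Module.Finite k A]

theorem free_finiteHomology_zero (r : ℕ) :
    FiniteHomology k A (Bimod A (Fin r → Env A)) 0 :=
  FiniteHomology.of_sum (π := freeProj r) (j := freeSingle r) (sum_freeSingle_freeProj r)
    env_finiteHomology_zero

theorem free_comparisonSurj_zero [IsNoetherianRing k] (r : ℕ) (I : Ideal k) :
    ComparisonSurj A (Bimod A (Fin r → Env A)) I 0 :=
  ComparisonSurj.of_sum (π := freeProj r) (j := freeSingle r) (sum_freeSingle_freeProj r)
    (env_comparisonSurj_zero I)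

/-- All finitely generated bimodules are treated at once in each degree, because the step from `q`
to `q + 1` for `M` uses degree `q` for the kernel of a free presentation of `M`. -/
theorem finiteHomology_and_comparison (q : ℕ) : ∀ (M : Type v) [AddCommGroup M] [Module ℂ M]
    [Module (Env A) M] [IsScalarTower ℂ (Env A) M] [Module k M] [IsScalarTower k (Env A) M]
    [IsScalarTower ℂ k M] [Module (k ⊗[ℂ] k) M] [IsScalarTower (k ⊗[ℂ] k) (Env A) M]
    [Module.Finite (Env A) M], FiniteHomology k A M q ∧
      ∀ I : Ideal k, ComparisonSurj A M I q ∧ ComparisonInj A M I q := by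
  have : IsNoetherianRing k := Algebra.FiniteType.isNoetherianRing ℂ k
  have : IsNoetherianRing (k ⊗[ℂ] k) := isNoetherianRing_tensor k
  have : Module.Finite (k ⊗[ℂ] k) (Env A) := finite_env
  induction q with
  | zero =>
    -- Degree zero takes two passes: injectivity for `M` relies on surjectivity for the kernel, so
    -- surjectivity is first proved for all bimodules.
    have main : ∀ (M : Type v) [AddCommGroup M] [Module ℂ M]
        [Module (Env A) M] [IsScalarTower ℂ (Env A) M] [Module k M] [IsScalarTower k (Env A) M]
        [IsScalarTower ℂ k M] [Module (k ⊗[ℂ] k) M] [IsScalarTower (k ⊗[ℂ] k) (Env A) M]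
        [Module.Finite (Env A) M], FiniteHomology k A M 0 ∧
          ∀ I : Ideal k, ComparisonSurj A M I 0 := by
      intro M _ _ _ _ _ _ _ _ _ _
      obtain ⟨r, ψ, φ, hφ, hex, hψ, hK, hL⟩ := exists_presentation (A := A) (R := k ⊗[ℂ] k) M
      exact ⟨.of_surjective_zero hφ hex hψ (free_finiteHomology_zero r),
        fun I => .of_surjective_zero hφ hex hψ (free_comparisonSurj_zero r I)⟩
    intro M _ _ _ _ _ _ _ _ _ _
    refine ⟨(main M).1, fun I => ⟨(main M).2 I, ?_⟩⟩
    obtain ⟨r, ψ, φ, hφ, hex, hψ, hK, hL⟩ := exists_presentation (A := A) (R := k ⊗[ℂ] k) M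
    exact .zero hφ hex hψ ((main (Bimod A (LinearMap.ker ψ))).2 I)
      (comparisonInj_of_sum_eq (sum_freeSingle_freeProj r) I 0)
  | succ q ih =>
    intro M _ _ _ _ _ _ _ _ _ _
    obtain ⟨r, ψ, φ, hφ, hex, hψ, hK, hL⟩ := exists_presentation (A := A) (R := k ⊗[ℂ] k) M
    obtain ⟨h1, h2⟩ := ih (Bimod A (LinearMap.ker ψ))
    exact ⟨.succ hφ hex hψ (exact_of_sum_eq (sum_freeSingle_freeProj r) q) h1,
      fun I => ⟨.succ hφ hex hψ (h2 I).1
          (comparisonInj_of_sum_eq (sum_freeSingle_freeProj r) I q)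
          (compl_exact_of_sum_eq (sum_freeSingle_freeProj r) I q),
        .succ hφ hex hψ (h2 I).2
          (exact_of_sum_eq (sum_freeSingle_freeProj r) q)⟩⟩

end Induction

/-! ### Chains of quotient algebras -/

section QuotientChains

variable {k A : Type*} [CommRing k] [Algebra ℂ k] [Ring A] [Algebra ℂ A] [Algebra k A]
  [IsScalarTower ℂ k A]

theorem mul_mem_smul_top {J J' : Ideal k} {a b : A} (ha : a ∈ (J • ⊤ : Submodule k A))
    (hb : b ∈ (J' • ⊤ : Submodule k A)) : a * b ∈ ((J * J') • ⊤ : Submodule k A) := by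
  refine Submodule.smul_induction_on ha (fun z hz c _ => ?_) fun x y hx hy => ?_
  · refine Submodule.smul_induction_on hb (fun w hw d _ => ?_) fun x y hx hy => ?_
    · rw [smul_mul_smul_comm]
      exact Submodule.smul_mem_smul (Ideal.mul_mem_mul hz hw) trivial
    · rw [mul_add]; exact add_mem hx hy
  · rw [add_mul]; exact add_mem hx hy

/-- The generators of `I A` are central, so `(I A)^m = I^m A`. -/
theorem mem_extIdeal_pow (I : Ideal k) (m : ℕ) (a : A) :
    a ∈ extIdeal A I ^ m ↔ a ∈ (I ^ m • ⊤ : Submodule k A) := by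
  refine ⟨fun ha => ?_, fun ha => ?_⟩
  · induction m generalizing a with
    | zero => simp [Ideal.one_eq_top]
    | succ m ih =>
      rw [Submodule.pow_succ] at ha ⊢
      refine Submodule.mul_induction_on ha (fun x hx y hy => mul_mem_smul_top (ih x hx) ?_)
        fun x y hx hy => add_mem hx hy
      refine Submodule.span_induction (p := fun y _ => y ∈ (I • ⊤ : Submodule k A)) ?_ ?_ ?_ ?_ hy
      · rintro _ ⟨z, hz, rfl⟩
        rw [Algebra.algebraMap_eq_smul_one]
        exact Submodule.smul_mem_smul hz trivial
      · exact zero_mem _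
      · intro x y _ _ hx hy
        exact add_mem hx hy
      · intro c x _ hx
        exact mul_mem_smul_top_right hx c
  · refine Submodule.smul_induction_on ha (fun z hz c _ => ?_) fun x y hx hy => add_mem hx hy
    rw [Algebra.smul_def, Algebra.commutes]
    exact Ideal.mul_mem_left _ _ (algebraMap_mem_extIdeal_pow I m hz)

variable (J : Ideal A) [J.IsTwoSided]

theorem chainMap_mk_surjective (q : ℕ) :
    Function.Surjective (chainMap k (Ideal.Quotient.mkₐ k J) q) := by
  intro t
  refine coChain_induction (A := A ⧸ J) (M := A ⧸ J)
    (P := fun t => ∃ x, chainMap k (Ideal.Quotient.mkₐ k J) q x = t) t ⟨0, map_zero _⟩ ?_ ?_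
  · intro x a
    obtain ⟨x, rfl⟩ := Ideal.Quotient.mk_surjective x
    choose b hb using fun i => Ideal.Quotient.mk_surjective (a i)
    obtain rfl : (fun i => Ideal.Quotient.mk J (b i)) = a := funext hb
    exact ⟨tensor x b, chainMap_tensor k _ x b⟩
  · rintro _ _ ⟨s, rfl⟩ ⟨t, rfl⟩
    exact ⟨s + t, map_add _ _ _⟩

/-- The head is changed by additivity; the tail is changed by viewing the tensor modulo `S` as a
multilinear map that vanishes when an entry lies in `J`. -/
theorem tensor_sub_tensor_mem {q : ℕ} {S : Submodule k (Chain A q)}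
    (hl : ∀ x ∈ J, ∀ a : Fin q → A, tensor x a ∈ S)
    (hr : ∀ (x : A) (a : Fin q → A) (i : Fin q), a i ∈ J → tensor x a ∈ S)
    {x y : A} {a b : Fin q → A} (hx : x - y ∈ J) (ha : ∀ i, a i - b i ∈ J) :
    tensor x a - tensor y b ∈ S := by
  have h1 : tensor x a - tensor y a ∈ S := by
    rw [sub_eq_iff_eq_add.2 (show tensor x a = tensor (x - y) a + tensor y a by
      rw [← tensor_add_left, sub_add_cancel])]
    exact hl _ hx a
  let f : MultilinearMap ℂ (fun _ : Fin q => A) (Chain A q ⧸ S.restrictScalars ℂ) :=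
    ((S.restrictScalars ℂ).mkQ ∘ₗ TensorProduct.mk ℂ A _ y).compMultilinearMap
      ((PiTensorProduct.tprod ℂ).compLinearMap
        fun _ : Fin q => (Submodule.span ℂ {(1 : A)}).mkQ)
  have h2 : f a = f b := multilinear_eq_of_sub_mem (J.restrictScalars ℂ) f
    (fun a i hi => (Submodule.Quotient.mk_eq_zero _).2 (hr y a i hi)) a b ha
  have h3 : tensor y a - tensor y b ∈ S := (Submodule.Quotient.eq _).1 h2
  simpa using add_mem h1 h3

/-- The kernel of the map on chains induced by the projection to a quotient algebra. -/
theorem mem_of_chainMap_mk_eq_zero {q : ℕ} {S : Submodule k (Chain A q)}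
    (hl : ∀ x ∈ J, ∀ a : Fin q → A, tensor x a ∈ S)
    (hr : ∀ (x : A) (a : Fin q → A) (i : Fin q), a i ∈ J → tensor x a ∈ S)
    {t : Chain A q} (ht : chainMap k (Ideal.Quotient.mkₐ k J) q t = 0) : t ∈ S := by
  let p : A →ₗ[ℂ] A ⧸ J := (Ideal.Quotient.mkₐ ℂ J).toLinearMap
  have hp : Function.Surjective p := Ideal.Quotient.mk_surjective
  have hle : Submodule.span ℂ {(1 : A)} ≤ (Submodule.span ℂ {(1 : A ⧸ J)}).comap p := by
    rw [Submodule.span_le]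
    rintro _ rfl
    exact Submodule.mem_span_singleton_self _
  let r : Bar A →ₗ[ℂ] Bar (A ⧸ J) := Submodule.mapQ _ _ p hle
  have hr' : Function.Surjective r := by
    intro y
    obtain ⟨y, rfl⟩ := Submodule.mkQ_surjective _ y
    obtain ⟨x, rfl⟩ := hp y
    exact ⟨Submodule.Quotient.mk x, rfl⟩
  obtain ⟨s, hs⟩ := p.exists_rightInverse_of_surjective (LinearMap.range_eq_top.2 hp)
  obtain ⟨s', hs'⟩ := r.exists_rightInverse_of_surjective (LinearMap.range_eq_top.2 hr')
  let σ : Chain (A ⧸ J) q →ₗ[ℂ] Chain A q :=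
    TensorProduct.map s (PiTensorProduct.map fun _ => s')
  -- Linear sections of `A → A / J` and of the induced map on `A / ℂ1` give `σ`. It suffices that
  -- `t` and `σ` of its image agree modulo `S`, because `σ` of zero is zero.
  suffices h : ∀ t : Chain A q, t - σ (chainMap k (Ideal.Quotient.mkₐ k J) q t) ∈ S by
    simpa [ht] using h t
  intro t
  refine coChain_induction (A := A) (M := A)
    (P := fun t => t - σ (chainMap k (Ideal.Quotient.mkₐ k J) q t) ∈ S) t (by simp) ?_ ?_
  · intro x a
    have h1 (i : Fin q) : ∃ b, a i - b ∈ J ∧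
        (Submodule.span ℂ {(1 : A)}).mkQ b = s' (Submodule.mkQ _ (p (a i))) := by
      obtain ⟨b, hb⟩ := Submodule.mkQ_surjective _ (s' (Submodule.mkQ _ (p (a i))))
      have h2 : Submodule.mkQ (Submodule.span ℂ {(1 : A ⧸ J)}) (p b) =
          Submodule.mkQ _ (p (a i)) := by
        have := LinearMap.congr_fun hs' (Submodule.mkQ _ (p (a i)))
        rw [LinearMap.comp_apply, ← hb] at this
        exact this
      rw [Submodule.mkQ_apply, Submodule.mkQ_apply, eq_comm, Submodule.Quotient.eq,
        Submodule.mem_span_singleton] at h2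
      obtain ⟨c, hc⟩ := h2
      -- A representative `b` of the class chosen by `s'` is congruent to `a i` modulo `J` only up
      -- to a scalar; adding `c • 1` corrects this without changing the class modulo `ℂ1`.
      refine ⟨b + c • 1, ?_, ?_⟩
      · rw [← Ideal.Quotient.eq_zero_iff_mem]
        change p (a i - (b + c • 1)) = 0
        rw [map_sub, map_add, map_smul, show p 1 = 1 from rfl, hc]
        abel
      · rw [map_add, hb, map_smul, Submodule.mkQ_apply _ (1 : A),
          (Submodule.Quotient.mk_eq_zero _).2 (Submodule.mem_span_singleton_self _), smul_zero,
          add_zero]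
    choose b hb hb' using h1
    have h3 : σ (chainMap k (Ideal.Quotient.mkₐ k J) q (tensor x a)) = tensor (s (p x)) b := by
      rw [chainMap_tensor, tensor, tensor]
      simp only [σ, TensorProduct.map_tmul, PiTensorProduct.map_tprod, hb']
      rfl
    change tensor x a - _ ∈ S
    rw [show (cTensor x a : CoChain A A q) = tensor x a from rfl, h3]
    refine tensor_sub_tensor_mem J hl hr ?_ hb
    rw [← Ideal.Quotient.eq_zero_iff_mem]
    change p (x - s (p x)) = 0
    rw [map_sub, ← LinearMap.comp_apply p s, hs, LinearMap.id_apply, sub_self]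
  · intro x y hx hy
    rw [map_add, map_add, add_sub_add_comm]
    exact add_mem hx hy

theorem chainMap_mk_tensor_eq_zero_left {q : ℕ} {x : A} (hx : x ∈ J) (a : Fin q → A) :
    chainMap k (Ideal.Quotient.mkₐ k J) q (tensor x a) = 0 := by
  rw [chainMap_tensor, show Ideal.Quotient.mkₐ k J x = 0 from Ideal.Quotient.eq_zero_iff_mem.2 hx,
    tensor, TensorProduct.zero_tmul]

theorem chainMap_mk_tensor_eq_zero_right {q : ℕ} (x : A) (a : Fin q → A) {i : Fin q}
    (hi : a i ∈ J) : chainMap k (Ideal.Quotient.mkₐ k J) q (tensor x a) = 0 := by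
  rw [chainMap_tensor, tensor, (PiTensorProduct.tprod ℂ).map_coord_zero i, TensorProduct.tmul_zero]
  rw [Function.comp_apply,
    show Ideal.Quotient.mkₐ k J (a i) = 0 from Ideal.Quotient.eq_zero_iff_mem.2 hi, map_zero]

end QuotientChains

/-! ### The twisted bimodule -/

section Twisted

variable {k : Type u} {A : Type v} [CommRing k] [Algebra ℂ k] [Ring A] [Algebra ℂ A] [Algebra k A]
  [IsScalarTower ℂ k A]

/-- `A` as a bimodule, with the right action twisted by `g`. -/
@[nolint unusedArguments]
def Tw (_ : A →ₐ[ℂ] A) : Type v := A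

/-- The action of the enveloping algebra on `A`, with the right action twisted by `g`. -/
def twistedAction (g : A →ₐ[ℂ] A) : Env A →ₐ[ℂ] Module.End ℂ A :=
  Algebra.TensorProduct.lift (Algebra.lmul ℂ A) ((Algebra.lsmul ℂ ℂ A).comp (AlgHom.op g))
    fun a _ => commute_iff_eq _ _ |>.2 (LinearMap.ext fun x => (mul_assoc a x _).symm)

namespace Tw

variable (g : A →ₐ[ℂ] A)

instance : AddCommGroup (Tw g) := inferInstanceAs (AddCommGroup A)

instance : Module ℂ (Tw g) := inferInstanceAs (Module ℂ A)

instance : Module k (Tw g) := inferInstanceAs (Module k A)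

instance : IsScalarTower ℂ k (Tw g) := inferInstanceAs (IsScalarTower ℂ k A)

instance : Module (Env A) (Tw g) := Module.compHom A (twistedAction g).toRingHom

instance : Module (k ⊗[ℂ] k) (Tw g) := Module.compHom (Tw g) (algebraMap (k ⊗[ℂ] k) (Env A))

/-- An element of `A`, regarded as an element of the twisted bimodule. -/
def of (x : A) : Tw g := x

theorem tmul_smul (a b x : A) :
    (a ⊗ₜ[ℂ] MulOpposite.op b : Env A) • of g x = of g (a * (x * g b)) := by
  change twistedAction g (a ⊗ₜ[ℂ] MulOpposite.op b) x = a * (x * g b)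
  rw [twistedAction, Algebra.TensorProduct.lift_tmul]
  rfl

theorem rightMul_smul (a x : A) : rightMul a • of g x = of g (x * g a) := by
  rw [rightMul_apply, tmul_smul, one_mul]

theorem leftMul_smul (a x : A) : leftMul a • of g x = of g (a * x) := by
  rw [leftMul_apply, ← MulOpposite.op_one, tmul_smul, map_one, mul_one]

instance : IsScalarTower ℂ (Env A) (Tw g) :=
  IsScalarTower.of_algebraMap_smul (R := ℂ) (A := Env A) (M := Tw g) fun c x =>
    (leftMul_smul g (algebraMap ℂ A c) x).trans (Algebra.smul_def (A := A) c x).symm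

instance : IsScalarTower k (Env A) (Tw g) :=
  IsScalarTower.of_algebraMap_smul (R := k) (A := Env A) (M := Tw g) fun z x =>
    (leftMul_smul g (algebraMap k A z) x).trans (Algebra.smul_def (A := A) z x).symm

instance : IsScalarTower (k ⊗[ℂ] k) (Env A) (Tw g) := .of_algebraMap_smul fun _ _ => rfl

/-- The twisted bimodule is generated by `1`, already under left multiplication. -/
instance : Module.Finite (Env A) (Tw g) :=
  ⟨{of g 1}, by
    rw [eq_top_iff]
    intro x _
    rw [Finset.coe_singleton]
    refine Submodule.mem_span_singleton.2 ⟨leftMul (A := A) x, ?_⟩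
    exact (leftMul_smul g x 1).trans (mul_one (M := A) x)⟩

theorem cHead_of {q : ℕ} (j : ℕ) (x : A) (a : Fin (q + 1) → A) :
    cHead j (of g x) a = of g (faceHead g j x a) := by
  unfold cHead faceHead
  split_ifs
  · exact rightMul_smul g _ _
  · exact leftMul_smul g _ _
  · rfl

theorem cBoundary_eq (q : ℕ) : cBoundary (A := A) (M := Tw g) k q = boundary k g q := by
  refine coChain_hom_ext fun x a => ?_
  refine (cBoundary_cTensor k q x a).trans (Eq.trans ?_ (boundary_tensor k g q x a).symm)
  refine Finset.sum_congr rfl fun j _ => ?_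
  rw [show cHead (j : ℕ) x a = of g (faceHead g j x a) from cHead_of g j x a]
  rfl

variable {g} {I : Ideal k}

/-- On the twisted bimodule, right multiplication by `z ∈ I ^ m` is multiplication by `g(z)`, which
stays in `(I A)^m` because `g` preserves `I A`. Conversely, left multiples alone exhaust `(I A)^m`.
-/
theorem mem_biFil (hg : ∀ a ∈ extIdeal A I, g a ∈ extIdeal A I) (m : ℕ) (x : A) :
    of g x ∈ biFil (Tw g) I m ↔ x ∈ extIdeal A I ^ m := by
  refine ⟨fun hx => ?_, fun hx => ?_⟩
  · obtain ⟨y, hxy, hy⟩ : ∃ y, of g x = of g y ∧ y ∈ extIdeal A I ^ m := by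
      refine biFil_induction (A := A) (M := Tw g)
        (P := fun x => ∃ y, x = of g y ∧ y ∈ extIdeal A I ^ m) ?_ ?_ ?_ hx
      · intro z hz x
        exact ⟨_, leftMul_smul g _ x,
          Ideal.mul_mem_right _ _ (algebraMap_mem_extIdeal_pow I m hz)⟩
      · intro z hz x
        exact ⟨_, rightMul_smul g _ x, Ideal.mul_mem_left _ _
          (pow_le_comap I g hg m (algebraMap_mem_extIdeal_pow I m hz))⟩
      · rintro _ _ ⟨x, hx', hx⟩ ⟨y, hy', hy⟩
        exact ⟨x + y, hx' ▸ hy' ▸ rfl, add_mem hx hy⟩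
    rwa [show x = y from hxy]
  · rw [mem_extIdeal_pow] at hx
    refine Submodule.smul_induction_on hx (fun z hz c _ => ?_) fun x y hx hy => add_mem hx hy
    rw [Algebra.smul_def]
    rw [← leftMul_smul g]
    exact left_smul_mem_biFil hz _

/-- This identifies level `m` of the filtered chains with the chains of `A / (I A)^m`: both sides
are generated by the tensors with one entry in `(I A)^m`. -/
theorem mem_chainFil_iff (hg : ∀ a ∈ extIdeal A I, g a ∈ extIdeal A I) {q m : ℕ} (t : Chain A q) :
    t ∈ (chainFil A (Tw g) I q).step m ↔
      chainMap k (Ideal.Quotient.mkₐ k (extIdeal A I ^ m)) q t = 0 := by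
  let F : CoChain A (Tw g) q →ₗ[k] Chain (QuotPow A I m) q :=
    chainMap k (Ideal.Quotient.mkₐ k (extIdeal A I ^ m)) q
  refine ⟨fun ht => ?_, fun ht => ?_⟩
  · refine chainFil_induction (P := fun t => F t = 0) (map_zero F) ?_ ?_ ?_ ht
    · intro x hx a
      exact chainMap_mk_tensor_eq_zero_left _ ((mem_biFil hg m x).1 hx) a
    · intro x a i hi
      exact chainMap_mk_tensor_eq_zero_right _ _ a ((mem_extIdeal_pow I m _).2 hi)
    · intro s t hs ht
      rw [map_add, hs, ht, add_zero]
  · exact mem_of_chainMap_mk_eq_zero (extIdeal A I ^ m)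
      (S := (chainFil A (Tw g) I q).step m)
      (fun x hx a => cTensor_mem_chainFil_left ((mem_biFil hg m x).2 hx) a)
      (fun x a i hi => cTensor_mem_chainFil_right _ ((mem_extIdeal_pow I m _).1 hi)) ht

end Tw

end Twisted

/-- Homology embeds into chains modulo boundaries, where its image lies in that of `T`, a Noetherian
module. -/
theorem finite_homology {R : Type*} [CommRing R] [IsNoetherianRing R] {C : ℕ → Type*}
    [∀ q, AddCommGroup (C q)] [∀ q, Module R (C q)] (d : ∀ q, C (q + 1) →ₗ[R] C q) (q : ℕ)
    (h : ∃ T : Submodule R (C q), T.FG ∧ cycles d q ≤ T ⊔ LinearMap.range (d q)) :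
    Module.Finite R (Homology d q) := by
  obtain ⟨T, hT, hle⟩ := h
  set B := LinearMap.range (d q) with hB
  have : IsNoetherian R (T.map B.mkQ) := isNoetherian_of_fg_of_noetherian _ (hT.map _)
  let f : Homology d q →ₗ[R] C q ⧸ B := Submodule.mapQ _ B (cycles d q).subtype le_rfl
  have hf : Function.Injective f := by
    refine (injective_iff_map_eq_zero f).2 fun x hx => ?_
    obtain ⟨x, rfl⟩ := Submodule.mkQ_surjective _ x
    exact (Submodule.Quotient.mk_eq_zero _).2 ((Submodule.Quotient.mk_eq_zero B).1 hx)
  have hT' : ∀ x, f x ∈ T.map B.mkQ := by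
    intro x
    obtain ⟨x, rfl⟩ := Submodule.mkQ_surjective _ x
    obtain ⟨t, ht, b, hb, htb⟩ := Submodule.mem_sup.1 (hle x.2)
    refine ⟨t, ht, (Submodule.Quotient.eq B).2 ?_⟩
    rw [Submodule.subtype_apply, ← htb, sub_add_cancel_left]
    exact neg_mem hb
  exact Module.Finite.of_injective (f.codRestrict _ hT')
    fun x y hxy => hf (congrArg Subtype.val hxy)

/-! ### Transfer of the comparison to an isomorphic completed complex -/

section Transfer

variable {k A : Type*} [CommRing k] [Algebra ℂ k] [Ring A] [Algebra ℂ A] [Algebra k A]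
  [IsScalarTower ℂ k A] {M : Type*} [AddCommGroup M] [Module ℂ M] [Module (Env A) M]
  [IsScalarTower ℂ (Env A) M] [Module k M] [IsScalarTower k (Env A) M] [IsScalarTower ℂ k M]
  [Module (k ⊗[ℂ] k) M] [IsScalarTower (k ⊗[ℂ] k) (Env A) M] {I : Ideal k}
  {D : ℕ → Type*} [∀ q, AddCommGroup (D q)] [∀ q, Module k (D q)]
  [∀ q, Module (AdicCompletion I k) (D q)] [∀ q, IsScalarTower k (AdicCompletion I k) (D q)]

/-- The boundary enters through an equation `hd`, so that the differential `b_g` can be put in place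
of `cBoundary` for the twisted bimodule. -/
theorem bijective_homologyMap_of_comparison [IsNoetherianRing k]
    {d : ∀ q, CoChain A M (q + 1) →ₗ[k] CoChain A M q} (hd : cBoundary k = d)
    {d' : ∀ q, D (q + 1) →ₗ[AdicCompletion I k] D q} (f : ∀ q, CoChain A M q →ₗ[k] D q)
    (hf : ∀ q x, d' q (f (q + 1) x) = f q (d q x))
    (e : ∀ q, (chainFil A M I q).Compl →ₗ[AdicCompletion I k] D q)
    (hc : ∀ q x, d' q (e (q + 1) x) = e q (complCBoundary A M I q x))
    (he : ∀ q, Function.Bijective (e q))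
    (hfe : ∀ q x, f q x = e q ((chainFil A M I q).toCompletion x)) {q : ℕ}
    (hi : ComparisonInj A M I q) (hs : ComparisonSurj A M I q) :
    Function.Bijective ((homologyMap (C := CoChain A M) f hf q).liftBaseChange
      (AdicCompletion I k)) := by
  subst hd
  have h (q : ℕ) (x : AdicCompletion I k ⊗[k] CoChain A M q) :
      (f q).liftBaseChange (AdicCompletion I k) x = e q (comparison A M I q x) := by
    induction x using TensorProduct.induction_on with
    | zero => rw [map_zero, map_zero, map_zero]
    | add x y hx hy => rw [map_add, map_add, map_add, hx, hy]
    | tmul c x =>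
      rw [comparison, LinearMap.liftBaseChange_tmul, LinearMap.liftBaseChange_tmul, map_smul, hfe]
  exact bijective_liftBaseChange_homologyMap (C := CoChain A M) (AdicCompletion I k)
    (cBoundary_cBoundary k) f hf q (hi.trans_bijective hc he h) (hs.trans_bijective hc he h)

end Transfer

/-! ### The inverse limit as a filtered completion, and the two conclusions -/

section Main

variable {k : Type u} {A : Type v} [CommRing k] [Algebra ℂ k] [Ring A] [Algebra ℂ A] [Algebra k A]
  [IsScalarTower ℂ k A] {I : Ideal k} {g : A →ₐ[ℂ] A}

theorem quotPow_chain_smul {m q : ℕ} {c : AdicCompletion I k} {z : k}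
    (hz : AdicCompletion.evalₐ I m c = Ideal.Quotient.mk _ z) (y : Chain (QuotPow A I m) q) :
    c • y = z • y := by
  induction y using TensorProduct.induction_on with
  | zero => rw [smul_zero, smul_zero]
  | add x y hx hy => rw [smul_add, smul_add, hx, hy]
  | tmul x t =>
    rw [TensorProduct.smul_tmul', TensorProduct.smul_tmul']
    congr 1
    rw [Algebra.smul_def, Algebra.smul_def]
    congr 1
    exact quotPowStructureMap_eq I m hz

/-- The chains of `A`, regarded as chains with coefficients in the twisted bimodule, are mapped to
the chains of `A / I ^ m`. -/
def reduction (g : A →ₐ[ℂ] A) (I : Ideal k) (q m : ℕ) :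
    CoChain A (Tw g) q →ₗ[k] Chain (QuotPow A I m) q :=
  chainMap k (Ideal.Quotient.mkₐ k (extIdeal A I ^ m)) q

theorem reduction_surjective (q m : ℕ) : Function.Surjective (reduction g I q m) :=
  chainMap_mk_surjective (k := k) (extIdeal A I ^ m) q

theorem chainMap_reduction {q m n : ℕ} (h : m ≤ n) (t : CoChain A (Tw g) q) :
    chainMap (AdicCompletion I k) (quotPowMap I h) q (reduction g I q n t) = reduction g I q m t :=
  (toCompl A I q t).2 m n h

variable (hg : ∀ a ∈ extIdeal A I, g a ∈ extIdeal A I)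

include hg in
theorem mem_step_iff {q m : ℕ} (t : CoChain A (Tw g) q) :
    t ∈ (chainFil A (Tw g) I q).step m ↔ reduction g I q m t = 0 :=
  Tw.mem_chainFil_iff hg t

theorem boundary_reduction (q m : ℕ) (t : CoChain A (Tw g) (q + 1)) :
    boundary (AdicCompletion I k) (quotPowEndo I g hg m) q (reduction g I (q + 1) m t) =
      reduction g I q m (cBoundary k q t) := by
  rw [Tw.cBoundary_eq]
  exact congrFun (congrArg Subtype.val (complBoundary_toCompl I g hg q t)) m

/-- A quotient of the filtered chains, as chains of `A / I ^ m`. -/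
def levelMap (q m : ℕ) : (chainFil A (Tw g) I q).Level m →ₗ[k] Chain (QuotPow A I m) q :=
  Submodule.liftQ _ (reduction g I q m) fun t ht => (mem_step_iff hg t).1 ht

theorem levelMap_proj (q m : ℕ) (t : CoChain A (Tw g) q) :
    levelMap hg q m ((chainFil A (Tw g) I q).proj m t) = reduction g I q m t := rfl

/-- The completion of the chains is the inverse limit of the chains of `A / I ^ m`. -/
def complMap (q : ℕ) :
    (chainFil A (Tw g) I q).Compl →ₗ[AdicCompletion I k] ComplChain A I q where
  toFun x := ⟨fun m => levelMap hg q m (x.1 m), fun m n h => by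
    obtain ⟨c, hc⟩ := AdicFil.proj_surjective _ n (x.1 n)
    dsimp only
    rw [← hc, AdicFil.compl_eq_proj _ x h hc.symm, levelMap_proj, levelMap_proj,
      chainMap_reduction]⟩
  map_add' x y := Subtype.ext (funext fun m => map_add (levelMap hg q m) (x.1 m) (y.1 m))
  map_smul' r x := Subtype.ext (funext fun m => by
    obtain ⟨z, hz⟩ := Ideal.Quotient.mk_surjective (AdicCompletion.evalₐ I m r)
    have h1 : (r • x).1 m = z • x.1 m := AdicFil.level_smul _ hz.symm (x.1 m)
    dsimp only
    rw [h1, map_smul]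
    exact (quotPow_chain_smul hz.symm _).symm)

theorem complMap_apply {q m : ℕ} {x : (chainFil A (Tw g) I q).Compl} {c : CoChain A (Tw g) q}
    (hc : x.1 m = (chainFil A (Tw g) I q).proj m c) :
    (complMap hg q x).1 m = reduction g I q m c := by
  change levelMap hg q m (x.1 m) = _
  rw [hc, levelMap_proj]

/-- Injectivity holds level by level, since each step is the kernel of the reduction. For
surjectivity, lifts of a compatible family form a Cauchy sequence for the same reason. -/
theorem complMap_bijective (q : ℕ) : Function.Bijective (complMap hg q) := by
  constructor
  · refine (injective_iff_map_eq_zero _).2 fun x hx => AdicFil.compl_ext fun m => ?_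
    obtain ⟨c, hc⟩ := AdicFil.proj_surjective _ m (x.1 m)
    have h0 : (complMap hg q x).1 m = 0 := by rw [hx]; rfl
    rw [complMap_apply hg hc.symm, ← mem_step_iff hg, ← AdicFil.proj_eq_zero, hc] at h0
    exact h0
  · intro y
    choose c hc using fun m => reduction_surjective (g := g) q m (y.1 m)
    refine ⟨AdicFil.ofSeq _ c fun m n h => ?_, Subtype.ext (funext fun m => ?_)⟩
    · rw [mem_step_iff hg, map_sub, hc, ← chainMap_reduction h, hc, y.2 m n h, sub_self]
    · rw [complMap_apply hg (AdicFil.ofSeq_apply _ c _ m), hc]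

theorem complBoundary_complMap (q : ℕ) (x : (chainFil A (Tw g) I (q + 1)).Compl) :
    complBoundary I g hg q (complMap hg (q + 1) x) =
      complMap hg q (complCBoundary A (Tw g) I q x) := by
  refine Subtype.ext (funext fun m => ?_)
  obtain ⟨c, hc⟩ := AdicFil.proj_surjective _ m (x.1 m)
  rw [complCBoundary, complMap_apply hg (AdicFil.map_apply cBoundary_mem_chainFil hc.symm)]
  change boundary (AdicCompletion I k) (quotPowEndo I g hg m) q ((complMap hg (q + 1) x).1 m) = _
  rw [complMap_apply hg hc.symm, boundary_reduction]

/-- The natural map to the completed chains, on chains with coefficients in the twisted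
bimodule. -/
def twToCompl (g : A →ₐ[ℂ] A) (I : Ideal k) (q : ℕ) : CoChain A (Tw g) q →ₗ[k] ComplChain A I q :=
  toCompl A I q

theorem twToCompl_eq (q : ℕ) (x : CoChain A (Tw g) q) :
    twToCompl g I q x = complMap hg q ((chainFil A (Tw g) I q).toCompletion x) := rfl

/-- The twisted Hochschild boundary, on chains with coefficients in the twisted bimodule. -/
def twBoundary (g : A →ₐ[ℂ] A) (q : ℕ) : CoChain A (Tw g) (q + 1) →ₗ[k] CoChain A (Tw g) q :=
  boundary k g q

theorem complBoundary_twToCompl (q : ℕ) (x : CoChain A (Tw g) (q + 1)) :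
    complBoundary I g hg q (twToCompl g I (q + 1) x) =
      twToCompl g I q (twBoundary (k := k) g q x) :=
  complBoundary_toCompl I g hg q x

theorem cBoundary_eq_twBoundary : cBoundary (A := A) (M := Tw g) k = twBoundary g :=
  funext fun q => Tw.cBoundary_eq g q

variable [Algebra.FiniteType ℂ k] [Module.Finite k A]

theorem finite_HH (g : A →ₐ[ℂ] A) (q : ℕ) : Module.Finite k (HH k g q) := by
  have : IsNoetherianRing k := Algebra.FiniteType.isNoetherianRing ℂ k
  have h := finite_homology (C := CoChain A (Tw g)) (cBoundary k) q
    (finiteHomology_and_comparison (k := k) (A := A) q (Tw g)).1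
  rw [cBoundary_eq_twBoundary] at h
  exact h

theorem comparisonInj_tw (q : ℕ) : ComparisonInj A (Tw g) I q :=
  ((finiteHomology_and_comparison (k := k) (A := A) q (Tw g)).2 I).2

theorem comparisonSurj_tw (q : ℕ) : ComparisonSurj A (Tw g) I q :=
  ((finiteHomology_and_comparison (k := k) (A := A) q (Tw g)).2 I).1

set_option maxHeartbeats 1000000 in
theorem bijective_naturalMap (q : ℕ) :
    Function.Bijective ((naturalMap I g hg q).liftBaseChange (AdicCompletion I k)) := by
  have : IsNoetherianRing k := Algebra.FiniteType.isNoetherianRing ℂ k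
  -- The chains with coefficients in `Tw g`, `twBoundary` and `twToCompl` unfold to the chains of
  -- `A`, `boundary` and `toCompl`, so the result is the assertion about the natural map by
  -- definition.
  have key := @bijective_homologyMap_of_comparison k A _ _ _ _ _ _ (Tw g) _ _ _ _ _ _ _ _ _ I
    (fun q => ComplChain A I q) _ _ _ _ _ (twBoundary g) cBoundary_eq_twBoundary
    (complBoundary I g hg) (twToCompl g I) (complBoundary_twToCompl hg) (complMap hg)
    (complBoundary_complMap hg) (complMap_bijective hg) (twToCompl_eq hg) q
    (comparisonInj_tw q) (comparisonSurj_tw q)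
  exact key

end Main

end TwistedHochschild

end

theorem mainTheorem8 {k A : Type*} [CommRing k] [Algebra ℂ k] [Algebra.FiniteType ℂ k]
    [Ring A] [Algebra ℂ A] [Algebra k A] [IsScalarTower ℂ k A] [Module.Finite k A]
    (g : A →ₐ[ℂ] A) (σ : k →ₐ[ℂ] k) (hσ : ∀ (z : k) (a : A), g (z • a) = σ z • g a) :
    (∀ q : ℕ, Module.Finite k (TwistedHochschild.HH k g q)) ∧
    ∀ (I₀ : Ideal k)
      (hI : ∀ a ∈ TwistedHochschild.extIdeal A I₀, g a ∈ TwistedHochschild.extIdeal A I₀) (q : ℕ),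
      Function.Bijective
        ((TwistedHochschild.naturalMap I₀ g hI q).liftBaseChange (AdicCompletion I₀ k)) := by
  exact ⟨fun q => TwistedHochschild.finite_HH g q,
    fun _ hI q => TwistedHochschild.bijective_naturalMap hI q⟩
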